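/- **Setting.** Fix $d\ge 1$; $|\cdot|$ denotes the Euclidean norm on $\mathbb R^d$ and Lebesgue measure. Cubes have sides parallel to the axes, $kQ$ is the concentric $k$-fold dilate of the cube $Q$, $\langle f\rangle_{p,Q}=|Q|^{-1/p}\|f\mathbf 1_Q\|_{p}$ and $\mathrm M_pf(x)=\sup_{Q\ni x}\langle f\rangle_{p,Q}$. Dyadic cubes are $Q=2^{s}(m+[0,1)^d)$ with $m\in\mathbb Z^d$ and scale $s_Q=s\in\mathbb Z$. Write $\langle g,h\rangle=\int gh$. *Sparse norm.* A countable collection $\mathcal S$ of cubes is $\tfrac12$-sparse if there are pairwise disjoint measurable $E_I\subset I$ ($I\in\mathcal S$) with $|E_I|\ge\frac12|I|$. For an operator $T$ on the bounded compactly supported complex functions $L^\infty_0(\mathbb R^d)$, $\|T\|_{(p_1,p_2),\mathsf{sparse}}$ is the least constant $c$ such that for all $f_1,f_2\in L^\infty_0(\mathbb R^d)$ there is a $\frac12$-sparse collection $\mathcal S$ with $|\langle Tf_1,f_2\rangle|\le c\sum_{Q\in\mathcal S}|Q|\langle f_1\rangle_{p_1,Q}\langle f_2\rangle_{p_2,Q}$.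 *Kernels.* Let $[K]=\{K_s:s\in\mathbb Z\}$ be measurable functions $\mathbb R^d\times\mathbb R^d\to\mathbb C$ with $$\operatorname{supp}K_s\subset\{|x-y|<2^s\},\qquad \sup_{s}2^{sd}\sup_x\big(\|K_s(x,\cdot)\|_\infty+\|K_s(\cdot,x)\|_\infty\big)<\infty .$$ Put $T[K]f(x,t_1,t_2)=\sum_{t_1<s\le t_2}\int K_s(x,y)f(y)\,dy$ for $t_1,t_2\in\mathbb Z$, $T_\star[K]f(x)=\sup_{t_1\le t_2}|T[K]f(x,t_1,t_2)|$, $\|[K]\|_{r,\star}=\|T_\star[K]\|_{L^r\to L^r}$, and, for bounded measurable $t_1,t_2:\mathbb R^d\to\mathbb Z$, $T[K]_{t_1}^{t_2}f(x)=T[K]f(x,t_1(x),t_2(x))$. *Stopping collections.* A stopping collection with top the dyadic cube $Q$ is a collection $\mathcal Q$ of pairwise disjoint dyadic cubes such that, with $\mathsf{sh}\mathcal Q=\bigcup_{L\in\mathcal Q}L$: (i) $\mathsf{sh}\mathcal Q\subset 3Q$; (ii) $9L\subset\mathsf{sh}\mathcal Q$ whenever $L\in\mathcal Q$ and $3L\cap2Q\ne\varnothing$;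 (iii) $|s_L-s_{L'}|\le8$ whenever $L,L'\in\mathcal Q$ and $3L\cap3L'\neq\varnothing$. *Atomic spaces.* $\mathcal Y_p(\mathcal Q)$ consists of the $f\in L^p(\mathbb R^d)$ supported in $3Q$ with finite norm $$\|f\|_{\mathcal Y_p(\mathcal Q)}=\max\Big\{\|f\mathbf 1_{\mathbb R^d\setminus\mathsf{sh}\mathcal Q}\|_\infty,\ \sup_{L\in\mathcal Q}\inf_{2^5L}\mathrm M_pf\Big\}\ (p<\infty),\qquad \|f\|_{\mathcal Y_\infty(\mathcal Q)}=\|f\|_\infty .$$ $\dot{\mathcal X}_p(\mathcal Q)$, with the same norm, consists of those $b\in\mathcal Y_p(\mathcal Q)$ of the form $b=\sum_{L\in\mathcal Q}b_L$ with $\operatorname{supp}b_L\subset L$ and $\int b_L=0$. *Localized forms.* With $\wedge$ the minimum, let $$\mathcal Q[K]_{t_1}^{t_2}(f_1,f_2)=\frac1{|Q|}\Big[\big\langle T[K]_{t_1}^{t_2\wedge s_Q}(f_1\mathbf 1_Q),f_2\big\rangle-\sum_{L\in\mathcal Q,\,L\subset Q}\big\langle T[K]_{t_1}^{t_2\wedge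 s_L}(f_1\mathbf 1_L),f_2\big\rangle\Big],$$ $$C_{\mathsf L}[K](p_1,p_2)=\sup_{\mathcal Q,t_1,t_2}\Bigg(\sup_{\substack{\|b\|_{\dot{\mathcal X}_{p_1}(\mathcal Q)}=1\\ \|f\|_{\mathcal Y_{p_2}(\mathcal Q)}=1}}\big|\mathcal Q[K]_{t_1}^{t_2}(b,f)\big|+\sup_{\substack{\|f\|_{\mathcal Y_\infty(\mathcal Q)}=1\\ \|b\|_{\dot{\mathcal X}_{p_2}(\mathcal Q)}=1}}\big|\mathcal Q[K]_{t_1}^{t_2}(f,b)\big|\Bigg),$$ the outer supremum being over all stopping collections $\mathcal Q$ (with any top $Q$) and all bounded measurable $t_1,t_2:\mathbb R^d\to\mathbb Z$. **Theorem.** There is a constant $C$ depending only on $d$ such that, for all $1<r<\infty$, all $1\le p_1,p_2<\infty$ and all families $[K]$ as above with $\|[K]\|_{r,\star}<\infty$ and $C_{\mathsf L}[K](p_1,p_2)<\infty$, $$\|T_\star[K]\|_{(p_1,p_2),\mathsf{sparse}}\le C\big(\|[K]\|_{r,\star}+C_{\mathsf L}[K](p_1,p_2)\big).$$ -/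

import Mathlib

open MeasureTheory Set
open scoped ENNReal NNReal

noncomputable section

namespace SparseDom

/-! ### Cubes -/

/-- An axis-parallel (half-open) cube `∏ᵢ [aᵢ, aᵢ + ℓ)` of `ℝ^d`, with `ℓ > 0`. -/
structure Cube (d : ℕ) where
  corner : Fin d → ℝ
  side : ℝ
  side_pos : 0 < side

/-- The point set of a cube. -/
def Cube.set {d : ℕ} (Q : Cube d) : Set (Fin d → ℝ) :=
  {x | ∀ i, x i ∈ Ico (Q.corner i) (Q.corner i + Q.side)}

/-- The center `c_Q` of a cube. -/
def Cube.center {d : ℕ} (Q : Cube d) : Fin d → ℝ := fun i => Q.corner i + Q.side / 2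

/-- The concentric dilate `k Q`. -/
def Cube.dilate {d : ℕ} (k : ℝ) (Q : Cube d) : Set (Fin d → ℝ) :=
  {x | ∀ i, x i ∈ Ico (Q.center i - k * Q.side / 2) (Q.center i + k * Q.side / 2)}

/-- A dyadic cube `2^s (m + [0,1)^d)`, given by its scale `s ∈ ℤ` and its index `m ∈ ℤ^d`. -/
structure DyadicCube (d : ℕ) where
  scale : ℤ
  index : Fin d → ℤ

/-- The dyadic cube `2^s (m + [0,1)^d)` as a cube. -/
def DyadicCube.toCube {d : ℕ} (Q : DyadicCube d) : Cube d where
  corner := fun i => (2 : ℝ) ^ Q.scale * (Q.index i : ℝ)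
  side := (2 : ℝ) ^ Q.scale
  side_pos := by positivity

/-- The point set of a dyadic cube. -/
def DyadicCube.set {d : ℕ} (Q : DyadicCube d) : Set (Fin d → ℝ) := Q.toCube.set

/-- The concentric dilate `k Q` of a dyadic cube. -/
def DyadicCube.dilate {d : ℕ} (k : ℝ) (Q : DyadicCube d) : Set (Fin d → ℝ) :=
  Q.toCube.dilate k

/-! ### Averages, the maximal function, sparse bounds -/

/-- The average `⟨f⟩_{p,Q} = ‖f 1_Q‖_p / |Q|^{1/p}` (for `p = ∞` this is `‖f 1_Q‖_∞`). -/
def average {d : ℕ} (p : ℝ≥0∞) (Q : Cube d) (f : (Fin d → ℝ) → ℂ) : ℝ≥0∞ :=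
  eLpNorm (Q.set.indicator f) p volume / (volume Q.set) ^ (1 / p.toReal)

/-- The `p`-Hardy-Littlewood maximal function, the supremum being over all cubes containing `x`. -/
def maximalFunction {d : ℕ} (p : ℝ≥0∞) (f : (Fin d → ℝ) → ℂ) (x : Fin d → ℝ) : ℝ≥0∞ :=
  ⨆ (Q : Cube d) (_ : x ∈ Q.set), average p Q f

/-- A countable collection `S` of cubes is `η`-sparse. -/
def IsSparse {d : ℕ} (η : ℝ≥0∞) (S : Set (Cube d)) : Prop :=
  S.Countable ∧ ∃ E : Cube d → Set (Fin d → ℝ),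
    (∀ I ∈ S, MeasurableSet (E I) ∧ E I ⊆ I.set ∧ η * volume I.set ≤ volume (E I)) ∧
    (∀ I ∈ S, ∀ J ∈ S, I ≠ J → E I ∩ E J = ∅)

/-- The space `L^∞_0(ℝ^d)` of complex-valued, bounded and compactly supported functions. -/
def IsBoundedCompactlySupported {d : ℕ} (f : (Fin d → ℝ) → ℂ) : Prop :=
  MemLp f ∞ volume ∧ HasCompactSupport f

/-- `T` has the sparse `(p₁,p₂)` bound with constant `c`. Here `T` takes values in nonnegative
functions, and the sparse form sees only `|f₂|`, so that bounding `|⟨T f₁, f₂⟩|` for all `f₂` is the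
same as bounding `⟨T f₁, |f₂|⟩` for all `f₂`; the latter pairing is always meaningful. -/
def HasSparseBound {d : ℕ} (p₁ p₂ : ℝ≥0∞) (T : ((Fin d → ℝ) → ℂ) → (Fin d → ℝ) → ℝ≥0∞)
    (c : ℝ≥0) : Prop :=
  ∀ f₁ f₂ : (Fin d → ℝ) → ℂ, IsBoundedCompactlySupported f₁ → IsBoundedCompactlySupported f₂ →
    ∃ S : Set (Cube d), IsSparse (1 / 2) S ∧
      ∫⁻ x, T f₁ x * ‖f₂ x‖ₑ ≤
        c * ∑' Q : S, volume (Q : Cube d).set * (average p₁ Q f₁ * average p₂ Q f₂)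

/-- The sparse norm `‖T‖_{(p₁,p₂),sparse}`: the infimum of the admissible constants `c > 0`
(`∞` if there are none). -/
def sparseNorm {d : ℕ} (p₁ p₂ : ℝ≥0∞) (T : ((Fin d → ℝ) → ℂ) → (Fin d → ℝ) → ℝ≥0∞) : ℝ≥0∞ :=
  ⨅ (c : ℝ≥0) (_ : 0 < c) (_ : HasSparseBound p₁ p₂ T c), (c : ℝ≥0∞)

/-! ### Families of kernels and their maximal truncations -/

/-- The size constant `‖[K]‖ = sup_s 2^{sd} sup_x (‖K_s(x,·)‖_∞ + ‖K_s(·,x)‖_∞)`. -/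
def kernelSize {d : ℕ} (K : ℤ → (Fin d → ℝ) → (Fin d → ℝ) → ℂ) : ℝ≥0∞ :=
  ⨆ s : ℤ, (2 : ℝ≥0∞) ^ (s * (d : ℤ)) *
    ⨆ x : Fin d → ℝ,
      (eLpNorm (fun y => K s x y) ∞ volume + eLpNorm (fun y => K s y x) ∞ volume)

/-- The support and size assumptions on a family of (measurable) kernels; the support condition
is `|x - y| < 2^s` for the Euclidean norm. -/
structure IsKernelFamily {d : ℕ} (K : ℤ → (Fin d → ℝ) → (Fin d → ℝ) → ℂ) : Prop where
  measurable : ∀ s, Measurable (Function.uncurry (K s))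
  support : ∀ s x y, K s x y ≠ 0 → √(∑ i, (x i - y i) ^ 2) < (2 : ℝ) ^ s
  size : kernelSize K < ∞

/-- `T[K]f(x,t₁,t₂) = ∑_{t₁ < s ≤ t₂} ∫ K_s(x,y) f(y) dy`. -/
def truncation {d : ℕ} (K : ℤ → (Fin d → ℝ) → (Fin d → ℝ) → ℂ) (f : (Fin d → ℝ) → ℂ)
    (x : Fin d → ℝ) (t₁ t₂ : ℤ) : ℂ :=
  ∑ s ∈ Finset.Ioc t₁ t₂, ∫ y, K s x y * f y

/-- The maximal truncation `T_⋆[K]f(x) = sup_{t₁ ≤ t₂} |T[K]f(x,t₁,t₂)|`. -/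
def maximalTruncation {d : ℕ} (K : ℤ → (Fin d → ℝ) → (Fin d → ℝ) → ℂ) (f : (Fin d → ℝ) → ℂ)
    (x : Fin d → ℝ) : ℝ≥0∞ :=
  ⨆ (t₁ : ℤ) (t₂ : ℤ) (_ : t₁ ≤ t₂), ‖truncation K f x t₁ t₂‖ₑ

/-- `‖[K]‖_{r,⋆}`, the operator norm of `T_⋆[K]` on `L^r(ℝ^d)`. -/
def maximalNorm {d : ℕ} (r : ℝ≥0∞) (K : ℤ → (Fin d → ℝ) → (Fin d → ℝ) → ℂ) : ℝ≥0∞ :=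
  ⨆ (f : (Fin d → ℝ) → ℂ) (_ : MemLp f r volume) (_ : eLpNorm f r volume ≤ 1),
    eLpNorm (maximalTruncation K f) r volume

/-! ### Stopping collections and their atomic spaces -/

/-- The shadow `sh 𝒬 = ⋃_{L ∈ 𝒬} L`. -/
def shadow {d : ℕ} (𝒬 : Set (DyadicCube d)) : Set (Fin d → ℝ) := ⋃ L ∈ 𝒬, L.set

/-- `𝒬` is a stopping collection with top `Q`. -/
structure IsStoppingCollection {d : ℕ} (Q : DyadicCube d) (𝒬 : Set (DyadicCube d)) : Prop where
  shadow_subset : shadow 𝒬 ⊆ Q.dilate 3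
  dilate_subset : ∀ L ∈ 𝒬, (L.dilate 3 ∩ Q.dilate 2).Nonempty → L.dilate 9 ⊆ shadow 𝒬
  disjoint : ∀ L ∈ 𝒬, ∀ L' ∈ 𝒬, (L.set ∩ L'.set).Nonempty → L = L'
  scale_le : ∀ L ∈ 𝒬, ∀ L' ∈ 𝒬, (L.dilate 3 ∩ L'.dilate 3).Nonempty →
    |L.scale - L'.scale| ≤ 8

/-- The norm `‖f‖_{𝒴_p(𝒬)}`; `L.dilate (2 ^ 5)` is the `2^5`-fold dilate `L̂` of `L`. -/
def normY {d : ℕ} (p : ℝ≥0∞) (𝒬 : Set (DyadicCube d)) (f : (Fin d → ℝ) → ℂ) : ℝ≥0∞ :=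
  if p = ∞ then eLpNorm f ∞ volume
  else max (eLpNorm ((shadow 𝒬)ᶜ.indicator f) ∞ volume)
    (⨆ L ∈ 𝒬, ⨅ x ∈ L.dilate (2 ^ 5), maximalFunction p f x)

/-- Membership in `𝒴_p(𝒬)`. -/
structure MemY {d : ℕ} (p : ℝ≥0∞) (Q : DyadicCube d) (𝒬 : Set (DyadicCube d))
    (f : (Fin d → ℝ) → ℂ) : Prop where
  memLp : MemLp f p volume
  support : ∀ᵐ x, x ∉ Q.dilate 3 → f x = 0
  norm_lt : normY p 𝒬 f < ∞

/-- Membership in `𝒳̇_p(𝒬)`, normed by `‖·‖_{𝒴_p(𝒬)}`. Since the cubes of `𝒬` are pairwise disjoint,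
the pieces of a decomposition `b = ∑_L b_L` with `supp b_L ⊆ L` can only be `b_L = b 1_L`, and such a
decomposition exists exactly when `b` vanishes off the shadow. -/
structure MemXdot {d : ℕ} (p : ℝ≥0∞) (Q : DyadicCube d) (𝒬 : Set (DyadicCube d))
    (b : (Fin d → ℝ) → ℂ) : Prop where
  memY : MemY p Q 𝒬 b
  support : ∀ᵐ x, x ∉ shadow 𝒬 → b x = 0
  mean_zero : ∀ L ∈ 𝒬, ∫ x in L.set, b x = 0

/-- Bounded measurable functions `ℝ^d → ℤ`. -/
def IsTruncationFunction {d : ℕ} (t : (Fin d → ℝ) → ℤ) : Prop :=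
  Measurable t ∧ ∃ N : ℤ, ∀ x, |t x| ≤ N

/-- The pairing `⟨T[K]_{t₁}^{t₂ ∧ σ} f₁, f₂⟩` for a constant `σ ∈ ℤ`. -/
def linearizedPairing {d : ℕ} (K : ℤ → (Fin d → ℝ) → (Fin d → ℝ) → ℂ)
    (t₁ t₂ : (Fin d → ℝ) → ℤ) (σ : ℤ) (f₁ f₂ : (Fin d → ℝ) → ℂ) : ℂ :=
  ∫ x, truncation K f₁ x (t₁ x) (min (t₂ x) σ) * f₂ x

/-- The localized truncated bilinear form `𝒬[K]_{t₁}^{t₂}(f₁,f₂)`. As `t₁` is bounded below, the sum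
over the (pairwise disjoint) `L ∈ 𝒬`, `L ⊆ Q`, has only finitely many nonzero terms. -/
def localizedForm {d : ℕ} (K : ℤ → (Fin d → ℝ) → (Fin d → ℝ) → ℂ)
    (t₁ t₂ : (Fin d → ℝ) → ℤ) (Q : DyadicCube d) (𝒬 : Set (DyadicCube d))
    (f₁ f₂ : (Fin d → ℝ) → ℂ) : ℂ :=
  ((volume Q.set).toReal : ℂ)⁻¹ *
    (linearizedPairing K t₁ t₂ Q.scale (Q.set.indicator f₁) f₂ -
      ∑' L : {L : DyadicCube d // L ∈ 𝒬 ∧ L.set ⊆ Q.set},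
        linearizedPairing K t₁ t₂ L.1.scale (L.1.set.indicator f₁) f₂)

/-- The constant `C_L[K](p₁,p₂)`: the supremum, over all stopping collections `𝒬` and all bounded
measurable `t₁, t₂`, of
`sup |𝒬[K]_{t₁}^{t₂}(b,f)| + sup |𝒬[K]_{t₁}^{t₂}(f,b)|`,
the first supremum being over the unit spheres of `𝒳̇_{p₁}(𝒬) × 𝒴_{p₂}(𝒬)` and the second
over those of `𝒴_∞(𝒬) × 𝒳̇_{p₂}(𝒬)`. -/
def localizedConstant {d : ℕ} (p₁ p₂ : ℝ≥0∞)
    (K : ℤ → (Fin d → ℝ) → (Fin d → ℝ) → ℂ) : ℝ≥0∞ :=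
  ⨆ (Q : DyadicCube d) (𝒬 : Set (DyadicCube d)) (_ : IsStoppingCollection Q 𝒬)
    (t₁ : (Fin d → ℝ) → ℤ) (_ : IsTruncationFunction t₁)
    (t₂ : (Fin d → ℝ) → ℤ) (_ : IsTruncationFunction t₂),
    ((⨆ (b : (Fin d → ℝ) → ℂ) (_ : MemXdot p₁ Q 𝒬 b) (_ : normY p₁ 𝒬 b = 1)
        (f : (Fin d → ℝ) → ℂ) (_ : MemY p₂ Q 𝒬 f) (_ : normY p₂ 𝒬 f = 1),
        ‖localizedForm K t₁ t₂ Q 𝒬 b f‖ₑ) +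
      ⨆ (f : (Fin d → ℝ) → ℂ) (_ : MemY ∞ Q 𝒬 f) (_ : normY ∞ 𝒬 f = 1)
        (b : (Fin d → ℝ) → ℂ) (_ : MemXdot p₂ Q 𝒬 b) (_ : normY p₂ 𝒬 b = 1),
        ‖localizedForm K t₁ t₂ Q 𝒬 f b‖ₑ)

end SparseDom

end

/-! The maximal operator is linearized, and the linearized pairing is expanded by a stopping-time
recursion over dyadic cubes.

The pairing of `maximalTruncation` with `|f₂|` is finite by the `L^r` bound, so bounded measurable
`t₁, t₂` recover more than half of it (`exists_lt_lintegral_truncation`). After `f₂` is multiplied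
by a phase, it remains to dominate one bilinear pairing. The function `f₁` is cut along finitely
many dyadic cubes `Q` so large that truncating at the scale of `Q` changes nothing.

For a given `Q`, let `E` be the open set where a local maximal function of `f₁ 1_{3Q}` or of `f₂
1_{3Q}` exceeds a large dimensional multiple of its average over `3Q`. The Whitney cubes of `E` in
`3Q` form a stopping collection whose shadow has at most half the measure of `Q`
(`exists_stoppingCollection`). The pairing on `Q` equals `localizedDifference` plus the pairings on
the stopping cubes inside `Q`. The difference is estimated by a Calderón–Zygmund decomposition of
both functions (`exists_calderonZygmund`): good against good by the `L^r` norm of the maximal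
truncation, every term with a bad function by `localizedConstant`. This gives the product of the
averages over `3Q` times `|Q|` (`exists_stopping_estimate`). The same argument applies to the
stopping cubes. The recursion ends because `t₁` is bounded below: at scales below that bound the
pairing vanishes. The halving of measure makes the cubes produced a Carleson family
(`exists_carleson_domination`).

The averages live on triples `3R`, which are not nested in general. They split into `3^d` residue
classes of nested triples, and taking generations modulo a fixed `m` makes each class a union of `m`
sparse families. The best of these `3^d m` families dominates the whole sum
(`isSparse_of_generation`, `exists_sparse_domination`).

The constant depends on `d` alone because thresholds and dilation factors are at least `1`: they are
never replaced by their `p`-th roots, and the powers `1/r` and `1 - 1/r` of a measure recombine to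
the measure itself. -/

noncomputable section

namespace SparseDom

section

variable {d : ℕ}

/-! ### Geometry of cubes -/

lemma Cube.set_eq_pi (Q : Cube d) :
    Q.set = Set.univ.pi fun i => Ico (Q.corner i) (Q.corner i + Q.side) := by
  ext x; simp [Cube.set]

lemma Cube.measurableSet_set (Q : Cube d) : MeasurableSet Q.set := by
  rw [Q.set_eq_pi]
  exact MeasurableSet.univ_pi fun i => measurableSet_Ico

lemma Cube.volume_set (Q : Cube d) : volume Q.set = ENNReal.ofReal Q.side ^ d := by
  rw [Q.set_eq_pi, Real.volume_pi_Ico]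
  simp

lemma Cube.volume_pos (Q : Cube d) : 0 < volume Q.set := by
  rw [Q.volume_set]
  exact (pow_ne_zero _ (by simpa using Q.side_pos)).bot_lt

lemma Cube.volume_ne_zero (Q : Cube d) : volume Q.set ≠ 0 := Q.volume_pos.ne'

lemma Cube.volume_ne_top (Q : Cube d) : volume Q.set ≠ ∞ := by
  rw [Q.volume_set]
  exact ENNReal.pow_ne_top ENNReal.ofReal_ne_top

lemma Cube.volume_le_of_side_le {Q R : Cube d} {c : ℝ≥0} (h : R.side ≤ c * Q.side) :
    volume R.set ≤ (c : ℝ≥0∞) ^ d * volume Q.set := by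
  rw [Q.volume_set, R.volume_set, ← mul_pow]
  gcongr
  refine (ENNReal.ofReal_le_ofReal h).trans_eq ?_
  rw [ENNReal.ofReal_mul c.coe_nonneg, ENNReal.ofReal_coe_nnreal]

/-- The concentric dilate of a cube, as a cube. -/
def Cube.scaleBy (k : ℝ) (hk : 0 < k) (Q : Cube d) : Cube d where
  corner := fun i => Q.center i - k * Q.side / 2
  side := k * Q.side
  side_pos := mul_pos hk Q.side_pos

lemma Cube.set_scaleBy (k : ℝ) (hk : 0 < k) (Q : Cube d) :
    (Q.scaleBy k hk).set = Q.dilate k := by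
  ext x
  simp only [Cube.set, Cube.scaleBy, Cube.dilate, mem_ofPred_eq]
  refine forall_congr' fun i => ?_
  rw [show Q.center i - k * Q.side / 2 + k * Q.side = Q.center i + k * Q.side / 2 by ring]

lemma Cube.volume_scaleBy (k : ℝ≥0) (hk : 0 < (k : ℝ)) (Q : Cube d) :
    volume (Q.scaleBy k hk).set = (k : ℝ≥0∞) ^ d * volume Q.set := by
  rw [Cube.volume_set, Cube.volume_set, ← mul_pow]
  simp only [Cube.scaleBy]
  rw [ENNReal.ofReal_mul k.coe_nonneg, ENNReal.ofReal_coe_nnreal]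

/-- The open box of a cube. -/
def Cube.openSet (Q : Cube d) : Set (Fin d → ℝ) :=
  Set.univ.pi fun i => Ioo (Q.corner i) (Q.corner i + Q.side)

lemma Cube.isOpen_openSet (Q : Cube d) : IsOpen Q.openSet :=
  isOpen_set_pi Set.finite_univ fun _ _ => isOpen_Ioo

lemma Cube.mem_openSet {Q : Cube d} {x : Fin d → ℝ} :
    x ∈ Q.openSet ↔ ∀ i, Q.corner i < x i ∧ x i < Q.corner i + Q.side := by
  simp [Cube.openSet]

lemma Cube.mem_set {Q : Cube d} {x : Fin d → ℝ} :
    x ∈ Q.set ↔ ∀ i, Q.corner i ≤ x i ∧ x i < Q.corner i + Q.side := by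
  simp [Cube.set]

lemma Cube.center_mem_openSet (Q : Cube d) : Q.center ∈ Q.openSet := by
  rw [Cube.mem_openSet]
  intro i
  have := Q.side_pos
  simp only [Cube.center]
  constructor <;> linarith

lemma Cube.openSet_subset (Q : Cube d) : Q.openSet ⊆ Q.set := fun x hx => by
  rw [Cube.mem_openSet] at hx
  rw [Cube.mem_set]
  exact fun i => ⟨(hx i).1.le, (hx i).2⟩

lemma Cube.nonempty_set (Q : Cube d) : Q.set.Nonempty :=
  ⟨_, Q.openSet_subset Q.center_mem_openSet⟩

lemma Cube.set_subset_openSet_scaleBy_two (Q : Cube d) :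
    Q.set ⊆ (Q.scaleBy 2 two_pos).openSet := fun x hx => by
  rw [Cube.mem_set] at hx
  rw [Cube.mem_openSet]
  intro i
  have := hx i
  have := Q.side_pos
  simp only [Cube.scaleBy, Cube.center]
  constructor <;> linarith

lemma Cube.openSet_subset_closedBall (Q : Cube d) :
    Q.openSet ⊆ Metric.closedBall Q.center (Q.side / 2) := fun x hx => by
  rw [Cube.mem_openSet] at hx
  have hs := Q.side_pos
  rw [Metric.mem_closedBall, dist_pi_le_iff (by positivity)]
  intro i
  have := hx i
  rw [Real.dist_eq, abs_le]
  simp only [Cube.center]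
  constructor <;> linarith

lemma Cube.set_subset_closedBall (Q : Cube d) :
    Q.set ⊆ Metric.closedBall Q.center (Q.side / 2) := fun x hx => by
  rw [Cube.mem_set] at hx
  have hs := Q.side_pos
  rw [Metric.mem_closedBall, dist_pi_le_iff (by positivity)]
  intro i
  have := hx i
  rw [Real.dist_eq, abs_le]
  simp only [Cube.center]
  constructor <;> linarith

lemma Cube.volume_closedBall (Q : Cube d) {τ : ℝ≥0} :
    volume (Metric.closedBall Q.center (τ * (Q.side / 2))) = (τ : ℝ≥0∞) ^ d * volume Q.set := by
  have hs := Q.side_pos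
  rw [Real.volume_pi_closedBall _ (by positivity), Cube.volume_set, ← mul_pow,
    ENNReal.ofReal_pow (by positivity), Fintype.card_fin]
  congr 1
  rw [show 2 * ((τ : ℝ) * (Q.side / 2)) = τ * Q.side by ring, ENNReal.ofReal_mul τ.coe_nonneg,
    ENNReal.ofReal_coe_nnreal]

lemma Cube.set_ae_eq_closedBall (Q : Cube d) :
    Q.set =ᵐ[volume] Metric.closedBall Q.center (Q.side / 2) := by
  refine ae_eq_of_subset_of_measure_ge Q.set_subset_closedBall ?_
    Q.measurableSet_set.nullMeasurableSet ?_
  · have := Q.volume_closedBall (τ := 1)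
    simp only [NNReal.coe_one, one_mul, ENNReal.coe_one, one_pow] at this
    exact this.le
  · exact (isCompact_closedBall _ _).measure_lt_top.ne

/-! ### Dyadic cubes: dilates, nesting, containing cubes. -/

lemma DyadicCube.mem_set {L : DyadicCube d} {x : Fin d → ℝ} :
    x ∈ L.set ↔ ∀ i, (2 : ℝ) ^ L.scale * L.index i ≤ x i ∧
      x i < (2 : ℝ) ^ L.scale * L.index i + (2 : ℝ) ^ L.scale := by
  simp [DyadicCube.set, Cube.set, DyadicCube.toCube]

lemma DyadicCube.mem_dilate {k : ℝ} {L : DyadicCube d} {x : Fin d → ℝ} :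
    x ∈ L.dilate k ↔ ∀ i, L.toCube.center i - k * (2 : ℝ) ^ L.scale / 2 ≤ x i ∧
      x i < L.toCube.center i + k * (2 : ℝ) ^ L.scale / 2 := by
  simp [DyadicCube.dilate, Cube.dilate, DyadicCube.toCube]

lemma DyadicCube.mem_set_iff_center {L : DyadicCube d} {x : Fin d → ℝ} :
    x ∈ L.set ↔ ∀ i, L.toCube.center i - (2 : ℝ) ^ L.scale / 2 ≤ x i ∧
      x i < L.toCube.center i + (2 : ℝ) ^ L.scale / 2 := by
  rw [DyadicCube.mem_set]
  refine forall_congr' fun i => ?_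
  simp only [Cube.center, DyadicCube.toCube]
  constructor <;> rintro ⟨h1, h2⟩ <;> constructor <;> linarith

lemma DyadicCube.dilate_eq {k : ℝ} (hk : 0 < k) (L : DyadicCube d) :
    L.dilate k = (L.toCube.scaleBy k hk).set := (Cube.set_scaleBy _ _ _).symm

lemma DyadicCube.measurableSet_set (L : DyadicCube d) : MeasurableSet L.set :=
  L.toCube.measurableSet_set

lemma DyadicCube.measurableSet_dilate (L : DyadicCube d) {k : ℝ} (hk : 0 < k) :
    MeasurableSet (L.dilate k) := by
  rw [L.dilate_eq hk]; exact Cube.measurableSet_set _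

lemma DyadicCube.volume_dilate (L : DyadicCube d) {k : ℝ≥0} (hk : 0 < (k : ℝ)) :
    volume (L.dilate k) = (k : ℝ≥0∞) ^ d * volume L.set := by
  rw [L.dilate_eq hk]; exact Cube.volume_scaleBy _ _ _

lemma DyadicCube.volume_dilate_three (L : DyadicCube d) :
    volume (L.dilate 3) = 3 ^ d * volume L.set := by
  simpa using L.volume_dilate (k := 3) (by norm_num)

lemma DyadicCube.subset_dilate {k : ℝ} (hk : 1 ≤ k) (L : DyadicCube d) : L.set ⊆ L.dilate k := by
  intro x hx
  rw [DyadicCube.mem_set_iff_center] at hx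
  rw [DyadicCube.mem_dilate]
  intro i
  have h := hx i
  have hp : (0 : ℝ) < 2 ^ L.scale := by positivity
  constructor <;> nlinarith

lemma DyadicCube.volume_ne_zero (L : DyadicCube d) : volume L.set ≠ 0 := L.toCube.volume_ne_zero

lemma DyadicCube.volume_ne_top (L : DyadicCube d) : volume L.set ≠ ∞ := L.toCube.volume_ne_top

lemma DyadicCube.nonempty_set (L : DyadicCube d) : L.set.Nonempty := L.toCube.nonempty_set

lemma DyadicCube.volume_set (L : DyadicCube d) :
    volume L.set = ENNReal.ofReal ((2 : ℝ) ^ L.scale) ^ d := L.toCube.volume_set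

lemma DyadicCube.ext_scale_index {L L' : DyadicCube d} (h : L.scale = L'.scale)
    (h' : L.index = L'.index) : L = L' := by
  cases L; cases L'; simp_all

instance : Countable (DyadicCube d) :=
  Function.Injective.countable (f := fun L : DyadicCube d => (L.scale, L.index)) fun L L' h => by
    simp only [Prod.mk.injEq] at h
    exact DyadicCube.ext_scale_index h.1 h.2

/-- The dyadic cube of scale `s` containing `x`. -/
def dyadicAt (s : ℤ) (x : Fin d → ℝ) : DyadicCube d where
  scale := s
  index := fun i => ⌊x i / 2 ^ s⌋

lemma mem_set_iff_dyadicAt {L : DyadicCube d} {x : Fin d → ℝ} :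
    x ∈ L.set ↔ dyadicAt L.scale x = L := by
  have hp : (0 : ℝ) < 2 ^ L.scale := by positivity
  have key : x ∈ L.set ↔ ∀ i, ⌊x i / 2 ^ L.scale⌋ = L.index i := by
    rw [DyadicCube.mem_set]
    refine forall_congr' fun i => ?_
    rw [Int.floor_eq_iff, le_div_iff₀ hp, div_lt_iff₀ hp]
    constructor <;> rintro ⟨h1, h2⟩ <;> constructor <;> linarith
  rw [key]
  constructor
  · intro h; exact DyadicCube.ext_scale_index rfl (funext h)
  · intro h i; exact congrFun (congrArg DyadicCube.index h) i

lemma mem_dyadicAt (s : ℤ) (x : Fin d → ℝ) : x ∈ (dyadicAt s x).set :=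
  mem_set_iff_dyadicAt.2 rfl

/-- Dyadic nesting: the coarse index is the integer quotient of the fine index by a power of two. -/
lemma dyadicAt_eq_of_le {s s' : ℤ} (hs : s ≤ s') {x y : Fin d → ℝ}
    (h : dyadicAt s x = dyadicAt s y) : dyadicAt s' x = dyadicAt s' y := by
  refine DyadicCube.ext_scale_index rfl (funext fun i => ?_)
  have hi : ⌊x i / 2 ^ s⌋ = ⌊y i / 2 ^ s⌋ := congrFun (congrArg DyadicCube.index h) i
  obtain ⟨k, rfl⟩ := Int.le.dest hs
  have key : ∀ z : ℝ, ⌊z / 2 ^ (s + (k : ℤ))⌋ = ⌊z / 2 ^ s⌋ / ((2 ^ k : ℕ) : ℤ) := by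
    intro z
    rw [← Int.floor_div_natCast, zpow_add₀ two_ne_zero, zpow_natCast, div_div]
    push_cast
    rfl
  change ⌊x i / 2 ^ (s + (k : ℤ))⌋ = ⌊y i / 2 ^ (s + (k : ℤ))⌋
  rw [key, key, hi]

lemma DyadicCube.subset_of_mem {L L' : DyadicCube d} (hs : L.scale ≤ L'.scale) {x : Fin d → ℝ}
    (hx : x ∈ L.set) (hx' : x ∈ L'.set) : L.set ⊆ L'.set := by
  intro y hy
  rw [mem_set_iff_dyadicAt] at *
  rw [← hx']
  exact dyadicAt_eq_of_le hs (hy.trans hx.symm)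

lemma DyadicCube.eq_of_mem {L L' : DyadicCube d} (hs : L.scale = L'.scale) {x : Fin d → ℝ}
    (hx : x ∈ L.set) (hx' : x ∈ L'.set) : L = L' := by
  rw [mem_set_iff_dyadicAt] at hx hx'
  rw [← hx, ← hx', hs]

lemma DyadicCube.abs_center_sub_le {L L' : DyadicCube d} (hd : L.set ⊆ L'.set) (i : Fin d) :
    L'.toCube.center i - 2 ^ L'.scale / 2 ≤ L.toCube.center i - 2 ^ L.scale / 2 ∧
    L.toCube.center i + 2 ^ L.scale / 2 ≤ L'.toCube.center i + 2 ^ L'.scale / 2 := by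
  have hp : (0 : ℝ) < 2 ^ L.scale := by positivity
  have hlow : (fun j => L.toCube.center j - 2 ^ L.scale / 2) ∈ L.set := by
    rw [DyadicCube.mem_set_iff_center]; intro j; constructor <;> linarith
  have h1 := (DyadicCube.mem_set_iff_center.1 (hd hlow) i).1
  refine ⟨h1, ?_⟩
  by_contra! hc
  -- The upper face of a half-open cube is not attained, so a point of `L` with `i`-th coordinate on
  -- or beyond the upper face of `L'` is used instead.
  set e : ℝ := max (L'.toCube.center i + 2 ^ L'.scale / 2) (L.toCube.center i - 2 ^ L.scale / 2)
    with he
  have hmem : (fun j => if j = i then e else L.toCube.center j - 2 ^ L.scale / 2) ∈ L.set := by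
    rw [DyadicCube.mem_set_iff_center]
    intro j
    by_cases hj : j = i
    · subst hj
      simp only [if_true]
      exact ⟨le_max_right _ _, max_lt hc (by linarith)⟩
    · simp only [hj, if_false]
      constructor <;> linarith
  have h2 := (DyadicCube.mem_set_iff_center.1 (hd hmem) i).2
  simp only [if_true] at h2
  exact absurd (le_max_left _ _) (not_le.2 (he ▸ h2))

lemma DyadicCube.dilate_subset_dilate {L L' : DyadicCube d} (h : L.set ⊆ L'.set) {k : ℝ}
    (hk : 1 ≤ k) : L.dilate k ⊆ L'.dilate k := by
  intro x hx
  rw [DyadicCube.mem_dilate] at hx ⊢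
  intro i
  have h1 := hx i
  have h2 := DyadicCube.abs_center_sub_le h i
  have hle : (2 : ℝ) ^ L.scale ≤ 2 ^ L'.scale := by linarith
  constructor <;> nlinarith

lemma DyadicCube.scale_le_of_subset [Nonempty (Fin d)] {L L' : DyadicCube d}
    (h : L.set ⊆ L'.set) : L.scale ≤ L'.scale := by
  have h2 := DyadicCube.abs_center_sub_le h (Classical.arbitrary _)
  have hle : (2 : ℝ) ^ L.scale ≤ 2 ^ L'.scale := by linarith
  exact (zpow_le_zpow_iff_right₀ one_lt_two).1 hle

end

section

variable {d : ℕ}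

/-! ### Averages over cubes -/

lemma average_eq_restrict (p : ℝ≥0∞) (Q : Cube d) (f : (Fin d → ℝ) → ℂ) :
    average p Q f = eLpNorm f p (volume.restrict Q.set) / (volume Q.set) ^ (1 / p.toReal) := by
  rw [average, eLpNorm_indicator_eq_eLpNorm_restrict Q.measurableSet_set]

lemma average_mono {p : ℝ≥0∞} {Q : Cube d} {f g : (Fin d → ℝ) → ℂ}
    (h : ∀ᵐ x, x ∈ Q.set → ‖f x‖ₑ ≤ ‖g x‖ₑ) : average p Q f ≤ average p Q g := by
  rw [average_eq_restrict, average_eq_restrict]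
  gcongr
  exact eLpNorm_mono_enorm_ae ((ae_restrict_iff' Q.measurableSet_set).2 h)

lemma average_rpow {p : ℝ≥0∞} (hp1 : 1 ≤ p) (hp : p ≠ ∞) (Q : Cube d) (f : (Fin d → ℝ) → ℂ) :
    average p Q f ^ p.toReal = (∫⁻ x in Q.set, ‖f x‖ₑ ^ p.toReal) / volume Q.set := by
  have hp0 : p ≠ 0 := (zero_lt_one.trans_le hp1).ne'
  have hpos : 0 < p.toReal := ENNReal.toReal_pos hp0 hp
  rw [average_eq_restrict, ENNReal.div_rpow_of_nonneg _ _ hpos.le,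
    eLpNorm_eq_lintegral_rpow_enorm_toReal hp0 hp, ← ENNReal.rpow_mul, ← ENNReal.rpow_mul]
  simp [hpos.ne']

lemma average_le_of_ae_le {p : ℝ≥0∞} {Q : Cube d} {f : (Fin d → ℝ) → ℂ} {M : ℝ≥0∞}
    (h : ∀ᵐ x, x ∈ Q.set → ‖f x‖ₑ ≤ M) : average p Q f ≤ M := by
  rw [average_eq_restrict]
  refine ENNReal.div_le_of_le_mul ?_
  have := eLpNorm_le_of_ae_enorm_bound (p := p)
    ((ae_restrict_iff' Q.measurableSet_set).2 h)
  simpa using this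

lemma average_add_le {p : ℝ≥0∞} (hp1 : 1 ≤ p) {Q : Cube d} {f g : (Fin d → ℝ) → ℂ}
    (hf : AEStronglyMeasurable f) (hg : AEStronglyMeasurable g) :
    average p Q (f + g) ≤ average p Q f + average p Q g := by
  simp only [average_eq_restrict]
  rw [← ENNReal.add_div]
  gcongr
  exact eLpNorm_add_le hf.restrict hg.restrict hp1

/-- The sharp factor would be `C^{1/p}`; since `C ≥ 1`, the cruder `C` is valid and does not depend
on `p`. -/
lemma average_le_mul_of_subset {p : ℝ≥0∞} (hp1 : 1 ≤ p) (hp : p ≠ ∞) {R R' : Cube d}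
    {C : ℝ≥0∞} (hC : 1 ≤ C) (hsub : R.set ⊆ R'.set)
    (hvol : volume R'.set ≤ C * volume R.set) (f : (Fin d → ℝ) → ℂ) :
    average p R f ≤ C * average p R' f := by
  have hp0 : p ≠ 0 := (zero_lt_one.trans_le hp1).ne'
  have hpos : 0 < p.toReal := ENNReal.toReal_pos hp0 hp
  have hpge : 1 ≤ p.toReal := by
    simpa using ENNReal.toReal_mono hp hp1
  rw [← ENNReal.rpow_le_rpow_iff hpos, ENNReal.mul_rpow_of_nonneg _ _ hpos.le,
    average_rpow hp1 hp, average_rpow hp1 hp]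
  refine ENNReal.div_le_of_le_mul ?_
  calc ∫⁻ x in R.set, ‖f x‖ₑ ^ p.toReal ≤ ∫⁻ x in R'.set, ‖f x‖ₑ ^ p.toReal :=
        lintegral_mono_set hsub
    _ = (∫⁻ x in R'.set, ‖f x‖ₑ ^ p.toReal) / volume R'.set * volume R'.set :=
        (ENNReal.div_mul_cancel R'.volume_ne_zero R'.volume_ne_top).symm
    _ ≤ (∫⁻ x in R'.set, ‖f x‖ₑ ^ p.toReal) / volume R'.set * (C ^ p.toReal * volume R.set) := by
        gcongr
        refine hvol.trans ?_
        gcongr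
        exact ENNReal.le_rpow_self_of_one_le hC hpge
    _ = _ := by ring

lemma lintegral_enorm_le_average {p : ℝ≥0∞} (hp1 : 1 ≤ p) (hp : p ≠ ∞) {Q : Cube d}
    {f : (Fin d → ℝ) → ℂ} (hf : AEStronglyMeasurable f) :
    ∫⁻ x in Q.set, ‖f x‖ₑ ≤ volume Q.set * average p Q f := by
  have hp0 : p ≠ 0 := (zero_lt_one.trans_le hp1).ne'
  have hpos : 0 < p.toReal := ENNReal.toReal_pos hp0 hp
  have h := eLpNorm_le_eLpNorm_mul_rpow_measure_univ (μ := volume.restrict Q.set) hp1 hf.restrict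
  rw [eLpNorm_one_eq_lintegral_enorm] at h
  refine h.trans_eq ?_
  rw [average_eq_restrict, Measure.restrict_apply_univ, ENNReal.toReal_one, div_one,
    ENNReal.rpow_sub _ _ Q.volume_ne_zero Q.volume_ne_top, ENNReal.rpow_one]
  simp only [div_eq_mul_inv]
  ring

/-- The weak-type `(p,p)` estimate for the local maximal function of a cube. -/
lemma volume_iUnion_openSet_le [NeZero d] {p : ℝ≥0∞} (hp1 : 1 ≤ p) (hp : p ≠ ∞) (Q : Cube d)
    {f : (Fin d → ℝ) → ℂ} (hf : eLpNorm (Q.set.indicator f) p volume ≠ ∞)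
    (h0 : average p Q f ≠ 0) {D : ℝ≥0∞} (hD : 1 ≤ D) (hDt : D ≠ ∞) :
    volume (⋃ R ∈ {R : Cube d | D * average p Q f < average p R (Q.set.indicator f)}, R.openSet) ≤
      5 ^ d * (volume Q.set / D) := by
  have hp0 : p ≠ 0 := (zero_lt_one.trans_le hp1).ne'
  have hpos : 0 < p.toReal := ENNReal.toReal_pos hp0 hp
  have hpge : 1 ≤ p.toReal := by simpa using ENNReal.toReal_mono hp hp1
  set h := Q.set.indicator f with hh
  set t := {R : Cube d | D * average p Q f < average p R h} with ht
  set N : ℝ≥0∞ := ∫⁻ x, ‖h x‖ₑ ^ p.toReal with hN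
  have hNt : N ≠ ∞ := by
    rw [eLpNorm_eq_lintegral_rpow_enorm_toReal hp0 hp] at hf
    intro hc
    apply hf
    rw [← hN, hc, ENNReal.top_rpow_of_pos (by positivity)]
  have hQN : average p Q f ^ p.toReal = N / volume Q.set := by
    rw [average_rpow hp1 hp, hN, ← lintegral_indicator Q.measurableSet_set]
    congr 2
    ext x
    by_cases hx : x ∈ Q.set <;> simp [hh, hx, hpos]
  have hN0 : N ≠ 0 := by
    intro hc
    rw [hc, ENNReal.zero_div, ENNReal.rpow_eq_zero_iff_of_pos hpos] at hQN
    exact h0 hQN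
  have hD0 : D ≠ 0 := (zero_lt_one.trans_le hD).ne'
  -- The level for the means of `|h|^p`. As `D ≤ D^p`, each selected cube has mean at least `c`, and
  -- `N / c = |Q| / D` is free of `p`.
  set c : ℝ≥0∞ := D * (N / volume Q.set) with hc
  have hc0 : c ≠ 0 := mul_ne_zero hD0 (ENNReal.div_ne_zero.2 ⟨hN0, Q.volume_ne_top⟩)
  have hct : c ≠ ∞ := ENNReal.mul_ne_top hDt (ENNReal.div_ne_top hNt Q.volume_ne_zero)
  have hNc : N / c = volume Q.set / D := by
    rw [ENNReal.div_eq_div_iff hD0 hDt hc0 hct, hc, mul_assoc,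
      ENNReal.div_mul_cancel Q.volume_ne_zero Q.volume_ne_top]
  have hvolR : ∀ R ∈ t, volume R.set ≤ (∫⁻ x in R.set, ‖h x‖ₑ ^ p.toReal) / c := by
    intro R hR
    have h1 : (D * average p Q f) ^ p.toReal ≤ average p R h ^ p.toReal :=
      ENNReal.rpow_le_rpow (le_of_lt hR) hpos.le
    rw [ENNReal.mul_rpow_of_nonneg _ _ hpos.le, hQN, average_rpow hp1 hp,
      ENNReal.le_div_iff_mul_le (Or.inl R.volume_ne_zero) (Or.inl R.volume_ne_top)] at h1
    rw [ENNReal.le_div_iff_mul_le (Or.inl hc0) (Or.inl hct), mul_comm]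
    refine le_trans ?_ h1
    rw [hc]
    gcongr
    exact ENNReal.le_rpow_self_of_one_le hD hpge
  -- The Vitali covering lemma needs bounded radii. It is applied to sup-norm balls, which are the
  -- closures of the cubes.
  have hside : ∀ R ∈ t, R.side / 2 ≤ Q.side / 2 := by
    intro R hR
    have h1 : volume R.set ≤ volume Q.set :=
      calc volume R.set ≤ N / c := (hvolR R hR).trans (by gcongr; exact setLIntegral_le_lintegral _ _)
        _ = volume Q.set / D := hNc
        _ ≤ volume Q.set := ENNReal.div_le_of_le_mul (le_mul_of_one_le_right' hD)
    rw [R.volume_set, Q.volume_set, ENNReal.pow_le_pow_left_iff (NeZero.ne d),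
      ENNReal.ofReal_le_ofReal_iff Q.side_pos.le] at h1
    linarith
  obtain ⟨u, hut, hdisj, hcov⟩ := Vitali.exists_disjoint_subfamily_covering_enlargement_closedBall
    t (fun R => R.center) (fun R => R.side / 2) (Q.side / 2) hside 5 (by norm_num)
  have hucount : u.Countable := by
    refine Set.PairwiseDisjoint.countable_of_isOpen (s := Cube.openSet)
      (hdisj.mono fun R => R.openSet_subset_closedBall) (fun R _ => R.isOpen_openSet)
      fun R _ => ⟨_, R.center_mem_openSet⟩
  calc volume (⋃ R ∈ t, R.openSet)
      ≤ volume (⋃ R ∈ u, Metric.closedBall R.center (((5 : ℝ≥0) : ℝ) * (R.side / 2))) := by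
        refine measure_mono (iUnion₂_subset fun R hR => ?_)
        obtain ⟨b, hb, hRb⟩ := hcov R hR
        exact (R.openSet_subset_closedBall.trans hRb).trans
          (subset_biUnion_of_mem (u := fun R : Cube d =>
            Metric.closedBall R.center (((5 : ℝ≥0) : ℝ) * (R.side / 2))) hb)
    _ ≤ ∑' R : u, volume (Metric.closedBall R.1.center (((5 : ℝ≥0) : ℝ) * (R.1.side / 2))) :=
        measure_biUnion_le _ hucount _
    _ ≤ ∑' R : u, 5 ^ d * ((∫⁻ x in R.1.set, ‖h x‖ₑ ^ p.toReal) / c) := by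
        refine ENNReal.tsum_le_tsum fun R => ?_
        rw [Cube.volume_closedBall]
        simp only [ENNReal.coe_ofNat]
        gcongr
        exact hvolR _ (hut R.2)
    _ = 5 ^ d * ((∑' R : u, ∫⁻ x in R.1.set, ‖h x‖ₑ ^ p.toReal) / c) := by
        simp only [div_eq_mul_inv]
        rw [ENNReal.tsum_mul_left, ENNReal.tsum_mul_right]
    _ = 5 ^ d * ((∫⁻ x in ⋃ R ∈ u, R.set, ‖h x‖ₑ ^ p.toReal) / c) := by
        rw [lintegral_biUnion hucount (fun R _ => R.measurableSet_set)
          (hdisj.mono fun R => R.set_subset_closedBall)]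
    _ ≤ 5 ^ d * (N / c) := by
        gcongr
        exact setLIntegral_le_lintegral _ _
    _ = _ := by rw [hNc]

/-- By Lebesgue differentiation, a function whose averages over the cubes around a point are
bounded is bounded at almost every such point. -/
lemma ae_enorm_le_of_average_le {p : ℝ≥0∞} (hp1 : 1 ≤ p) (hp : p ≠ ∞) {f : (Fin d → ℝ) → ℂ}
    (hf : Integrable f) {M : ℝ≥0∞} :
    ∀ᵐ x, (∀ R : Cube d, x ∈ R.openSet → average p R f ≤ M) → ‖f x‖ₑ ≤ M := by
  filter_upwards [(Besicovitch.vitaliFamily (volume : Measure (Fin d → ℝ))).ae_tendsto_lintegral_div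
    hf.1.enorm hf.2.ne] with x hx hM
  have h1 := hx.comp (Besicovitch.tendsto_filterAt volume x)
  refine le_of_tendsto h1 ?_
  filter_upwards [self_mem_nhdsWithin] with r hr
  have hr : 0 < r := hr
  let R : Cube d := ⟨fun i => x i - r, 2 * r, by positivity⟩
  have hcen : R.center = x := by
    ext i; simp [R, Cube.center]
  have hball : R.set =ᵐ[volume] Metric.closedBall x r := by
    have := R.set_ae_eq_closedBall
    rwa [hcen, show R.side / 2 = r by simp [R]] at this
  simp only [Function.comp]
  rw [← measure_congr hball, ← setLIntegral_congr hball]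
  refine ENNReal.div_le_of_le_mul ?_
  rw [mul_comm]
  refine (lintegral_enorm_le_average hp1 hp hf.1).trans ?_
  gcongr
  apply hM
  rw [← hcen]
  exact R.center_mem_openSet

/-! ### The maximal function -/

lemma average_le_maximalFunction {p : ℝ≥0∞} {f : (Fin d → ℝ) → ℂ} {x : Fin d → ℝ} {R : Cube d}
    (hx : x ∈ R.set) : average p R f ≤ maximalFunction p f x :=
  le_iSup₂ (f := fun (Q : Cube d) (_ : x ∈ Q.set) => average p Q f) R hx

/-- The exceptional set is built from open boxes in order to be open. A half-open cube containing
`x` has `x` in the open box of its double, at the cost of `2^d`. -/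
lemma maximalFunction_le_of_notMem {p : ℝ≥0∞} (hp1 : 1 ≤ p) (hp : p ≠ ∞)
    {f : (Fin d → ℝ) → ℂ} {x : Fin d → ℝ} {M : ℝ≥0∞}
    (h : ∀ R : Cube d, x ∈ R.openSet → average p R f ≤ M) :
    maximalFunction p f x ≤ 2 ^ d * M := by
  refine iSup₂_le fun R hR => ?_
  refine (average_le_mul_of_subset hp1 hp (C := 2 ^ d) (one_le_pow₀ one_le_two)
    (R.set_subset_openSet_scaleBy_two.trans (Cube.openSet_subset _)) ?_ f).trans ?_
  · have := R.volume_scaleBy 2 (by norm_num)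
    exact this.le
  · gcongr
    exact h _ (R.set_subset_openSet_scaleBy_two hR)

lemma maximalFunction_add_le {p : ℝ≥0∞} (hp1 : 1 ≤ p) {f g : (Fin d → ℝ) → ℂ}
    (hf : AEStronglyMeasurable f) (hg : AEStronglyMeasurable g) (x : Fin d → ℝ) :
    maximalFunction p (f + g) x ≤ maximalFunction p f x + maximalFunction p g x :=
  iSup₂_le fun _ hR => (average_add_le hp1 hf hg).trans
    (add_le_add (average_le_maximalFunction hR) (average_le_maximalFunction hR))

lemma maximalFunction_le_of_ae_le {p : ℝ≥0∞} {f : (Fin d → ℝ) → ℂ} {M : ℝ≥0∞}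
    (h : ∀ᵐ x, ‖f x‖ₑ ≤ M) (x : Fin d → ℝ) : maximalFunction p f x ≤ M :=
  iSup₂_le fun _ _ => average_le_of_ae_le (h.mono fun _ hy _ => hy)

lemma average_const_smul (p : ℝ≥0∞) (Q : Cube d) (f : (Fin d → ℝ) → ℂ) (c : ℂ) :
    average p Q (c • f) = ‖c‖ₑ * average p Q f := by
  rw [average_eq_restrict, average_eq_restrict, eLpNorm_const_smul, mul_div_assoc]

lemma maximalFunction_const_smul (p : ℝ≥0∞) (f : (Fin d → ℝ) → ℂ) (c : ℂ) (x : Fin d → ℝ) :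
    maximalFunction p (c • f) x = ‖c‖ₑ * maximalFunction p f x := by
  simp only [maximalFunction, average_const_smul, ENNReal.mul_iSup]

end

section

variable {d : ℕ}

/-! ### Whitney-type stopping collections -/

/-- `3Q` is a union of dyadic cubes of the scale of `Q`, and `L` lies inside the one that contains
`x`. -/
lemma DyadicCube.subset_dilate_three {L Q : DyadicCube d} (hs : L.scale ≤ Q.scale)
    {x : Fin d → ℝ} (hx : x ∈ L.set) (hxQ : x ∈ Q.dilate 3) : L.set ⊆ Q.dilate 3 := by
  have hP := mem_dyadicAt Q.scale x
  refine (DyadicCube.subset_of_mem (L' := dyadicAt Q.scale x) hs hx hP).trans ?_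
  intro y hy
  rw [DyadicCube.mem_dilate] at hxQ ⊢
  rw [DyadicCube.mem_set] at hy hP
  intro i
  have h1 := hxQ i
  have h2 := hy i
  have h3 := hP i
  simp only [Cube.center, DyadicCube.toCube] at h1 ⊢
  set n : ℤ := (dyadicAt Q.scale x).index i
  have hsc : (dyadicAt Q.scale x).scale = Q.scale := rfl
  rw [hsc] at h2 h3
  have hp : (0 : ℝ) < 2 ^ Q.scale := by positivity
  set ℓ : ℝ := 2 ^ Q.scale
  have hn1 : Q.index i - 1 ≤ n := by
    have : (Q.index i : ℝ) - 1 < n + 1 := by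
      by_contra! hc
      have := mul_le_mul_of_nonneg_left hc hp.le
      linarith
    have : Q.index i - 1 < n + 1 := by exact_mod_cast this
    omega
  have hn2 : n ≤ Q.index i + 1 := by
    have : (n : ℝ) < Q.index i + 2 := by
      by_contra! hc
      have := mul_le_mul_of_nonneg_left hc hp.le
      linarith
    have : n < Q.index i + 2 := by exact_mod_cast this
    omega
  have hn1' : (Q.index i : ℝ) - 1 ≤ n := by exact_mod_cast hn1
  have hn2' : (n : ℝ) ≤ Q.index i + 1 := by exact_mod_cast hn2
  have e1 := mul_le_mul_of_nonneg_left hn1' hp.le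
  have e2 := mul_le_mul_of_nonneg_left hn2' hp.le
  constructor <;> linarith

/-- The maximal dyadic cubes `L` contained in `3Q` with `9L ⊆ E`. -/
def whitney (E : Set (Fin d → ℝ)) (Q : DyadicCube d) : Set (DyadicCube d) :=
  {L | L.dilate 9 ⊆ E ∧ L.set ⊆ Q.dilate 3 ∧
    ∀ L' : DyadicCube d, L.set ⊆ L'.set → L.scale < L'.scale → ¬ L'.dilate 9 ⊆ E}

/-- Comparison of volumes: `18^d |L| = 2^d |9L| ≤ 2^d |E| ≤ |Q|`. The gain over `9` leaves room to
keep `9L` inside `3Q` whenever `3L` meets `2Q`. -/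
lemma scale_small_of_dilate_subset [NeZero d] {E : Set (Fin d → ℝ)} {Q L : DyadicCube d}
    (hE : 2 ^ d * volume E ≤ volume Q.set) (hL : L.dilate 9 ⊆ E) :
    18 * (2 : ℝ) ^ L.scale ≤ 2 ^ Q.scale := by
  have h1 : (18 : ℝ≥0∞) ^ d * volume L.set ≤ volume Q.set := by
    refine le_trans ?_ hE
    rw [show (18 : ℝ≥0∞) = 2 * 9 by norm_num, mul_pow, mul_assoc]
    gcongr
    refine le_trans ?_ (measure_mono hL)
    have := L.volume_dilate (k := 9) (by norm_num)
    simpa using this.ge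
  rw [L.volume_set, Q.volume_set, ← mul_pow, ENNReal.pow_le_pow_left_iff (NeZero.ne d),
    show (18 : ℝ≥0∞) = ENNReal.ofReal 18 by simp, ← ENNReal.ofReal_mul (by norm_num),
    ENNReal.ofReal_le_ofReal_iff (by positivity)] at h1
  exact h1

lemma scale_lt_of_dilate_subset [NeZero d] {E : Set (Fin d → ℝ)} {Q L : DyadicCube d}
    (hE : 2 ^ d * volume E ≤ volume Q.set) (hL : L.dilate 9 ⊆ E) : L.scale < Q.scale := by
  have h := scale_small_of_dilate_subset hE hL
  have hp : (0 : ℝ) < 2 ^ L.scale := by positivity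
  exact (zpow_lt_zpow_iff_right₀ one_lt_two).1 (by linarith : (2 : ℝ) ^ L.scale < 2 ^ Q.scale)

lemma exists_mem_whitney [NeZero d] {E : Set (Fin d → ℝ)} {Q : DyadicCube d} (hEo : IsOpen E)
    (hE : 2 ^ d * volume E ≤ volume Q.set) {x : Fin d → ℝ} (hx : x ∈ E) (hxQ : x ∈ Q.dilate 3) :
    ∃ L ∈ whitney E Q, x ∈ L.set := by
  obtain ⟨ε, hε, hball⟩ := Metric.isOpen_iff.1 hEo x hx
  have hex : ∃ s : ℤ, (dyadicAt s x).dilate 9 ⊆ E := by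
    -- A point of `9L` is within `9/2 + 1/2 = 5` side lengths of any point of `L`.
    obtain ⟨n, hn⟩ := exists_pow_lt_of_lt_one (show 0 < ε / 5 by positivity)
      (show (1 / 2 : ℝ) < 1 by norm_num)
    refine ⟨-(n : ℤ), fun y hy => hball ?_⟩
    have hx' := DyadicCube.mem_set_iff_center.1 (mem_dyadicAt (-(n : ℤ)) x)
    rw [DyadicCube.mem_dilate] at hy
    have hsc : (dyadicAt (-(n : ℤ)) x).scale = -(n : ℤ) := rfl
    rw [hsc] at hx' hy
    have hp : (2 : ℝ) ^ (-(n : ℤ)) = (1 / 2) ^ n := by simp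
    rw [hp] at hx' hy
    rw [Metric.mem_ball, dist_pi_lt_iff hε]
    intro i
    have := hx' i
    have := hy i
    rw [Real.dist_eq, abs_lt]
    constructor <;> linarith
  obtain ⟨s, hs, hmax⟩ := Int.exists_greatest_of_bdd
    (P := fun s => (dyadicAt s x).dilate 9 ⊆ E)
    ⟨Q.scale, fun z hz => (scale_lt_of_dilate_subset hE hz).le⟩ hex
  refine ⟨dyadicAt s x, ⟨hs, ?_, ?_⟩, mem_dyadicAt s x⟩
  · exact DyadicCube.subset_dilate_three (scale_lt_of_dilate_subset hE hs).le (mem_dyadicAt s x) hxQ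
  · intro L' hL' hlt hc
    have hL'x := mem_set_iff_dyadicAt.1 (hL' (mem_dyadicAt s x))
    rw [← hL'x] at hc
    exact absurd (hmax _ hc) (not_le.2 hlt)

lemma shadow_whitney_subset (E : Set (Fin d → ℝ)) (Q : DyadicCube d) :
    shadow (whitney E Q) ⊆ E :=
  iUnion₂_subset fun L hL => (L.subset_dilate (by norm_num)).trans hL.1

lemma whitney_disjoint {E : Set (Fin d → ℝ)} {Q L L' : DyadicCube d} (hL : L ∈ whitney E Q)
    (hL' : L' ∈ whitney E Q) (h : (L.set ∩ L'.set).Nonempty) : L = L' := by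
  obtain ⟨x, hx, hx'⟩ := h
  rcases lt_trichotomy L.scale L'.scale with hlt | heq | hlt
  · exact absurd hL'.1 (hL.2.2 L' (DyadicCube.subset_of_mem hlt.le hx hx') hlt)
  · exact DyadicCube.eq_of_mem heq hx hx'
  · exact absurd hL.1 (hL'.2.2 L (DyadicCube.subset_of_mem hlt.le hx' hx) hlt)

/-- By maximality the ninefold dilate of the dyadic parent leaves `E`. It has half-side `9 ℓ(L)`,
and its centre is off by `ℓ(L)/2` in each coordinate, whence `19/2`. As `19/2 < 16`, such a point
lies in `2^5 L`. -/
lemma exists_notMem_of_mem_whitney {E : Set (Fin d → ℝ)} {Q L : DyadicCube d}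
    (hL : L ∈ whitney E Q) :
    ∃ y ∉ E, ∀ i, |y i - L.toCube.center i| ≤ 19 / 2 * (2 : ℝ) ^ L.scale := by
  obtain ⟨x, hx⟩ := L.nonempty_set
  set P := dyadicAt (L.scale + 1) x with hP
  have hsc : P.scale = L.scale + 1 := rfl
  have hLP : L.set ⊆ P.set :=
    DyadicCube.subset_of_mem (by rw [hsc]; omega) hx (mem_dyadicAt _ _)
  obtain ⟨y, hy, hyE⟩ := not_subset.1 (hL.2.2 P hLP (by rw [hsc]; omega))
  refine ⟨y, hyE, fun i => ?_⟩
  have h1 := DyadicCube.mem_dilate.1 hy i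
  have h2 := DyadicCube.abs_center_sub_le hLP i
  rw [hsc, zpow_add_one₀ two_ne_zero] at h1 h2
  rw [abs_le]
  constructor <;> linarith

/-- If `L` were larger by nine scales or more, the point outside `E` close to `L'` would fall into
`9L ⊆ E`. -/
lemma scale_le_of_mem_whitney {E : Set (Fin d → ℝ)} {Q L L' : DyadicCube d}
    (hL : L ∈ whitney E Q) (hL' : L' ∈ whitney E Q)
    (h : (L.dilate 3 ∩ L'.dilate 3).Nonempty) : L.scale - L'.scale ≤ 8 := by
  by_contra! hlt
  obtain ⟨y, hyE, hy⟩ := exists_notMem_of_mem_whitney hL'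
  obtain ⟨z, hz, hz'⟩ := h
  apply hyE
  apply hL.1
  rw [DyadicCube.mem_dilate] at hz hz' ⊢
  have hsmall : 512 * (2 : ℝ) ^ L'.scale ≤ 2 ^ L.scale := by
    have : (2 : ℝ) ^ (L'.scale + 9) ≤ 2 ^ L.scale :=
      zpow_le_zpow_right₀ one_le_two (by omega)
    rw [zpow_add₀ two_ne_zero] at this
    norm_num at this
    linarith
  have hp : (0 : ℝ) < 2 ^ L'.scale := by positivity
  intro i
  have h1 := hz i
  have h2 := hz' i
  have h3 := abs_le.1 (hy i)
  constructor <;> linarith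

lemma isStoppingCollection_whitney [NeZero d] {E : Set (Fin d → ℝ)} {Q : DyadicCube d}
    (hEo : IsOpen E) (hE : 2 ^ d * volume E ≤ volume Q.set) :
    IsStoppingCollection Q (whitney E Q) where
  shadow_subset := iUnion₂_subset fun L hL => hL.2.1
  dilate_subset := by
    rintro L hL ⟨z, hz3, hz2⟩ y hy
    have hyE := hL.1 hy
    have hsm := scale_small_of_dilate_subset hE hL.1
    have hyQ : y ∈ Q.dilate 3 := by
      rw [DyadicCube.mem_dilate] at hz3 hz2 hy ⊢
      have hp : (0 : ℝ) < 2 ^ L.scale := by positivity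
      intro i
      have h1 := hz3 i
      have h2 := hz2 i
      have h3 := hy i
      constructor <;> linarith
    obtain ⟨L', hL', hyL'⟩ := exists_mem_whitney hEo hE hyE hyQ
    exact mem_biUnion hL' hyL'
  disjoint := fun L hL L' hL' h => whitney_disjoint hL hL' h
  scale_le := fun L hL L' hL' h => by
    rw [abs_sub_le_iff]
    exact ⟨scale_le_of_mem_whitney hL hL' h,
      scale_le_of_mem_whitney hL' hL (by rwa [inter_comm])⟩

lemma IsStoppingCollection.tsum_volume_inter_le {Q : DyadicCube d} {𝒬 : Set (DyadicCube d)}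
    (h : IsStoppingCollection Q 𝒬) {A : Set (Fin d → ℝ)} (hA : MeasurableSet A) :
    ∑' L : {L : DyadicCube d // L ∈ 𝒬 ∧ L.set ⊆ Q.set}, volume (A ∩ L.1.set) ≤
      volume (A ∩ (Q.set ∩ shadow 𝒬)) := by
  rw [← measure_iUnion]
  · refine measure_mono (iUnion_subset fun L => ?_)
    exact inter_subset_inter_right _ (subset_inter L.2.2 (subset_biUnion_of_mem L.2.1))
  · intro L L' hne
    refine disjoint_iff_inter_eq_empty.2 (not_nonempty_iff_eq_empty.1 fun ⟨x, hx, hx'⟩ => hne ?_)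
    exact Subtype.ext (h.disjoint _ L.2.1 _ L'.2.1 ⟨x, hx.2, hx'.2⟩)
  · exact fun L => hA.inter L.1.measurableSet_set

/-- The triple `3Q` of a dyadic cube, as a cube. -/
def DyadicCube.triple (Q : DyadicCube d) : Cube d := Q.toCube.scaleBy 3 three_pos

lemma DyadicCube.set_triple (Q : DyadicCube d) : Q.triple.set = Q.dilate 3 :=
  (Q.dilate_eq three_pos).symm

/-- The stopping collection of a cube for two functions: off its shadow the functions are bounded
by their averages, and the maximal functions are controlled near its cubes. -/
lemma exists_stoppingCollection [NeZero d] {p : Fin 2 → ℝ≥0∞} (hp1 : ∀ j, 1 ≤ p j)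
    (hp : ∀ j, p j ≠ ∞) (Q : DyadicCube d) {f : Fin 2 → (Fin d → ℝ) → ℂ}
    (hf : ∀ j, MemLp (f j) ∞) (h0 : ∀ j, average (p j) Q.triple (f j) ≠ 0) :
    ∃ 𝒬 : Set (DyadicCube d), IsStoppingCollection Q 𝒬 ∧ (∀ L ∈ 𝒬, L.scale < Q.scale) ∧
      2 * volume (shadow 𝒬) ≤ volume Q.set ∧
      ∀ j, (∀ᵐ x, x ∉ shadow 𝒬 → ‖(Q.dilate 3).indicator (f j) x‖ₑ ≤
          2 ^ d * (2 * 30 ^ d) * average (p j) Q.triple (f j)) ∧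
        ∀ L ∈ 𝒬, ∃ y ∈ L.dilate (2 ^ 5),
          maximalFunction (p j) ((Q.dilate 3).indicator (f j)) y ≤
            2 ^ d * (2 * 30 ^ d) * average (p j) Q.triple (f j) := by
  -- Two functions, `5^d` from the covering lemma, `3^d` from `|3Q|`, and `2^d` for the smallness
  -- required of `E`.
  set D : ℝ≥0∞ := 2 * 30 ^ d with hD
  have hD1 : 1 ≤ D := by
    calc (1 : ℝ≥0∞) = 1 * 1 := (one_mul 1).symm
      _ ≤ D := mul_le_mul' one_le_two (one_le_pow₀ (by norm_num))
  have hD0 : D ≠ 0 := (zero_lt_one.trans_le hD1).ne'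
  have hDt : D ≠ ∞ := by simp [hD, ENNReal.mul_eq_top]
  set h : Fin 2 → (Fin d → ℝ) → ℂ := fun j => Q.triple.set.indicator (f j) with hh
  have hfin : ∀ q : ℝ≥0∞, ∀ j, MemLp (h j) q := by
    intro q j
    rw [hh, memLp_indicator_iff_restrict Q.triple.measurableSet_set]
    have : IsFiniteMeasure (volume.restrict Q.triple.set) :=
      ⟨by simpa using Q.triple.volume_ne_top.lt_top⟩
    exact ((hf j).restrict _).mono_exponent le_top
  set E : Fin 2 → Set (Fin d → ℝ) := fun j =>
    ⋃ R ∈ {R : Cube d | D * average (p j) Q.triple (f j) < average (p j) R (h j)}, R.openSet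
    with hE
  have hEo : IsOpen (⋃ j, E j) :=
    isOpen_iUnion fun j => isOpen_biUnion fun R _ => R.isOpen_openSet
  have hEj : ∀ j, volume (E j) ≤ 5 ^ d * (volume Q.triple.set / D) := fun j =>
    volume_iUnion_openSet_le (hp1 j) (hp j) Q.triple (hfin (p j) j).2.ne (h0 j) hD1 hDt
  have hEvol : 2 ^ d * volume (⋃ j, E j) ≤ volume Q.set := by
    calc 2 ^ d * volume (⋃ j, E j) ≤ 2 ^ d * ∑ j, 5 ^ d * (volume Q.triple.set / D) := by
          gcongr
          exact (measure_iUnion_fintype_le _ _).trans (Finset.sum_le_sum fun j _ => hEj j)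
      _ = D * (volume Q.set / D) := by
          rw [Q.set_triple, Q.volume_dilate_three, hD,
            show (30 : ℝ≥0∞) = 2 * 5 * 3 by norm_num, mul_pow, mul_pow]
          simp only [div_eq_mul_inv, Finset.sum_const, Finset.card_univ, Fintype.card_fin,
            nsmul_eq_mul, Nat.cast_ofNat]
          ring
      _ = volume Q.set := ENNReal.mul_div_cancel hD0 hDt
  have hmax : ∀ j, ∀ x ∉ ⋃ j, E j, ∀ R : Cube d, x ∈ R.openSet →
      average (p j) R (h j) ≤ D * average (p j) Q.triple (f j) := by
    intro j x hx R hR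
    by_contra! hc
    exact hx (mem_iUnion.2 ⟨j, mem_biUnion (show R ∈ {R | _} from hc) hR⟩)
  have hcoll := isStoppingCollection_whitney hEo hEvol
  refine ⟨whitney (⋃ j, E j) Q, hcoll,
    fun L hL => scale_lt_of_dilate_subset hEvol hL.1, ?_, fun j => ⟨?_, ?_⟩⟩
  · refine le_trans ?_ hEvol
    gcongr
    · exact le_self_pow₀ one_le_two (NeZero.ne d)
    · exact shadow_whitney_subset _ _
  · rw [← Q.set_triple]
    filter_upwards [ae_enorm_le_of_average_le (hp1 j) (hp j) (memLp_one_iff_integrable.1 (hfin 1 j))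
      (M := D * average (p j) Q.triple (f j))] with x hx hxs
    by_cases hxQ : x ∈ Q.triple.set
    -- The Whitney cubes cover `E ∩ 3Q`, so off the shadow no average around `x` is large.
    · have hxE : x ∉ ⋃ j, E j := by
        intro hc
        rw [Q.set_triple] at hxQ
        obtain ⟨L, hL, hxL⟩ := exists_mem_whitney hEo hEvol hc hxQ
        exact hxs (mem_biUnion hL hxL)
      refine (hx (hmax j x hxE)).trans ?_
      gcongr
      exact le_mul_of_one_le_left' (one_le_pow₀ (one_le_two : (1 : ℝ≥0∞) ≤ 2))
    · rw [indicator_of_notMem hxQ]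
      simp
  · intro L hL
    obtain ⟨y, hyE, hy⟩ := exists_notMem_of_mem_whitney hL
    refine ⟨y, ?_, ?_⟩
    · rw [DyadicCube.mem_dilate]
      have hp : (0 : ℝ) < 2 ^ L.scale := by positivity
      intro i
      have := abs_le.1 (hy i)
      constructor <;> linarith
    · rw [← Q.set_triple, mul_assoc]
      exact maximalFunction_le_of_notMem (hp1 j) (hp j) (hmax j y hyE)

end

section

variable {d : ℕ}

/-! ### The atomic norms and the Calderón–Zygmund decomposition -/

lemma measurableSet_shadow (𝒬 : Set (DyadicCube d)) : MeasurableSet (shadow 𝒬) :=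
  MeasurableSet.biUnion (to_countable _) fun L _ => L.measurableSet_set

lemma normY_of_ne_top {p : ℝ≥0∞} (hp : p ≠ ∞) (𝒬 : Set (DyadicCube d)) (f : (Fin d → ℝ) → ℂ) :
    normY p 𝒬 f = max (eLpNorm ((shadow 𝒬)ᶜ.indicator f) ∞ volume)
      (⨆ L ∈ 𝒬, ⨅ x ∈ L.dilate (2 ^ 5), maximalFunction p f x) := if_neg hp

lemma normY_le {p : ℝ≥0∞} (hp : p ≠ ∞) {𝒬 : Set (DyadicCube d)} {f : (Fin d → ℝ) → ℂ}
    {A : ℝ≥0∞} (h1 : ∀ᵐ x, x ∉ shadow 𝒬 → ‖f x‖ₑ ≤ A)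
    (h2 : ∀ L ∈ 𝒬, ∃ y ∈ L.dilate (2 ^ 5), maximalFunction p f y ≤ A) : normY p 𝒬 f ≤ A := by
  rw [normY_of_ne_top hp]
  refine max_le ?_ (iSup₂_le fun L hL => ?_)
  · rw [eLpNorm_exponent_top]
    refine eLpNormEssSup_le_of_ae_enorm_bound ?_
    filter_upwards [h1] with x hx
    by_cases hxs : x ∈ shadow 𝒬 <;> simp [hxs]
    exact hx hxs
  · obtain ⟨y, hy, hM⟩ := h2 L hL
    exact (iInf₂_le y hy).trans hM

lemma normY_const_smul {p : ℝ≥0∞} (𝒬 : Set (DyadicCube d)) (f : (Fin d → ℝ) → ℂ) {c : ℂ}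
    (hc : c ≠ 0) : normY p 𝒬 (c • f) = ‖c‖ₑ * normY p 𝒬 f := by
  by_cases hp : p = ∞
  · simp only [normY, hp, if_true, eLpNorm_const_smul]
  · have hc0 : ‖c‖ₑ ≠ 0 := by simpa using hc
    have hi : (shadow 𝒬)ᶜ.indicator (c • f) = c • (shadow 𝒬)ᶜ.indicator f := by
      ext x
      by_cases hx : x ∈ (shadow 𝒬)ᶜ <;> simp only [Pi.smul_apply, indicator, hx] <;> simp
    rw [normY_of_ne_top hp, normY_of_ne_top hp, (mul_right_mono (a := ‖c‖ₑ)).map_max,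
      hi, eLpNorm_const_smul]
    congr 1
    simp only [ENNReal.mul_iSup, ENNReal.mul_iInf_of_ne hc0 enorm_ne_top,
      maximalFunction_const_smul]

lemma average_le_iInf_maximalFunction {p : ℝ≥0∞} (L : DyadicCube d) (f : (Fin d → ℝ) → ℂ) :
    average p (L.toCube.scaleBy (2 ^ 5) (by positivity)) f ≤
      ⨅ x ∈ L.dilate (2 ^ 5), maximalFunction p f x :=
  le_iInf₂ fun x hx => average_le_maximalFunction (by
    rw [Cube.set_scaleBy]; exact hx)

/-- `localizedConstant` tests only functions of norm one, so functions of norm zero, which cannot be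
normalized, have to be shown negligible. On each stopping cube `L` the infimum of the maximal
function dominates the average over `2^5 L`, which therefore vanishes. -/
lemma ae_eq_zero_of_normY_eq_zero {p : ℝ≥0∞} (hp1 : 1 ≤ p) {𝒬 : Set (DyadicCube d)}
    {f : (Fin d → ℝ) → ℂ} (hf : AEStronglyMeasurable f) (h : normY p 𝒬 f = 0) :
    f =ᵐ[volume] 0 := by
  by_cases hp : p = ∞
  · rw [normY, if_pos hp] at h
    exact (eLpNorm_eq_zero_iff hf (by simp)).1 h
  rw [normY_of_ne_top hp] at h
  obtain ⟨h1, h2⟩ : eLpNorm ((shadow 𝒬)ᶜ.indicator f) ∞ volume = 0 ∧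
      (⨆ L ∈ 𝒬, ⨅ x ∈ L.dilate (2 ^ 5), maximalFunction p f x) = 0 := by
    constructor
    · exact le_antisymm ((le_max_left _ _).trans_eq h) bot_le
    · exact le_antisymm ((le_max_right _ _).trans_eq h) bot_le
  have hoff := (eLpNorm_eq_zero_iff (hf.indicator (measurableSet_shadow 𝒬).compl) (by simp)).1 h1
  have hon : ∀ L ∈ 𝒬, ∀ᵐ x, x ∈ L.set → f x = 0 := by
    intro L hL
    have h3 : average p (L.toCube.scaleBy (2 ^ 5) (by positivity)) f = 0 := by
      refine le_antisymm ((average_le_iInf_maximalFunction L f).trans ?_) bot_le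
      rw [← h2]
      exact le_iSup₂ (f := fun (L : DyadicCube d) (_ : L ∈ 𝒬) =>
        ⨅ x ∈ L.dilate (2 ^ 5), maximalFunction p f x) L hL
    rw [average_eq_restrict, ENNReal.div_eq_zero_iff] at h3
    rcases h3 with h3 | h3
    · rw [eLpNorm_eq_zero_iff hf.restrict (zero_lt_one.trans_le hp1).ne'] at h3
      filter_upwards [(ae_restrict_iff' (Cube.measurableSet_set _)).1 h3] with x hx hxL
      refine hx ?_
      rw [Cube.set_scaleBy]
      exact L.subset_dilate (by norm_num) hxL
    · exact absurd h3 (ENNReal.rpow_ne_top_of_nonneg (by positivity) (Cube.volume_ne_top _))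
  filter_upwards [hoff, (ae_ball_iff (to_countable 𝒬)).2 hon] with x hx1 hx2
  by_cases hxs : x ∈ shadow 𝒬
  · obtain ⟨L, hL, hxL⟩ := mem_iUnion₂.1 hxs
    exact hx2 L hL hxL
  · simpa [hxs] using hx1

/-! ### The Calderón–Zygmund decomposition along a stopping collection. -/

open Classical in
/-- The good part of the Calderón–Zygmund decomposition along a disjoint collection. -/
def goodPart (𝒬 : Set (DyadicCube d)) (f : (Fin d → ℝ) → ℂ) (x : Fin d → ℝ) : ℂ :=
  if h : ∃ L ∈ 𝒬, x ∈ L.set then ⨍ y in h.choose.set, f y else f x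

lemma goodPart_of_mem {Q : DyadicCube d} {𝒬 : Set (DyadicCube d)} (hs : IsStoppingCollection Q 𝒬)
    (f : (Fin d → ℝ) → ℂ) {L : DyadicCube d} (hL : L ∈ 𝒬) {x : Fin d → ℝ} (hx : x ∈ L.set) :
    goodPart 𝒬 f x = ⨍ y in L.set, f y := by
  have h : ∃ L ∈ 𝒬, x ∈ L.set := ⟨L, hL, hx⟩
  rw [goodPart, dif_pos h, hs.disjoint _ h.choose_spec.1 L hL ⟨x, h.choose_spec.2, hx⟩]

lemma goodPart_of_notMem {𝒬 : Set (DyadicCube d)} (f : (Fin d → ℝ) → ℂ) {x : Fin d → ℝ}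
    (hx : x ∉ shadow 𝒬) : goodPart 𝒬 f x = f x := by
  rw [goodPart, dif_neg]
  rintro ⟨L, hL, hxL⟩
  exact hx (mem_biUnion hL hxL)

lemma aestronglyMeasurable_goodPart {Q : DyadicCube d} {𝒬 : Set (DyadicCube d)}
    (hs : IsStoppingCollection Q 𝒬) {f : (Fin d → ℝ) → ℂ} (hf : AEStronglyMeasurable f) :
    AEStronglyMeasurable (goodPart 𝒬 f) := by
  rw [← Measure.restrict_univ (μ := volume), ← union_compl_self (shadow 𝒬),
    aestronglyMeasurable_union_iff]
  constructor
  · rw [shadow, biUnion_eq_iUnion, aestronglyMeasurable_iUnion_iff]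
    intro L
    refine (aestronglyMeasurable_const (b := ⨍ y in L.1.set, f y)).congr ?_
    filter_upwards [ae_restrict_mem L.1.measurableSet_set] with x hx
    exact (goodPart_of_mem hs f L.2 hx).symm
  · refine hf.restrict.congr ?_
    filter_upwards [ae_restrict_mem (measurableSet_shadow 𝒬).compl] with x hx
    exact (goodPart_of_notMem f hx).symm

lemma enorm_setAverage_le_average {p : ℝ≥0∞} (hp1 : 1 ≤ p) (hp : p ≠ ∞) (Q : Cube d)
    {f : (Fin d → ℝ) → ℂ} (hf : AEStronglyMeasurable f) :
    ‖⨍ y in Q.set, f y‖ₑ ≤ average p Q f := by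
  rw [setAverage_eq, enorm_smul]
  have h1 : ‖(volume.real Q.set)⁻¹‖ₑ = (volume Q.set)⁻¹ := by
    rw [enorm_inv, Measure.real, Real.enorm_of_nonneg ENNReal.toReal_nonneg,
      ENNReal.ofReal_toReal Q.volume_ne_top]
    exact (ENNReal.toReal_pos Q.volume_ne_zero Q.volume_ne_top).ne'
  rw [h1, mul_comm, ← div_eq_mul_inv]
  refine ENNReal.div_le_of_le_mul ?_
  rw [mul_comm]
  exact (enorm_integral_le_lintegral_enorm _).trans (lintegral_enorm_le_average hp1 hp hf)

lemma memLp_of_memLp_top {f : (Fin d → ℝ) → ℂ} (hf : MemLp f ∞) {B : Set (Fin d → ℝ)}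
    (hB : MeasurableSet B) (hBv : volume B ≠ ∞) (h0 : ∀ x ∉ B, f x = 0) (q : ℝ≥0∞) :
    MemLp f q := by
  have : f = B.indicator f := by
    ext x
    by_cases hx : x ∈ B <;> simp [hx, h0]
  rw [this, memLp_indicator_iff_restrict hB]
  have : IsFiniteMeasure (volume.restrict B) := ⟨by simpa using hBv.lt_top⟩
  exact (hf.restrict _).mono_exponent le_top

lemma DyadicCube.volume_dilate_three_ne_top (Q : DyadicCube d) : volume (Q.dilate 3) ≠ ∞ := by
  rw [← Q.set_triple]; exact Cube.volume_ne_top _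

lemma memY_of_memLp_top {p : ℝ≥0∞} {Q : DyadicCube d} {𝒬 : Set (DyadicCube d)}
    {f : (Fin d → ℝ) → ℂ} (hf : MemLp f ∞) (h0 : ∀ x ∉ Q.dilate 3, f x = 0)
    (hn : normY p 𝒬 f < ∞) : MemY p Q 𝒬 f where
  memLp := memLp_of_memLp_top hf (Q.measurableSet_dilate three_pos)
    Q.volume_dilate_three_ne_top h0 p
  support := ae_of_all _ h0
  norm_lt := hn

/-- The Calderón–Zygmund decomposition along a stopping collection. -/
lemma exists_calderonZygmund {p : ℝ≥0∞} (hp1 : 1 ≤ p) (hp : p ≠ ∞) {Q : DyadicCube d}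
    {𝒬 : Set (DyadicCube d)} (hs : IsStoppingCollection Q 𝒬) {h : (Fin d → ℝ) → ℂ}
    (hm : MemLp h ∞) (h0 : ∀ x ∉ Q.dilate 3, h x = 0) {A : ℝ≥0∞} (hA : A ≠ ∞)
    (h1 : ∀ᵐ x, x ∉ shadow 𝒬 → ‖h x‖ₑ ≤ A)
    (h2 : ∀ L ∈ 𝒬, ∃ y ∈ L.dilate (2 ^ 5), maximalFunction p h y ≤ A) :
    ∃ g b : (Fin d → ℝ) → ℂ, h = g + b ∧ MemLp g ∞ ∧ (∀ x ∉ Q.dilate 3, g x = 0) ∧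
      (∀ᵐ x, ‖g x‖ₑ ≤ 32 ^ d * A) ∧ MemLp b ∞ ∧ (∀ x ∉ Q.dilate 3, b x = 0) ∧
      MemXdot p Q 𝒬 b ∧ normY p 𝒬 b ≤ 2 * 32 ^ d * A := by
  have h32 : (1 : ℝ≥0∞) ≤ 32 ^ d := one_le_pow₀ (by norm_num)
  have hgm := aestronglyMeasurable_goodPart hs hm.1
  have hgb : ∀ᵐ x, ‖goodPart 𝒬 h x‖ₑ ≤ 32 ^ d * A := by
    filter_upwards [h1] with x hx
    by_cases hxs : x ∈ shadow 𝒬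
    · obtain ⟨L, hL, hxL⟩ := mem_iUnion₂.1 hxs
      rw [goodPart_of_mem hs h hL hxL]
      refine (enorm_setAverage_le_average hp1 hp L.toCube hm.1).trans ?_
      -- The maximal function is controlled only somewhere in `2^5 L`, so the mean over `L` is first
      -- compared with the average over `2^5 L`, losing `32^d`.
      refine (average_le_mul_of_subset hp1 hp h32
        (R' := L.toCube.scaleBy (2 ^ 5) (by positivity)) ?_ ?_ h).trans ?_
      · rw [Cube.set_scaleBy]
        exact L.subset_dilate (by norm_num)
      · refine Cube.volume_le_of_side_le (c := 32) (le_of_eq ?_)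
        simp only [Cube.scaleBy, NNReal.coe_ofNat]
        norm_num
      · gcongr
        obtain ⟨y, hy, hM⟩ := h2 L hL
        exact (average_le_iInf_maximalFunction L h).trans ((iInf₂_le y hy).trans hM)
    · rw [goodPart_of_notMem h hxs]
      exact (hx hxs).trans (le_mul_of_one_le_left' h32)
  have hAt : 32 ^ d * A ≠ ∞ := ENNReal.mul_ne_top (by simp) hA
  have hgL : MemLp (goodPart 𝒬 h) ∞ :=
    ⟨hgm, by
      rw [eLpNorm_exponent_top]
      exact (eLpNormEssSup_le_of_ae_enorm_bound hgb).trans_lt hAt.lt_top⟩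
  have hg0 : ∀ x ∉ Q.dilate 3, goodPart 𝒬 h x = 0 := fun x hx => by
    rw [goodPart_of_notMem h fun hc => hx (hs.shadow_subset hc), h0 x hx]
  have hbL : MemLp (h - goodPart 𝒬 h) ∞ := hm.sub hgL
  have hb0 : ∀ x ∉ Q.dilate 3, (h - goodPart 𝒬 h) x = 0 := fun x hx => by
    rw [Pi.sub_apply, hg0 x hx, h0 x hx, sub_zero]
  have hbs : ∀ x ∉ shadow 𝒬, (h - goodPart 𝒬 h) x = 0 := fun x hx => by
    rw [Pi.sub_apply, goodPart_of_notMem h hx, sub_self]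
  have hbn : normY p 𝒬 (h - goodPart 𝒬 h) ≤ 2 * 32 ^ d * A := by
    refine normY_le hp (ae_of_all _ fun x hx => by rw [hbs x hx]; simp) fun L hL => ?_
    obtain ⟨y, hy, hM⟩ := h2 L hL
    refine ⟨y, hy, ?_⟩
    rw [sub_eq_add_neg]
    -- At the same point `y` the maximal function of `h` is at most `A`, and that of the good part
    -- at most its sup bound `32^d A`.
    refine (maximalFunction_add_le hp1 hm.1 hgm.neg y).trans ?_
    rw [mul_assoc, two_mul]
    refine add_le_add (hM.trans (le_mul_of_one_le_left' h32)) ?_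
    exact maximalFunction_le_of_ae_le (hgb.mono fun x hx => by simpa using hx) y
  refine ⟨goodPart 𝒬 h, h - goodPart 𝒬 h, by simp, hgL, hg0, hgb, hbL, hb0, ?_, hbn⟩
  refine ⟨memY_of_memLp_top hbL hb0 (hbn.trans_lt ?_), ae_of_all _ hbs, fun L hL => ?_⟩
  · exact (ENNReal.mul_ne_top (ENNReal.mul_ne_top (by simp) (by simp)) hA).lt_top
  · have hvol : volume.real L.set ≠ 0 :=
      (ENNReal.toReal_pos L.volume_ne_zero L.volume_ne_top).ne'
    have hint : IntegrableOn h L.set :=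
      (memLp_one_iff_integrable.1 (memLp_of_memLp_top hm (Q.measurableSet_dilate three_pos)
        Q.volume_dilate_three_ne_top h0 1)).integrableOn
    have e1 : ∫ x in L.set, (h - goodPart 𝒬 h) x =
        ∫ x in L.set, (h x - ⨍ y in L.set, h y) :=
      setIntegral_congr_fun L.measurableSet_set fun x hx => by
        simp only [Pi.sub_apply, goodPart_of_mem hs h hL hx]
    rw [e1, integral_sub hint (integrableOn_const L.volume_ne_top),
      setIntegral_const, setAverage_eq, smul_smul, mul_inv_cancel₀ hvol, one_smul, sub_self]

end

section

variable {d : ℕ} {K : ℤ → (Fin d → ℝ) → (Fin d → ℝ) → ℂ}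

/-! ### Truncations and linearized pairings -/

/-- A single layer of the kernel, applied to a function. -/
def layer (K : ℤ → (Fin d → ℝ) → (Fin d → ℝ) → ℂ) (s : ℤ) (f : (Fin d → ℝ) → ℂ)
    (x : Fin d → ℝ) : ℂ := ∫ y, K s x y * f y

/-- The bound of a single layer of the kernel that the size constant provides. -/
def layerBound (K : ℤ → (Fin d → ℝ) → (Fin d → ℝ) → ℂ) (s : ℤ) : ℝ≥0∞ :=
  kernelSize K / (2 : ℝ≥0∞) ^ (s * (d : ℤ))

lemma layerBound_ne_top (hK : IsKernelFamily K) (s : ℤ) : layerBound K s ≠ ∞ :=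
  ENNReal.div_ne_top hK.size.ne (ENNReal.zpow_pos (by simp) (by simp) _).ne'

lemma ae_enorm_kernel_le (K : ℤ → (Fin d → ℝ) → (Fin d → ℝ) → ℂ) (s : ℤ) (x : Fin d → ℝ) :
    ∀ᵐ y, ‖K s x y‖ₑ ≤ layerBound K s := by
  have h1 : eLpNorm (fun y => K s x y) ∞ volume ≤ layerBound K s := by
    rw [layerBound, ENNReal.le_div_iff_mul_le
      (Or.inl (ENNReal.zpow_pos (by simp) (by simp) _).ne')
      (Or.inl (ENNReal.zpow_lt_top (by simp) (by simp) _).ne), mul_comm]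
    calc (2 : ℝ≥0∞) ^ (s * (d : ℤ)) * eLpNorm (fun y => K s x y) ∞ volume
        ≤ (2 : ℝ≥0∞) ^ (s * (d : ℤ)) * ⨆ x : Fin d → ℝ,
          (eLpNorm (fun y => K s x y) ∞ volume + eLpNorm (fun y => K s y x) ∞ volume) := by
          gcongr
          exact le_self_add.trans (le_iSup (fun x : Fin d → ℝ =>
            eLpNorm (fun y => K s x y) ∞ volume + eLpNorm (fun y => K s y x) ∞ volume) x)
      _ ≤ kernelSize K := le_iSup (fun s : ℤ => (2 : ℝ≥0∞) ^ (s * (d : ℤ)) *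
          ⨆ x : Fin d → ℝ, (eLpNorm (fun y => K s x y) ∞ volume +
            eLpNorm (fun y => K s y x) ∞ volume)) s
  rw [eLpNorm_exponent_top] at h1
  exact (enorm_ae_le_eLpNormEssSup _ _).mono fun y hy => hy.trans h1

lemma integrable_kernel_mul (hK : IsKernelFamily K) (s : ℤ) (x : Fin d → ℝ)
    {f : (Fin d → ℝ) → ℂ} (hf : Integrable f) : Integrable fun y => K s x y * f y := by
  refine hf.bdd_mul (c := (layerBound K s).toReal) ?_ ?_
  · exact ((hK.measurable s).comp measurable_prodMk_left).aestronglyMeasurable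
  · filter_upwards [ae_enorm_kernel_le K s x] with y hy
    rw [← toReal_enorm]
    exact ENNReal.toReal_mono (layerBound_ne_top hK s) hy

lemma layer_congr {s : ℤ} {f g : (Fin d → ℝ) → ℂ} (h : f =ᵐ[volume] g) :
    layer K s f = layer K s g := by
  ext x
  exact integral_congr_ae (h.mono fun y hy => by simp only [hy])

lemma layer_add (hK : IsKernelFamily K) (s : ℤ) {f g : (Fin d → ℝ) → ℂ} (hf : Integrable f)
    (hg : Integrable g) (x : Fin d → ℝ) : layer K s (f + g) x = layer K s f x + layer K s g x := by
  simp only [layer, Pi.add_apply, mul_add]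
  exact integral_add (integrable_kernel_mul hK s x hf) (integrable_kernel_mul hK s x hg)

lemma layer_const_smul (s : ℤ) (f : (Fin d → ℝ) → ℂ) (c : ℂ) (x : Fin d → ℝ) :
    layer K s (c • f) x = c * layer K s f x := by
  simp only [layer, Pi.smul_apply, smul_eq_mul]
  rw [← integral_const_mul]
  congr 1; ext y; ring

lemma measurable_layer (hK : IsKernelFamily K) (s : ℤ) {f : (Fin d → ℝ) → ℂ}
    (hf : AEStronglyMeasurable f) : Measurable (layer K s f) := by
  rw [layer_congr hf.ae_eq_mk]
  refine (StronglyMeasurable.integral_prod_right ?_).measurable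
  refine Measurable.stronglyMeasurable ?_
  exact (hK.measurable s).mul (hf.stronglyMeasurable_mk.measurable.comp measurable_snd)

lemma enorm_layer_le (hK : IsKernelFamily K) (s : ℤ) (f : (Fin d → ℝ) → ℂ) (x : Fin d → ℝ) :
    ‖layer K s f x‖ₑ ≤ layerBound K s * ∫⁻ y, ‖f y‖ₑ := by
  refine (enorm_integral_le_lintegral_enorm _).trans ?_
  rw [← lintegral_const_mul' _ _ (layerBound_ne_top hK s)]
  refine lintegral_mono_ae ((ae_enorm_kernel_le K s x).mono fun y hy => ?_)
  rw [enorm_mul]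
  gcongr

/-- Coordinates are dominated by the Euclidean norm, so a layer of scale at most that of `L` moves
the support by less than `ℓ(L)` in each coordinate. This is why triples appear. -/
lemma layer_eq_zero_of_notMem (hK : IsKernelFamily K) {s : ℤ} {L : DyadicCube d}
    (hs : s ≤ L.scale) {f : (Fin d → ℝ) → ℂ} (hf : ∀ y ∉ L.set, f y = 0) {x : Fin d → ℝ}
    (hx : x ∉ L.dilate 3) : layer K s f x = 0 := by
  refine integral_eq_zero_of_ae (ae_of_all _ fun y => ?_)
  by_contra hne
  simp only [Pi.zero_apply, mul_eq_zero, not_or] at hne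
  have hy : y ∈ L.set := by by_contra hc; exact hne.2 (hf y hc)
  have hlt := (hK.support s x y hne.1).trans_le (zpow_le_zpow_right₀ one_le_two hs)
  apply hx
  rw [DyadicCube.mem_dilate]
  rw [DyadicCube.mem_set_iff_center] at hy
  intro i
  have hi : |x i - y i| < 2 ^ L.scale := by
    refine lt_of_le_of_lt ?_ hlt
    rw [← Real.sqrt_sq_eq_abs]
    exact Real.sqrt_le_sqrt (Finset.single_le_sum (f := fun i => (x i - y i) ^ 2)
      (fun j _ => sq_nonneg _) (Finset.mem_univ i))
  have h1 := abs_lt.1 hi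
  have h2 := hy i
  constructor <;> linarith

lemma truncation_eq_sum_layer (f : (Fin d → ℝ) → ℂ) (x : Fin d → ℝ) (a b : ℤ) :
    truncation K f x a b = ∑ s ∈ Finset.Ioc a b, layer K s f x := rfl

lemma truncation_congr {f g : (Fin d → ℝ) → ℂ} (h : f =ᵐ[volume] g) :
    truncation K f = truncation K g := by
  ext x a b
  simp only [truncation_eq_sum_layer, layer_congr h]

lemma truncation_add (hK : IsKernelFamily K) {f g : (Fin d → ℝ) → ℂ} (hf : Integrable f)
    (hg : Integrable g) (x : Fin d → ℝ) (a b : ℤ) :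
    truncation K (f + g) x a b = truncation K f x a b + truncation K g x a b := by
  simp only [truncation_eq_sum_layer, layer_add hK _ hf hg, Finset.sum_add_distrib]

lemma truncation_const_smul (f : (Fin d → ℝ) → ℂ) (c : ℂ) (x : Fin d → ℝ) (a b : ℤ) :
    truncation K (c • f) x a b = c * truncation K f x a b := by
  simp only [truncation_eq_sum_layer, layer_const_smul, Finset.mul_sum]

lemma truncation_eq_zero_of_notMem (hK : IsKernelFamily K) {L : DyadicCube d}
    {f : (Fin d → ℝ) → ℂ} (hf : ∀ y ∉ L.set, f y = 0) {x : Fin d → ℝ} (hx : x ∉ L.dilate 3)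
    {a b : ℤ} (hb : b ≤ L.scale) : truncation K f x a b = 0 :=
  Finset.sum_eq_zero fun _ hs =>
    layer_eq_zero_of_notMem hK ((Finset.mem_Ioc.1 hs).2.trans hb) hf hx

lemma measurable_truncation (hK : IsKernelFamily K) {f : (Fin d → ℝ) → ℂ}
    (hf : AEStronglyMeasurable f) (a b : ℤ) : Measurable fun x => truncation K f x a b := by
  simp only [truncation_eq_sum_layer]
  exact Finset.measurable_fun_sum _ fun s _ => measurable_layer hK s hf

lemma measurable_maximalTruncation (hK : IsKernelFamily K) {f : (Fin d → ℝ) → ℂ}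
    (hf : AEStronglyMeasurable f) : Measurable (maximalTruncation K f) :=
  Measurable.iSup fun a => Measurable.iSup fun b => Measurable.iSup fun _ =>
    (measurable_truncation hK hf a b).enorm

lemma enorm_truncation_le_maximalTruncation (f : (Fin d → ℝ) → ℂ) (x : Fin d → ℝ) (a b : ℤ) :
    ‖truncation K f x a b‖ₑ ≤ maximalTruncation K f x := by
  by_cases hab : a ≤ b
  · exact le_iSup_of_le a (le_iSup_of_le b (le_iSup_of_le hab le_rfl))
  · rw [truncation_eq_sum_layer, Finset.Ioc_eq_empty (by omega)]
    simp

/-- A summation range that does not depend on `a` and `b` lets measurability and boundedness be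
checked layer by layer when these vary with `x`. -/
lemma truncation_eq_sum_ite (f : (Fin d → ℝ) → ℂ) (x : Fin d → ℝ) {a b N : ℤ} (σ : ℤ)
    (ha : |a| ≤ N) (hb : |b| ≤ N) :
    truncation K f x a (min b σ) = ∑ s ∈ Finset.Ioc (-N) N,
      if a < s ∧ s ≤ b ∧ s ≤ σ then layer K s f x else 0 := by
  rw [truncation_eq_sum_layer, ← Finset.sum_filter]
  congr 1
  ext s
  have h1 := abs_le.1 ha
  have h2 := abs_le.1 hb
  simp only [Finset.mem_Ioc, Finset.mem_filter, le_min_iff]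
  omega

variable {t₁ t₂ : (Fin d → ℝ) → ℤ}

lemma measurable_truncation_comp (hK : IsKernelFamily K) (ht₁ : IsTruncationFunction t₁)
    (ht₂ : IsTruncationFunction t₂) (σ : ℤ) {f : (Fin d → ℝ) → ℂ} (hf : AEStronglyMeasurable f) :
    Measurable fun x => truncation K f x (t₁ x) (min (t₂ x) σ) := by
  obtain ⟨hm₁, N₁, hN₁⟩ := ht₁
  obtain ⟨hm₂, N₂, hN₂⟩ := ht₂
  simp_rw [fun x => truncation_eq_sum_ite (K := K) f x σ ((hN₁ x).trans (le_max_left N₁ N₂))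
    ((hN₂ x).trans (le_max_right N₁ N₂))]
  refine Finset.measurable_fun_sum _ fun s _ => Measurable.ite ?_ (measurable_layer hK s hf)
    measurable_const
  exact (measurableSet_lt hm₁ measurable_const).inter
    ((measurableSet_le measurable_const hm₂).inter (MeasurableSet.const _))

/-- A qualitative bound, used only for integrability; it depends on the range of `t₁, t₂` and does
not enter the final constant. -/
lemma exists_enorm_truncation_le (hK : IsKernelFamily K) (ht₁ : IsTruncationFunction t₁)
    (ht₂ : IsTruncationFunction t₂) (σ : ℤ) {f : (Fin d → ℝ) → ℂ} (hf : Integrable f) :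
    ∃ C : ℝ≥0∞, C ≠ ∞ ∧ ∀ x, ‖truncation K f x (t₁ x) (min (t₂ x) σ)‖ₑ ≤ C := by
  obtain ⟨hm₁, N₁, hN₁⟩ := ht₁
  obtain ⟨hm₂, N₂, hN₂⟩ := ht₂
  refine ⟨∑ s ∈ Finset.Ioc (-(max N₁ N₂)) (max N₁ N₂), layerBound K s * ∫⁻ y, ‖f y‖ₑ, ?_, ?_⟩
  · exact ENNReal.sum_ne_top.2 fun s _ => ENNReal.mul_ne_top (layerBound_ne_top hK s) hf.2.ne
  · intro x
    rw [truncation_eq_sum_ite (K := K) f x σ ((hN₁ x).trans (le_max_left N₁ N₂))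
      ((hN₂ x).trans (le_max_right N₁ N₂))]
    refine (enorm_sum_le _ _).trans (Finset.sum_le_sum fun s _ => ?_)
    split_ifs
    · exact enorm_layer_le hK s f x
    · simp

lemma integrable_truncation_mul (hK : IsKernelFamily K) (ht₁ : IsTruncationFunction t₁)
    (ht₂ : IsTruncationFunction t₂) (σ : ℤ) {f g : (Fin d → ℝ) → ℂ} (hf : Integrable f)
    (hg : Integrable g) :
    Integrable fun x => truncation K f x (t₁ x) (min (t₂ x) σ) * g x := by
  obtain ⟨C, hC, hb⟩ := exists_enorm_truncation_le hK ht₁ ht₂ σ hf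
  refine hg.bdd_mul (c := C.toReal)
    (measurable_truncation_comp hK ht₁ ht₂ σ hf.1).aestronglyMeasurable (ae_of_all _ fun x => ?_)
  rw [← toReal_enorm]
  exact ENNReal.toReal_mono hC (hb x)

lemma linearizedPairing_add_left (hK : IsKernelFamily K) (ht₁ : IsTruncationFunction t₁)
    (ht₂ : IsTruncationFunction t₂) (σ : ℤ) {f f' g : (Fin d → ℝ) → ℂ} (hf : Integrable f)
    (hf' : Integrable f') (hg : Integrable g) :
    linearizedPairing K t₁ t₂ σ (f + f') g =
      linearizedPairing K t₁ t₂ σ f g + linearizedPairing K t₁ t₂ σ f' g := by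
  simp only [linearizedPairing, truncation_add hK hf hf', add_mul]
  exact integral_add (integrable_truncation_mul hK ht₁ ht₂ σ hf hg)
    (integrable_truncation_mul hK ht₁ ht₂ σ hf' hg)

lemma linearizedPairing_add_right (hK : IsKernelFamily K) (ht₁ : IsTruncationFunction t₁)
    (ht₂ : IsTruncationFunction t₂) (σ : ℤ) {f g g' : (Fin d → ℝ) → ℂ} (hf : Integrable f)
    (hg : Integrable g) (hg' : Integrable g') :
    linearizedPairing K t₁ t₂ σ f (g + g') =
      linearizedPairing K t₁ t₂ σ f g + linearizedPairing K t₁ t₂ σ f g' := by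
  simp only [linearizedPairing, Pi.add_apply, mul_add]
  exact integral_add (integrable_truncation_mul hK ht₁ ht₂ σ hf hg)
    (integrable_truncation_mul hK ht₁ ht₂ σ hf hg')

lemma linearizedPairing_const_smul (σ : ℤ) (f g : (Fin d → ℝ) → ℂ) (a b : ℂ) :
    linearizedPairing K t₁ t₂ σ (a • f) (b • g) = a * b * linearizedPairing K t₁ t₂ σ f g := by
  simp only [linearizedPairing, truncation_const_smul, Pi.smul_apply, smul_eq_mul]
  rw [← integral_const_mul]
  congr 1; ext x; ring

lemma linearizedPairing_congr (σ : ℤ) {f f' g g' : (Fin d → ℝ) → ℂ} (hf : f =ᵐ[volume] f')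
    (hg : g =ᵐ[volume] g') :
    linearizedPairing K t₁ t₂ σ f g = linearizedPairing K t₁ t₂ σ f' g' := by
  simp only [linearizedPairing, truncation_congr hf]
  exact integral_congr_ae (hg.mono fun x hx => by simp only [hx])

/-- The range of scales is empty. This ends the recursion and makes the sums over stopping cubes
finite. -/
lemma linearizedPairing_eq_zero {N σ : ℤ} (hN : ∀ x, -N ≤ t₁ x) (hσ : σ ≤ -N)
    (f g : (Fin d → ℝ) → ℂ) : linearizedPairing K t₁ t₂ σ f g = 0 := by
  refine integral_eq_zero_of_ae (ae_of_all _ fun x => ?_)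
  have h1 := hN x
  have h2 := min_le_right (t₂ x) σ
  simp only [Pi.zero_apply]
  rw [truncation_eq_sum_layer, Finset.Ioc_eq_empty (by omega)]
  simp

lemma linearizedPairing_indicator_right (hK : IsKernelFamily K) {L : DyadicCube d}
    {B : Set (Fin d → ℝ)} (hB : L.dilate 3 ⊆ B) (f g : (Fin d → ℝ) → ℂ) :
    linearizedPairing K t₁ t₂ L.scale (L.set.indicator f) (B.indicator g) =
      linearizedPairing K t₁ t₂ L.scale (L.set.indicator f) g := by
  simp only [linearizedPairing]
  congr 1
  ext x
  by_cases hx : x ∈ B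
  · rw [indicator_of_mem hx]
  · rw [truncation_eq_zero_of_notMem hK (fun y hy => indicator_of_notMem hy f)
      (fun h => hx (hB h)) (min_le_right _ _), zero_mul, zero_mul]

lemma enorm_linearizedPairing_le (hK : IsKernelFamily K) (L : DyadicCube d)
    (f : (Fin d → ℝ) → ℂ) {g : (Fin d → ℝ) → ℂ} {M : ℝ≥0∞} (hM : M ≠ ∞)
    (hg : ∀ᵐ x, ‖g x‖ₑ ≤ M) :
    ‖linearizedPairing K t₁ t₂ L.scale (L.set.indicator f) g‖ₑ ≤
      (∫⁻ x in L.dilate 3, maximalTruncation K (L.set.indicator f) x) * M := by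
  refine (enorm_integral_le_lintegral_enorm _).trans ?_
  calc ∫⁻ x, ‖truncation K (L.set.indicator f) x (t₁ x) (min (t₂ x) L.scale) * g x‖ₑ
      ≤ ∫⁻ x, (L.dilate 3).indicator (maximalTruncation K (L.set.indicator f)) x * M := by
        refine lintegral_mono_ae (hg.mono fun x hx => ?_)
        rw [enorm_mul]
        by_cases hxL : x ∈ L.dilate 3
        · rw [indicator_of_mem hxL]
          gcongr
          exact enorm_truncation_le_maximalTruncation _ _ _ _
        · rw [truncation_eq_zero_of_notMem hK (fun y hy => indicator_of_notMem hy f)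
            hxL (min_le_right _ _)]
          simp
    _ ≤ _ := by
        rw [lintegral_mul_const' _ _ hM, lintegral_indicator (L.measurableSet_dilate three_pos)]

end

section

variable {d : ℕ} {K : ℤ → (Fin d → ℝ) → (Fin d → ℝ) → ℂ} {t₁ t₂ : (Fin d → ℝ) → ℤ}

/-! ### The maximal truncations on bounded functions -/

lemma maximalTruncation_const_smul (f : (Fin d → ℝ) → ℂ) (c : ℂ) (x : Fin d → ℝ) :
    maximalTruncation K (c • f) x = ‖c‖ₑ * maximalTruncation K f x := by
  simp only [maximalTruncation, truncation_const_smul, enorm_mul, ENNReal.mul_iSup]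

/-- `maximalNorm` is a supremum over the unit ball, and the maximal truncation is absolutely
homogeneous; functions of norm zero are treated separately. -/
lemma eLpNorm_maximalTruncation_le {r : ℝ≥0∞} (hr1 : 1 ≤ r) (hr : r ≠ ∞)
    {f : (Fin d → ℝ) → ℂ} (hf : MemLp f r) :
    eLpNorm (maximalTruncation K f) r volume ≤ maximalNorm r K * eLpNorm f r volume := by
  have hr0 : r ≠ 0 := (zero_lt_one.trans_le hr1).ne'
  have hpos : 0 < r.toReal := ENNReal.toReal_pos hr0 hr
  by_cases h0 : eLpNorm f r volume = 0
  · have hf0 := (eLpNorm_eq_zero_iff hf.1 hr0).1 h0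
    have : maximalTruncation K f = 0 := by
      ext x
      have h1 : f =ᵐ[volume] (0 : ℂ) • f := by simpa using hf0
      rw [maximalTruncation, truncation_congr h1]
      have := maximalTruncation_const_smul (K := K) f 0 x
      rw [maximalTruncation] at this
      rw [this]; simp
    rw [this]
    simp
  · set n := (eLpNorm f r volume).toReal with hn
    have hnpos : 0 < n := ENNReal.toReal_pos h0 hf.2.ne
    have hne : ‖(n : ℂ)‖ₑ = eLpNorm f r volume := by
      rw [← ofReal_norm, Complex.norm_real, Real.norm_of_nonneg hnpos.le, hn,
        ENNReal.ofReal_toReal hf.2.ne]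
    have hinv : ‖((n : ℂ))⁻¹‖ₑ = (eLpNorm f r volume)⁻¹ := by
      rw [enorm_inv (by exact_mod_cast hnpos.ne'), hne]
    have h1 : eLpNorm (maximalTruncation K ((n : ℂ)⁻¹ • f)) r volume ≤ maximalNorm r K := by
      refine le_iSup_of_le ((n : ℂ)⁻¹ • f) (le_iSup_of_le (hf.const_smul _)
        (le_iSup_of_le ?_ le_rfl))
      rw [eLpNorm_const_smul, hinv, ENNReal.inv_mul_cancel h0 hf.2.ne]
    have h2 : eLpNorm (maximalTruncation K ((n : ℂ)⁻¹ • f)) r volume =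
        (eLpNorm f r volume)⁻¹ * eLpNorm (maximalTruncation K f) r volume := by
      rw [eLpNorm_eq_lintegral_rpow_enorm_toReal hr0 hr (f := maximalTruncation K _),
        eLpNorm_eq_lintegral_rpow_enorm_toReal hr0 hr (f := maximalTruncation K f)]
      simp only [maximalTruncation_const_smul, enorm_eq_self, hinv]
      simp_rw [ENNReal.mul_rpow_of_nonneg _ _ hpos.le]
      rw [lintegral_const_mul' _ _ (ENNReal.rpow_ne_top_of_nonneg hpos.le
        (ENNReal.inv_ne_top.2 h0)), ENNReal.mul_rpow_of_nonneg _ _ (by positivity),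
        ← ENNReal.rpow_mul, mul_one_div_cancel hpos.ne', ENNReal.rpow_one]
    rw [h2] at h1
    calc eLpNorm (maximalTruncation K f) r volume
        = (eLpNorm f r volume)⁻¹ * eLpNorm (maximalTruncation K f) r volume *
          eLpNorm f r volume := by
          rw [mul_comm, ← mul_assoc, ENNReal.mul_inv_cancel h0 hf.2.ne, one_mul]
      _ ≤ _ := by gcongr

/-- Hölder on `B` together with the `L^r` bound: `|B|^{1/r}` from the norm of `f` times
`|B|^{1-1/r}` from Hölder gives `|B|`. -/
lemma setLIntegral_maximalTruncation_le (hK : IsKernelFamily K) {r : ℝ≥0∞} (hr1 : 1 ≤ r)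
    (hr : r ≠ ∞) {f : (Fin d → ℝ) → ℂ} (hf : MemLp f ∞) {B : Set (Fin d → ℝ)}
    (hB : MeasurableSet B) (hBv : volume B ≠ ∞) (h0 : ∀ x ∉ B, f x = 0) {M : ℝ≥0∞}
    (hM : ∀ᵐ x, ‖f x‖ₑ ≤ M) :
    ∫⁻ x in B, maximalTruncation K f x ≤ maximalNorm r K * M * volume B := by
  have hr0 : r ≠ 0 := (zero_lt_one.trans_le hr1).ne'
  have hpos : 0 < r.toReal := ENNReal.toReal_pos hr0 hr
  have hge : 1 ≤ r.toReal := by simpa using ENNReal.toReal_mono hr hr1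
  have hmeas := measurable_maximalTruncation hK hf.1
  have h1 := eLpNorm_le_eLpNorm_mul_rpow_measure_univ (μ := volume.restrict B) hr1
    (f := maximalTruncation K f) hmeas.aestronglyMeasurable
  rw [eLpNorm_one_eq_lintegral_enorm] at h1
  simp only [enorm_eq_self, Measure.restrict_apply_univ] at h1
  have hfr : eLpNorm f r volume ≤ M * volume B ^ (1 / r.toReal) := by
    have hfi : f = B.indicator f := by
      ext x
      by_cases hx : x ∈ B <;> simp [hx, h0]
    rw [hfi, eLpNorm_indicator_eq_eLpNorm_restrict hB]
    have := eLpNorm_le_of_ae_enorm_bound (p := r) (ae_restrict_of_ae (s := B) hM)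
    simpa using this
  by_cases hB0 : volume B = 0
  · rw [hB0, mul_zero, Measure.restrict_eq_zero.2 hB0]
    simp
  calc ∫⁻ x in B, maximalTruncation K f x
      ≤ eLpNorm (maximalTruncation K f) r (volume.restrict B) *
          volume B ^ (1 / ENNReal.toReal 1 - 1 / r.toReal) := h1
    _ ≤ maximalNorm r K * (M * volume B ^ (1 / r.toReal)) *
          volume B ^ (1 / ENNReal.toReal 1 - 1 / r.toReal) := by
        gcongr
        refine (eLpNorm_mono_measure _ Measure.restrict_le_self).trans ?_
        refine (eLpNorm_maximalTruncation_le hr1 hr (memLp_of_memLp_top hf hB hBv h0 r)).trans ?_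
        gcongr
    _ = maximalNorm r K * M * (volume B ^ (1 / r.toReal) *
          volume B ^ (1 / ENNReal.toReal 1 - 1 / r.toReal)) := by ring
    _ = maximalNorm r K * M * volume B := by
        rw [← ENNReal.rpow_add _ _ hB0 hBv]
        simp

/-! ### The localized forms -/

/-- The localized form without its normalizing factor. -/
def localizedDifference (K : ℤ → (Fin d → ℝ) → (Fin d → ℝ) → ℂ)
    (t₁ t₂ : (Fin d → ℝ) → ℤ) (Q : DyadicCube d) (𝒬 : Set (DyadicCube d))
    (f₁ f₂ : (Fin d → ℝ) → ℂ) : ℂ :=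
  linearizedPairing K t₁ t₂ Q.scale (Q.set.indicator f₁) f₂ -
    ∑' L : {L : DyadicCube d // L ∈ 𝒬 ∧ L.set ⊆ Q.set},
      linearizedPairing K t₁ t₂ L.1.scale (L.1.set.indicator f₁) f₂

lemma enorm_localizedForm (Q : DyadicCube d) (𝒬 : Set (DyadicCube d))
    (f₁ f₂ : (Fin d → ℝ) → ℂ) :
    ‖localizedForm K t₁ t₂ Q 𝒬 f₁ f₂‖ₑ =
      (volume Q.set)⁻¹ * ‖localizedDifference K t₁ t₂ Q 𝒬 f₁ f₂‖ₑ := by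
  have hpos := ENNReal.toReal_pos Q.volume_ne_zero Q.volume_ne_top
  rw [localizedForm, enorm_mul, enorm_inv (by exact_mod_cast hpos.ne'), localizedDifference]
  congr 2
  rw [← ofReal_norm, Complex.norm_real, Real.norm_of_nonneg hpos.le,
    ENNReal.ofReal_toReal Q.volume_ne_top]

lemma IsStoppingCollection.tsum_volume_le {Q : DyadicCube d} {𝒬 : Set (DyadicCube d)}
    (h : IsStoppingCollection Q 𝒬) :
    ∑' L : {L : DyadicCube d // L ∈ 𝒬 ∧ L.set ⊆ Q.set}, volume L.1.set ≤ volume Q.set := by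
  have := h.tsum_volume_inter_le MeasurableSet.univ
  simp only [univ_inter] at this
  exact this.trans (measure_mono inter_subset_left)

/-- Disjoint cubes inside `Q` with volume bounded below are finite in number. -/
lemma IsStoppingCollection.finite_scale_gt {Q : DyadicCube d} {𝒬 : Set (DyadicCube d)}
    (h : IsStoppingCollection Q 𝒬) (N : ℤ) :
    {L : {L : DyadicCube d // L ∈ 𝒬 ∧ L.set ⊆ Q.set} | N < L.1.scale}.Finite := by
  have hfin := ENNReal.finite_const_le_of_tsum_ne_top (h.tsum_volume_le.trans_lt
    Q.volume_ne_top.lt_top).ne (ε := ENNReal.ofReal ((2 : ℝ) ^ N) ^ d)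
    (pow_ne_zero _ (by simp; positivity))
  refine hfin.subset fun L hL => ?_
  have hL : N < L.1.scale := hL
  change _ ≤ volume L.1.set
  rw [L.1.volume_set]
  gcongr
  exact one_le_two

lemma IsStoppingCollection.hasFiniteSupport {Q : DyadicCube d} {𝒬 : Set (DyadicCube d)}
    (h : IsStoppingCollection Q 𝒬) (ht₁ : IsTruncationFunction t₁) (f₁ f₂ : (Fin d → ℝ) → ℂ) :
    (Function.support fun L : {L : DyadicCube d // L ∈ 𝒬 ∧ L.set ⊆ Q.set} =>
      linearizedPairing K t₁ t₂ L.1.scale (L.1.set.indicator f₁) f₂).Finite := by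
  obtain ⟨-, N, hN⟩ := ht₁
  refine (h.finite_scale_gt (-N)).subset fun L hL => ?_
  by_contra hc
  exact hL (linearizedPairing_eq_zero (fun x => (abs_le.1 (hN x)).1) (not_lt.1 hc) _ _)

lemma IsStoppingCollection.summable_linearizedPairing {Q : DyadicCube d} {𝒬 : Set (DyadicCube d)}
    (h : IsStoppingCollection Q 𝒬) (ht₁ : IsTruncationFunction t₁) (f₁ f₂ : (Fin d → ℝ) → ℂ) :
    Summable fun L : {L : DyadicCube d // L ∈ 𝒬 ∧ L.set ⊆ Q.set} =>
      linearizedPairing K t₁ t₂ L.1.scale (L.1.set.indicator f₁) f₂ :=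
  summable_of_hasFiniteSupport (h.hasFiniteSupport ht₁ f₁ f₂)

/-! ### Bilinearity, locality and size of the localized difference. -/

section Algebra

variable {Q : DyadicCube d} {𝒬 : Set (DyadicCube d)}

lemma localizedDifference_add_left (hK : IsKernelFamily K) (ht₁ : IsTruncationFunction t₁)
    (ht₂ : IsTruncationFunction t₂) (hs : IsStoppingCollection Q 𝒬) {f f' g : (Fin d → ℝ) → ℂ}
    (hf : Integrable f) (hf' : Integrable f') (hg : Integrable g) :
    localizedDifference K t₁ t₂ Q 𝒬 (f + f') g =
      localizedDifference K t₁ t₂ Q 𝒬 f g + localizedDifference K t₁ t₂ Q 𝒬 f' g := by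
  simp only [localizedDifference, indicator_add']
  rw [linearizedPairing_add_left hK ht₁ ht₂ _ (hf.indicator Q.measurableSet_set)
    (hf'.indicator Q.measurableSet_set) hg]
  have : ∀ L : {L : DyadicCube d // L ∈ 𝒬 ∧ L.set ⊆ Q.set}, _ := fun L =>
    linearizedPairing_add_left hK ht₁ ht₂ L.1.scale (hf.indicator L.1.measurableSet_set)
    (hf'.indicator L.1.measurableSet_set) hg
  simp only [this]
  rw [Summable.tsum_add (hs.summable_linearizedPairing ht₁ _ _)
    (hs.summable_linearizedPairing ht₁ _ _)]
  ring

lemma localizedDifference_add_right (hK : IsKernelFamily K) (ht₁ : IsTruncationFunction t₁)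
    (ht₂ : IsTruncationFunction t₂) (hs : IsStoppingCollection Q 𝒬) {f g g' : (Fin d → ℝ) → ℂ}
    (hf : Integrable f) (hg : Integrable g) (hg' : Integrable g') :
    localizedDifference K t₁ t₂ Q 𝒬 f (g + g') =
      localizedDifference K t₁ t₂ Q 𝒬 f g + localizedDifference K t₁ t₂ Q 𝒬 f g' := by
  simp only [localizedDifference]
  rw [linearizedPairing_add_right hK ht₁ ht₂ _ (hf.indicator Q.measurableSet_set) hg hg']
  have : ∀ L : {L : DyadicCube d // L ∈ 𝒬 ∧ L.set ⊆ Q.set}, _ := fun L =>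
    linearizedPairing_add_right hK ht₁ ht₂ L.1.scale (hf.indicator L.1.measurableSet_set) hg hg'
  simp only [this]
  rw [Summable.tsum_add (hs.summable_linearizedPairing ht₁ _ _)
    (hs.summable_linearizedPairing ht₁ _ _)]
  ring

lemma localizedDifference_const_smul (f g : (Fin d → ℝ) → ℂ) (a b : ℂ) :
    localizedDifference K t₁ t₂ Q 𝒬 (a • f) (b • g) =
      a * b * localizedDifference K t₁ t₂ Q 𝒬 f g := by
  have hi : ∀ s : Set (Fin d → ℝ), s.indicator (a • f) = a • s.indicator f := fun s => by
    ext x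
    by_cases hx : x ∈ s <;> simp [hx]
  simp only [localizedDifference, hi, linearizedPairing_const_smul, tsum_mul_left]
  ring

lemma localizedDifference_congr {f f' g g' : (Fin d → ℝ) → ℂ} (hf : f =ᵐ[volume] f')
    (hg : g =ᵐ[volume] g') :
    localizedDifference K t₁ t₂ Q 𝒬 f g = localizedDifference K t₁ t₂ Q 𝒬 f' g' := by
  have hi : ∀ s : Set (Fin d → ℝ), s.indicator f =ᵐ[volume] s.indicator f' := fun s => by
    filter_upwards [hf] with x hx
    simp only [indicator, hx]
  rw [localizedDifference, localizedDifference, linearizedPairing_congr _ (hi _) hg,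
    tsum_congr fun L => linearizedPairing_congr _ (hi _) hg]

/-- Every pairing involved starts from a cube `L ⊆ Q` and is supported in `3L ⊆ 3Q`. -/
lemma localizedDifference_indicator (hK : IsKernelFamily K) (f g : (Fin d → ℝ) → ℂ) :
    localizedDifference K t₁ t₂ Q 𝒬 ((Q.dilate 3).indicator f) ((Q.dilate 3).indicator g) =
      localizedDifference K t₁ t₂ Q 𝒬 f g := by
  have hQ := Q.subset_dilate (k := 3) (by norm_num)
  have : ∀ L : DyadicCube d, L.set ⊆ Q.set →
      linearizedPairing K t₁ t₂ L.scale (L.set.indicator ((Q.dilate 3).indicator f))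
        ((Q.dilate 3).indicator g) =
      linearizedPairing K t₁ t₂ L.scale (L.set.indicator f) g := by
    intro L hL
    rw [indicator_indicator, inter_eq_left.2 (hL.trans hQ)]
    exact linearizedPairing_indicator_right hK
      (DyadicCube.dilate_subset_dilate hL (by norm_num)) f g
  unfold localizedDifference
  exact congrArg₂ (· - ·) (this Q subset_rfl) (tsum_congr fun L => this L.1 L.2.2)

/-- The good–good term uses no cancellation: each cube contributes at most a multiple of its volume,
and the disjoint stopping cubes inside `Q` together cost no more than `Q` itself, whence the factor
`2`. -/
lemma enorm_localizedDifference_le_maximalNorm (hK : IsKernelFamily K)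
    (ht₁ : IsTruncationFunction t₁) (hs : IsStoppingCollection Q 𝒬) {r : ℝ≥0∞} (hr1 : 1 ≤ r)
    (hr : r ≠ ∞) {f g : (Fin d → ℝ) → ℂ} (hf : MemLp f ∞) {M M' : ℝ≥0∞} (hM' : M' ≠ ∞)
    (hfM : ∀ᵐ x, ‖f x‖ₑ ≤ M) (hgM : ∀ᵐ x, ‖g x‖ₑ ≤ M') :
    ‖localizedDifference K t₁ t₂ Q 𝒬 f g‖ₑ ≤
      2 * 3 ^ d * maximalNorm r K * (M * M') * volume Q.set := by
  have hL : ∀ L : DyadicCube d,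
      ‖linearizedPairing K t₁ t₂ L.scale (L.set.indicator f) g‖ₑ ≤
        3 ^ d * maximalNorm r K * (M * M') * volume L.set := by
    intro L
    refine (enorm_linearizedPairing_le hK L f hM' hgM).trans ?_
    calc (∫⁻ x in L.dilate 3, maximalTruncation K (L.set.indicator f) x) * M'
        ≤ maximalNorm r K * M * volume (L.dilate 3) * M' := by
          gcongr
          refine setLIntegral_maximalTruncation_le hK hr1 hr (hf.indicator L.measurableSet_set)
            (L.measurableSet_dilate three_pos) L.volume_dilate_three_ne_top
            (fun x hx => indicator_of_notMem
              (fun h => hx (L.subset_dilate (by norm_num) h)) f) ?_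
          filter_upwards [hfM] with x hx
          exact (enorm_indicator_le_enorm_self f x).trans hx
      _ = _ := by rw [L.volume_dilate_three]; ring
  have hsum : ‖∑' L : {L : DyadicCube d // L ∈ 𝒬 ∧ L.set ⊆ Q.set},
      linearizedPairing K t₁ t₂ L.1.scale (L.1.set.indicator f) g‖ₑ ≤
      3 ^ d * maximalNorm r K * (M * M') * volume Q.set := by
    rw [tsum_eq_sum' (s := (hs.hasFiniteSupport (K := K) (t₂ := t₂) ht₁ f g).toFinset) (by simp)]
    refine (enorm_sum_le _ _).trans ((Finset.sum_le_sum fun L _ => hL L.1).trans ?_)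
    rw [← Finset.mul_sum]
    gcongr
    exact (ENNReal.sum_le_tsum _).trans hs.tsum_volume_le
  rw [localizedDifference]
  refine enorm_sub_le.trans ((add_le_add (hL Q) hsum).trans_eq ?_)
  ring

/-- Homogeneity passes from unit spheres to all functions. The predicates `F` and `G` stand for
membership in the two atomic classes, so that both suprema in `localizedConstant` are covered at
once. -/
lemma enorm_localizedDifference_le (p p' : ℝ≥0∞) (hp : 1 ≤ p) (hp' : 1 ≤ p')
    {C : ℝ≥0∞} {f g : (Fin d → ℝ) → ℂ} {F G : ((Fin d → ℝ) → ℂ) → Prop}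
    (hF : ∀ c : ℂ, c ≠ 0 → F (c • f)) (hG : ∀ c : ℂ, c ≠ 0 → G (c • g))
    (hfm : AEStronglyMeasurable f) (hgm : AEStronglyMeasurable g)
    (hft : normY p 𝒬 f ≠ ∞) (hgt : normY p' 𝒬 g ≠ ∞)
    (hC : ∀ f g, F f → G g → normY p 𝒬 f = 1 → normY p' 𝒬 g = 1 →
      ‖localizedForm K t₁ t₂ Q 𝒬 f g‖ₑ ≤ C) :
    ‖localizedDifference K t₁ t₂ Q 𝒬 f g‖ₑ ≤
      C * (normY p 𝒬 f * normY p' 𝒬 g) * volume Q.set := by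
  by_cases hf0 : normY p 𝒬 f = 0
  · have h1 : f =ᵐ[volume] (0 : ℂ) • f := by
      simpa using ae_eq_zero_of_normY_eq_zero hp hfm hf0
    have h2 : g =ᵐ[volume] (1 : ℂ) • g := by simp
    rw [localizedDifference_congr h1 h2, localizedDifference_const_smul]
    simp
  by_cases hg0 : normY p' 𝒬 g = 0
  · have h1 : g =ᵐ[volume] (0 : ℂ) • g := by
      simpa using ae_eq_zero_of_normY_eq_zero hp' hgm hg0
    have h2 : f =ᵐ[volume] (1 : ℂ) • f := by simp
    rw [localizedDifference_congr h2 h1, localizedDifference_const_smul]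
    simp
  have key : ∀ n : ℝ≥0∞, n ≠ 0 → n ≠ ∞ →
      ((n.toReal : ℂ)⁻¹ ≠ 0 ∧ ‖(n.toReal : ℂ)⁻¹‖ₑ = n⁻¹) := by
    intro n h0 ht
    have hpos := ENNReal.toReal_pos h0 ht
    have hne : (n.toReal : ℂ) ≠ 0 := by exact_mod_cast hpos.ne'
    refine ⟨inv_ne_zero hne, ?_⟩
    rw [enorm_inv hne, ← ofReal_norm, Complex.norm_real, Real.norm_of_nonneg hpos.le,
      ENNReal.ofReal_toReal ht]
  obtain ⟨ha, han⟩ := key _ hf0 hft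
  obtain ⟨hb, hbn⟩ := key _ hg0 hgt
  have h1 := hC _ _ (hF _ ha) (hG _ hb)
    (by rw [normY_const_smul _ _ ha, han, ENNReal.inv_mul_cancel hf0 hft])
    (by rw [normY_const_smul _ _ hb, hbn, ENNReal.inv_mul_cancel hg0 hgt])
  rw [enorm_localizedForm, localizedDifference_const_smul, enorm_mul, enorm_mul, han, hbn,
    ← ENNReal.mul_inv (Or.inl hf0) (Or.inl hft), ← mul_assoc,
    ← ENNReal.mul_inv (Or.inl Q.volume_ne_zero) (Or.inl Q.volume_ne_top), mul_comm,
    ← div_eq_mul_inv, ENNReal.div_le_iff (mul_ne_zero Q.volume_ne_zero (mul_ne_zero hf0 hg0))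
      (ENNReal.mul_ne_top Q.volume_ne_top (ENNReal.mul_ne_top hft hgt))] at h1
  refine h1.trans_eq (by ring)

lemma MemY.const_smul {p : ℝ≥0∞} {f : (Fin d → ℝ) → ℂ} (hf : MemY p Q 𝒬 f) {c : ℂ}
    (hc : c ≠ 0) : MemY p Q 𝒬 (c • f) where
  memLp := hf.memLp.const_smul c
  support := hf.support.mono fun x hx hxQ => by simp [hx hxQ]
  norm_lt := by
    rw [normY_const_smul _ _ hc]
    exact (ENNReal.mul_ne_top enorm_ne_top hf.norm_lt.ne).lt_top

lemma MemXdot.const_smul {p : ℝ≥0∞} {f : (Fin d → ℝ) → ℂ} (hf : MemXdot p Q 𝒬 f) {c : ℂ}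
    (hc : c ≠ 0) : MemXdot p Q 𝒬 (c • f) where
  memY := hf.memY.const_smul hc
  support := hf.support.mono fun x hx hxQ => by simp [hx hxQ]
  mean_zero := fun L hL => by
    simp only [Pi.smul_apply]
    rw [integral_smul, hf.mean_zero L hL, smul_zero]

lemma enorm_localizedDifference_le_of_memXdot_left {p₁ p₂ : ℝ≥0∞} (hp₁ : 1 ≤ p₁) (hp₂ : 1 ≤ p₂)
    (hs : IsStoppingCollection Q 𝒬) (ht₁ : IsTruncationFunction t₁)
    (ht₂ : IsTruncationFunction t₂) {b f : (Fin d → ℝ) → ℂ} (hb : MemXdot p₁ Q 𝒬 b)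
    (hf : MemY p₂ Q 𝒬 f) :
    ‖localizedDifference K t₁ t₂ Q 𝒬 b f‖ₑ ≤
      localizedConstant p₁ p₂ K * (normY p₁ 𝒬 b * normY p₂ 𝒬 f) * volume Q.set := by
  refine enorm_localizedDifference_le p₁ p₂ hp₁ hp₂ (F := MemXdot p₁ Q 𝒬) (G := MemY p₂ Q 𝒬)
    (fun c hc => hb.const_smul hc) (fun c hc => hf.const_smul hc) hb.memY.memLp.1 hf.memLp.1
    hb.memY.norm_lt.ne hf.norm_lt.ne fun b f hb hf hbn hfn => ?_
  refine le_iSup_of_le Q <| le_iSup_of_le 𝒬 <| le_iSup_of_le hs <| le_iSup_of_le t₁ <|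
    le_iSup_of_le ht₁ <| le_iSup_of_le t₂ <| le_iSup_of_le ht₂ <| le_trans ?_ le_self_add
  exact le_iSup_of_le b <| le_iSup_of_le hb <| le_iSup_of_le hbn <| le_iSup_of_le f <|
    le_iSup_of_le hf <| le_iSup_of_le hfn le_rfl

lemma enorm_localizedDifference_le_of_memXdot_right {p₁ p₂ : ℝ≥0∞} (hp₂ : 1 ≤ p₂)
    (hs : IsStoppingCollection Q 𝒬) (ht₁ : IsTruncationFunction t₁)
    (ht₂ : IsTruncationFunction t₂) {f b : (Fin d → ℝ) → ℂ} (hf : MemY ∞ Q 𝒬 f)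
    (hb : MemXdot p₂ Q 𝒬 b) :
    ‖localizedDifference K t₁ t₂ Q 𝒬 f b‖ₑ ≤
      localizedConstant p₁ p₂ K * (normY ∞ 𝒬 f * normY p₂ 𝒬 b) * volume Q.set := by
  refine enorm_localizedDifference_le ∞ p₂ le_top hp₂ (F := MemY ∞ Q 𝒬) (G := MemXdot p₂ Q 𝒬)
    (fun c hc => hf.const_smul hc) (fun c hc => hb.const_smul hc) hf.memLp.1 hb.memY.memLp.1
    hf.norm_lt.ne hb.memY.norm_lt.ne fun f b hf hb hfn hbn => ?_
  refine le_iSup_of_le Q <| le_iSup_of_le 𝒬 <| le_iSup_of_le hs <| le_iSup_of_le t₁ <|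
    le_iSup_of_le ht₁ <| le_iSup_of_le t₂ <| le_iSup_of_le ht₂ <| le_trans ?_ le_add_self
  exact le_iSup_of_le f <| le_iSup_of_le hf <| le_iSup_of_le hfn <| le_iSup_of_le b <|
    le_iSup_of_le hb <| le_iSup_of_le hbn le_rfl

end Algebra

end

section

variable {d : ℕ} {K : ℤ → (Fin d → ℝ) → (Fin d → ℝ) → ℂ} {t₁ t₂ : (Fin d → ℝ) → ℤ}

/-! ### The stopping estimate and its iteration -/

/-- The constant of the stopping estimate. -/
def stepConstant (d : ℕ) : ℝ≥0 :=
  (2 * 32 ^ d + 2 * 32 ^ d * 32 ^ d + 2 * 3 ^ d * (32 ^ d * 32 ^ d)) *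
    ((2 ^ d * (2 * 30 ^ d)) * (2 ^ d * (2 * 30 ^ d)))

lemma average_ne_top {p : ℝ≥0∞} {Q : Cube d} {f : (Fin d → ℝ) → ℂ} (hf : MemLp f ∞) :
    average p Q f ≠ ∞ := by
  refine (lt_of_le_of_lt (average_le_of_ae_le (M := eLpNorm f ∞ volume) ?_) hf.2).ne
  rw [eLpNorm_exponent_top]
  exact (enorm_ae_le_eLpNormEssSup f volume).mono fun x hx _ => hx

lemma isStoppingCollection_empty (Q : DyadicCube d) : IsStoppingCollection Q ∅ where
  shadow_subset := by simp [shadow]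
  dilate_subset := by simp
  disjoint := by simp
  scale_le := by simp

lemma indicator_dilate_ae_eq_zero {p : ℝ≥0∞} (hp1 : 1 ≤ p) {Q : DyadicCube d}
    {f : (Fin d → ℝ) → ℂ} (hf : AEStronglyMeasurable f) (h : average p Q.triple f = 0) :
    (Q.dilate 3).indicator f =ᵐ[volume] 0 := by
  rw [average, ENNReal.div_eq_zero_iff, Q.set_triple] at h
  rcases h with h | h
  · exact (eLpNorm_eq_zero_iff (hf.indicator (Q.measurableSet_dilate three_pos))
      (zero_lt_one.trans_le hp1).ne').1 h
  · exact absurd h (ENNReal.rpow_ne_top_of_nonneg (by positivity) Q.volume_dilate_three_ne_top)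

/-- The stopping estimate: every dyadic cube has a stopping collection of small measure for which
the localized form is controlled by the averages. -/
lemma exists_stopping_estimate [NeZero d] (hK : IsKernelFamily K) (ht₁ : IsTruncationFunction t₁)
    (ht₂ : IsTruncationFunction t₂) {r p₁ p₂ : ℝ≥0∞} (hr1 : 1 ≤ r) (hr : r ≠ ∞) (hp₁ : 1 ≤ p₁)
    (hp₁t : p₁ ≠ ∞) (hp₂ : 1 ≤ p₂) (hp₂t : p₂ ≠ ∞) {f₁ f₂ : (Fin d → ℝ) → ℂ}
    (hf₁ : MemLp f₁ ∞) (hf₂ : MemLp f₂ ∞) (Q : DyadicCube d) :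
    ∃ 𝒬 : Set (DyadicCube d), IsStoppingCollection Q 𝒬 ∧ (∀ L ∈ 𝒬, L.scale < Q.scale) ∧
      2 * volume (shadow 𝒬) ≤ volume Q.set ∧
      ‖localizedDifference K t₁ t₂ Q 𝒬 f₁ f₂‖ₑ ≤
        stepConstant d * (maximalNorm r K + localizedConstant p₁ p₂ K) *
          (volume Q.set * (average p₁ Q.triple f₁ * average p₂ Q.triple f₂)) := by
  -- With a zero average the threshold set of the stopping construction degenerates. But then one
  -- function vanishes almost everywhere on `3Q`, and the empty collection works.
  by_cases h0 : average p₁ Q.triple f₁ = 0 ∨ average p₂ Q.triple f₂ = 0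
  · refine ⟨∅, isStoppingCollection_empty Q, by simp, by simp [shadow], ?_⟩
    rw [← localizedDifference_indicator hK]
    suffices h : localizedDifference K t₁ t₂ Q ∅ ((Q.dilate 3).indicator f₁)
        ((Q.dilate 3).indicator f₂) = 0 by
      rw [h]; simp
    rcases h0 with h0 | h0
    · have h1 : (Q.dilate 3).indicator f₁ =ᵐ[volume] (0 : ℂ) • (Q.dilate 3).indicator f₁ := by
        simpa using indicator_dilate_ae_eq_zero hp₁ hf₁.1 h0
      have h2 : (Q.dilate 3).indicator f₂ =ᵐ[volume] (1 : ℂ) • (Q.dilate 3).indicator f₂ := by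
        simp
      rw [localizedDifference_congr h1 h2, localizedDifference_const_smul, zero_mul, zero_mul]
    · have h1 : (Q.dilate 3).indicator f₂ =ᵐ[volume] (0 : ℂ) • (Q.dilate 3).indicator f₂ := by
        simpa using indicator_dilate_ae_eq_zero hp₂ hf₂.1 h0
      have h2 : (Q.dilate 3).indicator f₁ =ᵐ[volume] (1 : ℂ) • (Q.dilate 3).indicator f₁ := by
        simp
      rw [localizedDifference_congr h2 h1, localizedDifference_const_smul, mul_zero, zero_mul]
  push Not at h0
  obtain ⟨𝒬, hs, hsc, hvol, hj⟩ := exists_stoppingCollection (p := ![p₁, p₂]) (f := ![f₁, f₂])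
    (by simp [Fin.forall_fin_two, hp₁, hp₂]) (by simp [Fin.forall_fin_two, hp₁t, hp₂t]) Q
    (by simp [Fin.forall_fin_two, hf₁, hf₂]) (by simp [Fin.forall_fin_two, h0])
  refine ⟨𝒬, hs, hsc, hvol, ?_⟩
  have hj₁ := hj 0
  have hj₂ := hj 1
  simp only [Matrix.cons_val_zero, Matrix.cons_val_one] at hj₁ hj₂
  set c : ℝ≥0∞ := 2 ^ d * (2 * 30 ^ d) with hc
  have hct : c ≠ ∞ := ENNReal.mul_ne_top (by simp) (ENNReal.mul_ne_top (by simp) (by simp))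
  set a₁ := average p₁ Q.triple f₁
  set a₂ := average p₂ Q.triple f₂
  have ha₁ : c * a₁ ≠ ∞ := ENNReal.mul_ne_top hct (average_ne_top hf₁)
  have ha₂ : c * a₂ ≠ ∞ := ENNReal.mul_ne_top hct (average_ne_top hf₂)
  have hQm := Q.measurableSet_dilate (k := 3) three_pos
  rw [← localizedDifference_indicator hK]
  set h₁ := (Q.dilate 3).indicator f₁ with hh₁
  set h₂ := (Q.dilate 3).indicator f₂ with hh₂
  have hm₁ : MemLp h₁ ∞ := hf₁.indicator hQm
  have hm₂ : MemLp h₂ ∞ := hf₂.indicator hQm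
  have hz₁ : ∀ x ∉ Q.dilate 3, h₁ x = 0 := fun x hx => indicator_of_notMem hx _
  have hz₂ : ∀ x ∉ Q.dilate 3, h₂ x = 0 := fun x hx => indicator_of_notMem hx _
  obtain ⟨g₁, b₁, e₁, hg₁, hg₁0, hg₁b, hb₁, hb₁0, hb₁X, hb₁n⟩ :=
    exists_calderonZygmund hp₁ hp₁t hs hm₁ hz₁ ha₁ hj₁.1 hj₁.2
  obtain ⟨g₂, b₂, e₂, hg₂, hg₂0, hg₂b, hb₂, hb₂0, hb₂X, hb₂n⟩ :=
    exists_calderonZygmund hp₂ hp₂t hs hm₂ hz₂ ha₂ hj₂.1 hj₂.2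
  have hint : ∀ {f : (Fin d → ℝ) → ℂ}, MemLp f ∞ → (∀ x ∉ Q.dilate 3, f x = 0) →
      Integrable f := fun hf h0 => memLp_one_iff_integrable.1
    (memLp_of_memLp_top hf hQm Q.volume_dilate_three_ne_top h0 1)
  -- The bad part of the first function is paired with the whole of `h₂`, so only the two kinds of
  -- pairs tested by `localizedConstant` occur besides good–good.
  have hsplit : localizedDifference K t₁ t₂ Q 𝒬 h₁ h₂ =
      localizedDifference K t₁ t₂ Q 𝒬 g₁ g₂ + localizedDifference K t₁ t₂ Q 𝒬 g₁ b₂ +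
        localizedDifference K t₁ t₂ Q 𝒬 b₁ h₂ := by
    rw [← localizedDifference_add_right hK ht₁ ht₂ hs (hint hg₁ hg₁0) (hint hg₂ hg₂0)
      (hint hb₂ hb₂0), ← e₂, ← localizedDifference_add_left hK ht₁ ht₂ hs (hint hg₁ hg₁0)
      (hint hb₁ hb₁0) (hint hm₂ hz₂), ← e₁]
  have hY₂ : normY p₂ 𝒬 h₂ ≤ c * a₂ := normY_le hp₂t hj₂.1 hj₂.2
  have hg₁Y : normY ∞ 𝒬 g₁ ≤ 32 ^ d * (c * a₁) := by
    rw [normY, if_pos rfl, eLpNorm_exponent_top]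
    exact eLpNormEssSup_le_of_ae_enorm_bound hg₁b
  have h32 : (32 : ℝ≥0∞) ^ d * (c * a₁) ≠ ∞ := ENNReal.mul_ne_top (by simp) ha₁
  have h32' : (32 : ℝ≥0∞) ^ d * (c * a₂) ≠ ∞ := ENNReal.mul_ne_top (by simp) ha₂
  have B1 := enorm_localizedDifference_le_maximalNorm (t₂ := t₂) hK ht₁ hs hr1 hr hg₁ h32'
    hg₁b hg₂b
  have B2 := enorm_localizedDifference_le_of_memXdot_right (K := K) (p₁ := p₁) hp₂ hs ht₁ ht₂
    (memY_of_memLp_top hg₁ hg₁0 (hg₁Y.trans_lt h32.lt_top)) hb₂X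
  have B3 := enorm_localizedDifference_le_of_memXdot_left (K := K) hp₁ hp₂ hs ht₁ ht₂
    hb₁X (memY_of_memLp_top hm₂ hz₂ (hY₂.trans_lt ha₂.lt_top))
  rw [hsplit]
  set N := maximalNorm r K
  set CL := localizedConstant p₁ p₂ K
  calc ‖localizedDifference K t₁ t₂ Q 𝒬 g₁ g₂ + localizedDifference K t₁ t₂ Q 𝒬 g₁ b₂ +
        localizedDifference K t₁ t₂ Q 𝒬 b₁ h₂‖ₑ
      ≤ 2 * 3 ^ d * N * (32 ^ d * (c * a₁) * (32 ^ d * (c * a₂))) * volume Q.set +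
        CL * (normY ∞ 𝒬 g₁ * normY p₂ 𝒬 b₂) * volume Q.set +
        CL * (normY p₁ 𝒬 b₁ * normY p₂ 𝒬 h₂) * volume Q.set :=
        (enorm_add_le _ _).trans (add_le_add ((enorm_add_le _ _).trans (add_le_add B1 B2)) B3)
    _ ≤ 2 * 3 ^ d * (N + CL) * (32 ^ d * (c * a₁) * (32 ^ d * (c * a₂))) * volume Q.set +
        (N + CL) * (32 ^ d * (c * a₁) * (2 * 32 ^ d * (c * a₂))) * volume Q.set +
        (N + CL) * (2 * 32 ^ d * (c * a₁) * (c * a₂)) * volume Q.set := by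
        gcongr
        · exact le_self_add
        · exact le_add_self
        · exact le_add_self
    _ = stepConstant d * (N + CL) * (volume Q.set * (a₁ * a₂)) := by
        rw [hc, stepConstant]
        push_cast
        ring

open Classical in
/-- Iterating the stopping estimate: the pairing localized to a cube is dominated by a finite
collection of dyadic cubes with a Carleson packing property. -/
lemma exists_carleson_domination [NeZero d] (hK : IsKernelFamily K)
    (ht₁ : IsTruncationFunction t₁)
    (ht₂ : IsTruncationFunction t₂) {r p₁ p₂ : ℝ≥0∞} (hr1 : 1 ≤ r) (hr : r ≠ ∞) (hp₁ : 1 ≤ p₁)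
    (hp₁t : p₁ ≠ ∞) (hp₂ : 1 ≤ p₂) (hp₂t : p₂ ≠ ∞) {f₁ f₂ : (Fin d → ℝ) → ℂ}
    (hf₁ : MemLp f₁ ∞) (hf₂ : MemLp f₂ ∞) (Q : DyadicCube d) :
    ∃ 𝒯 : Finset (DyadicCube d), (∀ R ∈ 𝒯, R.set ⊆ Q.set) ∧
      (∀ A : Set (Fin d → ℝ), MeasurableSet A →
        ∑ R ∈ 𝒯, (if R.set ⊆ A then volume R.set else 0) ≤ 2 * volume (A ∩ Q.set)) ∧
      ‖linearizedPairing K t₁ t₂ Q.scale (Q.set.indicator f₁) f₂‖ₑ ≤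
        stepConstant d * (maximalNorm r K + localizedConstant p₁ p₂ K) *
          ∑ R ∈ 𝒯, volume R.set * (average p₁ R.triple f₁ * average p₂ R.triple f₂) := by
  obtain ⟨N, hN⟩ : ∃ N : ℤ, ∀ x, -N ≤ t₁ x := by
    obtain ⟨-, N, hN⟩ := ht₁
    exact ⟨N, fun x => (abs_le.1 (hN x)).1⟩
  -- Induction on the height of the scale above `-N`, where the pairing vanishes; stopping cubes
  -- have strictly smaller scale.
  suffices H : ∀ n : ℕ, ∀ Q : DyadicCube d, Q.scale ≤ -N + n →
      ∃ 𝒯 : Finset (DyadicCube d), (∀ R ∈ 𝒯, R.set ⊆ Q.set) ∧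
      (∀ A : Set (Fin d → ℝ), MeasurableSet A →
        ∑ R ∈ 𝒯, (if R.set ⊆ A then volume R.set else 0) ≤ 2 * volume (A ∩ Q.set)) ∧
      ‖linearizedPairing K t₁ t₂ Q.scale (Q.set.indicator f₁) f₂‖ₑ ≤
        stepConstant d * (maximalNorm r K + localizedConstant p₁ p₂ K) *
          ∑ R ∈ 𝒯, volume R.set * (average p₁ R.triple f₁ * average p₂ R.triple f₂) from
    H (Q.scale + N).toNat Q (by omega)
  intro n
  induction n with
  | zero =>
    intro Q hQ
    refine ⟨∅, by simp, by simp, ?_⟩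
    rw [linearizedPairing_eq_zero hN (by simpa using hQ)]
    simp
  | succ n ih =>
    intro Q hQ
    obtain ⟨𝒬, hs, hsc, hvol, hest⟩ := exists_stopping_estimate (p₁ := p₁) (p₂ := p₂) hK ht₁ ht₂
      hr1 hr hp₁ hp₁t hp₂ hp₂t hf₁ hf₂ Q
    have ih' : ∀ L : {L : DyadicCube d // L ∈ 𝒬 ∧ L.set ⊆ Q.set}, _ := fun L =>
      ih L.1 (by have := hsc L.1 L.2.1; push_cast at hQ; omega)
    choose 𝒯 hsub hcar hdom using ih'
    set J := (hs.finite_scale_gt (-N)).toFinset with hJ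
    have hdisj : ∀ L ∈ J, ∀ L' ∈ J, L ≠ L' → Disjoint (𝒯 L) (𝒯 L') := by
      intro L _ L' _ hne
      rw [Finset.disjoint_left]
      intro R hR hR'
      obtain ⟨x, hx⟩ := R.nonempty_set
      exact hne (Subtype.ext (hs.disjoint _ L.2.1 _ L'.2.1 ⟨x, hsub L R hR hx, hsub L' R hR' hx⟩))
    -- All descendants lie in stopping cubes, hence have smaller scale than `Q`. With the
    -- disjointness above, nothing is counted twice.
    have hQnot : Q ∉ J.biUnion 𝒯 := by
      rw [Finset.mem_biUnion]
      rintro ⟨L, -, hL⟩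
      have h1 := DyadicCube.scale_le_of_subset (hsub L Q hL)
      have h2 := hsc L.1 L.2.1
      omega
    refine ⟨insert Q (J.biUnion 𝒯), ?_, ?_, ?_⟩
    · intro R hR
      rw [Finset.mem_insert, Finset.mem_biUnion] at hR
      rcases hR with rfl | ⟨L, -, hR⟩
      · exact subset_rfl
      · exact (hsub L R hR).trans L.2.2
    · intro A hA
      rw [Finset.sum_insert hQnot, Finset.sum_biUnion hdisj]
      have h1 : ∑ L ∈ J, ∑ R ∈ 𝒯 L, (if R.set ⊆ A then volume R.set else 0) ≤
          2 * volume (A ∩ (Q.set ∩ shadow 𝒬)) := by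
        refine (Finset.sum_le_sum fun L _ => hcar L A hA).trans ?_
        rw [← Finset.mul_sum]
        gcongr
        exact (ENNReal.sum_le_tsum _).trans (hs.tsum_volume_inter_le hA)
      -- If `Q ⊆ A`, then `Q` costs `|Q|` and its descendants at most twice the shadow, again at
      -- most `|Q|`. Otherwise only the descendants count.
      refine (add_le_add le_rfl h1).trans ?_
      split_ifs with hQA
      · rw [inter_eq_right.2 hQA, two_mul (volume Q.set)]
        gcongr
        refine le_trans ?_ hvol
        gcongr
        exact inter_subset_right.trans inter_subset_right
      · rw [zero_add]
        gcongr
        exact inter_subset_left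
    · have hsum : ∑' L : {L : DyadicCube d // L ∈ 𝒬 ∧ L.set ⊆ Q.set},
          linearizedPairing K t₁ t₂ L.1.scale (L.1.set.indicator f₁) f₂ =
          ∑ L ∈ J, linearizedPairing K t₁ t₂ L.1.scale (L.1.set.indicator f₁) f₂ := by
        refine tsum_eq_sum fun L hL => linearizedPairing_eq_zero hN ?_ _ _
        simpa [hJ] using hL
      have heq : linearizedPairing K t₁ t₂ Q.scale (Q.set.indicator f₁) f₂ =
          localizedDifference K t₁ t₂ Q 𝒬 f₁ f₂ +
          ∑ L ∈ J, linearizedPairing K t₁ t₂ L.1.scale (L.1.set.indicator f₁) f₂ := by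
        rw [← hsum, localizedDifference, sub_add_cancel]
      rw [heq, Finset.sum_insert hQnot, Finset.sum_biUnion hdisj, mul_add, Finset.mul_sum]
      exact (enorm_add_le _ _).trans (add_le_add hest
        ((enorm_sum_le _ _).trans (Finset.sum_le_sum fun L _ => hdom L)))

end

section

variable {d : ℕ}

/-! ### Sparse subcollections of Carleson collections -/

lemma DyadicCube.mem_dilate_three {L : DyadicCube d} {x : Fin d → ℝ} :
    x ∈ L.dilate 3 ↔ ∀ i, (2 : ℝ) ^ L.scale * ((L.index i : ℝ) - 1) ≤ x i ∧
      x i < (2 : ℝ) ^ L.scale * ((L.index i : ℝ) + 2) := by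
  rw [DyadicCube.mem_dilate]
  refine forall_congr' fun i => ?_
  simp only [Cube.center, DyadicCube.toCube]
  constructor <;> rintro ⟨h1, h2⟩ <;> constructor <;> linarith

/-- The residue class of a dyadic cube: the triples of the cubes of one class are nested or
disjoint. -/
def tripleClass (L : DyadicCube d) (i : Fin d) : ZMod 3 :=
  (2 : ZMod 3) ^ L.scale * ((L.index i : ZMod 3) - 1)

/-- In units of `ℓ(L)` the lower corners of `3L` and `3L'` are integer vectors, and equality of
classes makes them congruent modulo `3`, because `2` is invertible there. So `3L` is a cell of a
grid of mesh `3ℓ(L)` in which `3L'` is a union of cells. -/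
lemma dilate_three_subset_or_disjoint {L L' : DyadicCube d} (h : tripleClass L = tripleClass L')
    (hs : L.scale ≤ L'.scale) : L.dilate 3 ⊆ L'.dilate 3 ∨ Disjoint (L.dilate 3) (L'.dilate 3) := by
  rw [or_iff_not_imp_right, not_disjoint_iff]
  rintro ⟨z, hz, hz'⟩ x hx
  obtain ⟨k, hk⟩ := Int.le.dest hs
  rw [DyadicCube.mem_dilate_three] at *
  intro i
  have hi : (3 : ℤ) ∣ (L.index i - 1) - 2 ^ k * (L'.index i - 1) := by
    have h1 : tripleClass L i = tripleClass L' i := congrFun h i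
    have h2 : (2 : ZMod 3) ≠ 0 := by decide
    rw [tripleClass, tripleClass, ← hk, zpow_add₀ h2, zpow_natCast, mul_assoc] at h1
    have h3 := mul_left_cancel₀ (zpow_ne_zero _ h2) h1
    refine (ZMod.intCast_zmod_eq_zero_iff_dvd _ 3).1 ?_
    push_cast
    rw [h3, sub_self]
  obtain ⟨q, hq⟩ := hi
  obtain ⟨hz1, hz2⟩ := hz i
  obtain ⟨hz1', hz2'⟩ := hz' i
  obtain ⟨hx1, hx2⟩ := hx i
  rw [← hk, zpow_add₀ two_ne_zero, zpow_natCast, mul_assoc] at hz1' hz2' ⊢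
  have hp : (0 : ℝ) < 2 ^ L.scale := by positivity
  have a1 := lt_of_mul_lt_mul_left (hz1.trans_lt hz2') hp.le
  have a2 := lt_of_mul_lt_mul_left (hz1'.trans_lt hz2) hp.le
  have b1 : L.index i - 1 < 2 ^ k * (L'.index i + 2) := by exact_mod_cast a1
  have b2 : 2 ^ k * (L'.index i - 1) < L.index i + 2 := by exact_mod_cast a2
  have hq0 : 0 ≤ q := by linarith
  have hq1 : q + 1 ≤ 2 ^ k := by
    have : 3 * q < 3 * 2 ^ k := by linarith
    linarith
  have c1 : 2 ^ k * (L'.index i - 1) ≤ L.index i - 1 := by linarith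
  have c2 : L.index i + 2 ≤ 2 ^ k * (L'.index i + 2) := by linarith
  have c1' : (2 : ℝ) ^ k * ((L'.index i : ℝ) - 1) ≤ L.index i - 1 := by exact_mod_cast c1
  have c2' : (L.index i : ℝ) + 2 ≤ 2 ^ k * ((L'.index i : ℝ) + 2) := by exact_mod_cast c2
  exact ⟨(mul_le_mul_of_nonneg_left c1' hp.le).trans hx1,
    hx2.trans_le (by rw [mul_assoc]; exact mul_le_mul_of_nonneg_left c2' hp.le)⟩

lemma dilate_three_injective [NeZero d] {L L' : DyadicCube d} (h : L.dilate 3 = L'.dilate 3) :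
    L = L' := by
  have key : ∀ L L' : DyadicCube d, L.dilate 3 ⊆ L'.dilate 3 → ∀ i,
      (2 : ℝ) ^ L'.scale * ((L'.index i : ℝ) - 1) ≤ 2 ^ L.scale * ((L.index i : ℝ) - 1) := by
    intro L L' hsub i
    have hp : (0 : ℝ) < 2 ^ L.scale := by positivity
    have hmem : (fun j => (2 : ℝ) ^ L.scale * ((L.index j : ℝ) - 1)) ∈ L.dilate 3 := by
      rw [DyadicCube.mem_dilate_three]
      exact fun j => ⟨le_rfl, mul_lt_mul_of_pos_left (by linarith) hp⟩
    exact (DyadicCube.mem_dilate_three.1 (hsub hmem) i).1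
  have hvol : volume L.set = volume L'.set := by
    have h1 := L.volume_dilate_three
    rw [h, L'.volume_dilate_three] at h1
    exact ((ENNReal.mul_right_inj (by simp) (by simp)).1 h1).symm
  have hs : L.scale = L'.scale := by
    rw [L.volume_set, L'.volume_set] at hvol
    have h1 := le_antisymm ((ENNReal.pow_le_pow_left_iff (NeZero.ne d)).1 hvol.le)
      ((ENNReal.pow_le_pow_left_iff (NeZero.ne d)).1 hvol.ge)
    rw [ENNReal.ofReal_eq_ofReal_iff (by positivity) (by positivity)] at h1
    exact zpow_right_injective₀ two_pos (by norm_num) h1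
  refine DyadicCube.ext_scale_index hs (funext fun i => ?_)
  have h1 := le_antisymm (key L L' h.le i) (key L' L h.ge i)
  rw [hs] at h1
  have h2 := mul_left_cancel₀ (by positivity) h1
  have h3 : (L'.index i : ℝ) = L.index i := by linarith
  exact_mod_cast h3.symm

open Classical in
/-- The number of strict ancestors of a cube in a collection. -/
def generation (F : Finset (Cube d)) (R : Cube d) : ℕ := (F.filter fun P => R.set ⊂ P.set).card

-- `E_I` is `I` minus the union `U I` of the smaller selected cubes inside it. A point of `U I` lies
-- in a selected `J ⊂ I` whose generation exceeds that of `I` by at least `m`, hence in at least `m`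
-- cubes of `F` contained in `I`. Integrating this count against the packing condition gives `|U I|
-- ≤ |I| / 2`.
open Classical in
lemma isSparse_of_generation {F : Finset (Cube d)}
    (hlam : ∀ R ∈ F, ∀ R' ∈ F, R.set ⊆ R'.set ∨ R'.set ⊆ R.set ∨ Disjoint R.set R'.set)
    (hinj : ∀ R ∈ F, ∀ R' ∈ F, R.set = R'.set → R = R') {m : ℕ} (hm : 0 < m)
    (hpack : ∀ R ∈ F, 2 * ∑ R' ∈ F, (if R'.set ⊆ R.set then volume R'.set else 0) ≤
      m * volume R.set) (j : ℕ) :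
    IsSparse (1 / 2) {R | R ∈ F ∧ generation F R % m = j} := by
  set S : Set (Cube d) := {R | R ∈ F ∧ generation F R % m = j} with hS
  have hSc : S.Countable := (F.finite_toSet.subset fun R hR => hR.1).countable
  set U : Cube d → Set (Fin d → ℝ) := fun I => ⋃ J ∈ {J ∈ S | J.set ⊂ I.set}, J.set with hU
  have hUm : ∀ I, MeasurableSet (U I) := fun I =>
    MeasurableSet.biUnion (hSc.mono fun J hJ => hJ.1) fun J _ => J.measurableSet_set
  have hcount : ∀ I ∈ S, ∀ x ∈ U I,
      (m : ℝ≥0∞) ≤ ∑ P ∈ F, if P.set ⊆ I.set then P.set.indicator 1 x else 0 := by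
    intro I hI x hx
    obtain ⟨J, ⟨hJS, hJI⟩, hxJ⟩ := mem_iUnion₂.1 hx
    set AJ := F.filter fun P => J.set ⊂ P.set with hAJ
    set AI := F.filter fun P => I.set ⊂ P.set with hAI
    have hsub : AI ⊆ AJ := fun P hP => by
      rw [Finset.mem_filter] at hP ⊢
      exact ⟨hP.1, hJI.trans hP.2⟩
    have hlt : AI.card < AJ.card := by
      refine Finset.card_lt_card ⟨hsub, fun h => ?_⟩
      have h1 : I ∈ AJ := Finset.mem_filter.2 ⟨hI.1, hJI⟩
      exact (Finset.mem_filter.1 (h h1)).2.ne rfl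
    have hmod : AI.card + m ≤ AJ.card := by
      have h1 : AI.card % m = AJ.card % m := hI.2.trans hJS.2.symm
      have h2 : m ∣ AJ.card - AI.card := (Nat.modEq_iff_dvd' hlt.le).1 h1
      have h3 := Nat.le_of_dvd (by omega) h2
      omega
    have hcard : m ≤ (AJ \ AI).card := by
      rw [Finset.card_sdiff_of_subset hsub]; omega
    -- A strict ancestor of `J` meets `I`; if it were not contained in `I`, it would be a strict
    -- ancestor of `I`.
    have hmem : ∀ P ∈ AJ \ AI, P.set ⊆ I.set ∧ x ∈ P.set := by
      intro P hP
      rw [Finset.mem_sdiff, Finset.mem_filter, Finset.mem_filter] at hP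
      refine ⟨?_, hP.1.2.subset hxJ⟩
      rcases hlam P hP.1.1 I hI.1 with h | h | h
      · exact h
      · by_contra hc
        exact hP.2 ⟨hP.1.1, h, hc⟩
      · exact absurd h (not_disjoint_iff.2 ⟨x, hP.1.2.subset hxJ, hJI.subset hxJ⟩)
    calc (m : ℝ≥0∞) ≤ ((AJ \ AI).card : ℝ≥0∞) := by exact_mod_cast hcard
      _ = ∑ P ∈ AJ \ AI, if P.set ⊆ I.set then P.set.indicator 1 x else 0 := by
          rw [Finset.card_eq_sum_ones, Nat.cast_sum]
          refine Finset.sum_congr rfl fun P hP => ?_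
          rw [if_pos (hmem P hP).1, indicator_of_mem (hmem P hP).2]
          simp
      _ ≤ _ := Finset.sum_le_sum_of_subset
          (Finset.sdiff_subset.trans (Finset.filter_subset _ _))
  have hUvol : ∀ I ∈ S, 2 * volume (U I) ≤ volume I.set := by
    intro I hI
    have h1 : (m : ℝ≥0∞) * volume (U I) ≤
        ∑ P ∈ F, (if P.set ⊆ I.set then volume P.set else 0) := by
      calc (m : ℝ≥0∞) * volume (U I) = ∫⁻ _ in U I, (m : ℝ≥0∞) := by
            rw [setLIntegral_const]
        _ ≤ ∫⁻ x in U I, ∑ P ∈ F, if P.set ⊆ I.set then P.set.indicator 1 x else 0 :=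
            setLIntegral_mono' (hUm I) (hcount I hI)
        _ ≤ ∫⁻ x, ∑ P ∈ F, if P.set ⊆ I.set then P.set.indicator 1 x else 0 :=
            setLIntegral_le_lintegral _ _
        _ = ∑ P ∈ F, (if P.set ⊆ I.set then volume P.set else 0) := by
            rw [lintegral_finsetSum]
            · refine Finset.sum_congr rfl fun P _ => ?_
              split_ifs
              · exact lintegral_indicator_one P.measurableSet_set
              · simp
            · intro P _
              split_ifs
              · exact measurable_one.indicator P.measurableSet_set
              · exact measurable_const
    have hm0 : (m : ℝ≥0∞) ≠ 0 := by exact_mod_cast hm.ne'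
    rw [← ENNReal.mul_le_mul_iff_right hm0 (by simp)]
    calc (m : ℝ≥0∞) * (2 * volume (U I)) = 2 * (m * volume (U I)) := by ring
      _ ≤ 2 * ∑ P ∈ F, (if P.set ⊆ I.set then volume P.set else 0) := by gcongr
      _ ≤ _ := hpack I hI.1
  refine ⟨hSc, fun I => I.set \ U I, fun I hI => ⟨I.measurableSet_set.diff (hUm I),
    sdiff_subset, ?_⟩, ?_⟩
  · have hUI : volume (U I) ≤ 1 / 2 * volume I.set := by
      rw [one_div, ← ENNReal.mul_le_mul_iff_right two_ne_zero (by simp), ← mul_assoc,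
        ENNReal.mul_inv_cancel two_ne_zero (by simp), one_mul]
      exact hUvol I hI
    have hfin : 1 / 2 * volume I.set ≠ ∞ := ENNReal.mul_ne_top (by simp) I.volume_ne_top
    calc 1 / 2 * volume I.set = volume I.set - 1 / 2 * volume I.set := by
          refine (ENNReal.sub_eq_of_eq_add hfin ?_).symm
          rw [← add_mul, one_div, ENNReal.inv_two_add_inv_two, one_mul]
      _ ≤ volume I.set - volume (U I) := tsub_le_tsub_left hUI _
      _ ≤ volume (I.set \ U I) := le_measure_sdiff
  · have key : ∀ I ∈ S, ∀ J ∈ S, I ≠ J → I.set ⊆ J.set →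
        (I.set \ U I) ∩ (J.set \ U J) = ∅ := by
      intro I hI J hJ hne hsub
      have hss : I.set ⊂ J.set := hsub.ssubset_of_ne fun h => hne (hinj I hI.1 J hJ.1 h)
      refine eq_empty_of_forall_notMem fun x hx => hx.2.2 ?_
      exact mem_biUnion (show I ∈ {I ∈ S | I.set ⊂ J.set} from ⟨hI, hss⟩) hx.1.1
    intro I hI J hJ hne
    rcases hlam I hI.1 J hJ.1 with h | h | h
    · exact key I hI J hJ hne h
    · rw [inter_comm]
      exact key J hJ I hI hne.symm h
    · exact (h.mono sdiff_subset sdiff_subset).inter_eq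

open Classical in
/-- A finite Carleson collection of dyadic cubes is dominated by a sparse collection of triples. -/
lemma exists_sparse_domination [NeZero d] {𝒯 : Finset (DyadicCube d)}
    (hcar : ∀ A : Set (Fin d → ℝ), MeasurableSet A →
      ∑ R ∈ 𝒯, (if R.set ⊆ A then volume R.set else 0) ≤ 2 * volume A) (w : Cube d → ℝ≥0∞) :
    ∃ S : Set (Cube d), IsSparse (1 / 2) S ∧
      ∑ R ∈ 𝒯, w R.triple ≤ 3 ^ d * (4 * 3 ^ d) * ∑' I : S, w I := by
  -- A triple inside `I` has its cube inside `I`, so the triples pack with constant `2 · 3^d`;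
  -- half-sparseness needs twice that.
  set m : ℕ := 4 * 3 ^ d with hm
  have hmpos : 0 < m := by positivity
  have htinj : Function.Injective (DyadicCube.triple (d := d)) := fun L L' h =>
    dilate_three_injective (by rw [← L.set_triple, ← L'.set_triple, h])
  set F : (Fin d → ZMod 3) → Finset (Cube d) := fun κ =>
    (𝒯.filter fun R => tripleClass R = κ).image DyadicCube.triple with hF
  set S : (Fin d → ZMod 3) × Fin m → Set (Cube d) := fun c =>
    {R | R ∈ F c.1 ∧ generation (F c.1) R % m = c.2} with hS
  have hsparse : ∀ c, IsSparse (1 / 2) (S c) := by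
    intro c
    refine isSparse_of_generation ?_ ?_ hmpos ?_ c.2
    · intro I hI I' hI'
      obtain ⟨R, hR, rfl⟩ := Finset.mem_image.1 hI
      obtain ⟨R', hR', rfl⟩ := Finset.mem_image.1 hI'
      have hc : tripleClass R = tripleClass R' :=
        (Finset.mem_filter.1 hR).2.trans (Finset.mem_filter.1 hR').2.symm
      rw [R.set_triple, R'.set_triple]
      rcases le_total R.scale R'.scale with h | h
      · rcases dilate_three_subset_or_disjoint hc h with h' | h'
        · exact Or.inl h'
        · exact Or.inr (Or.inr h')
      · rcases dilate_three_subset_or_disjoint hc.symm h with h' | h'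
        · exact Or.inr (Or.inl h')
        · exact Or.inr (Or.inr h'.symm)
    · intro I hI I' hI' h
      obtain ⟨R, hR, rfl⟩ := Finset.mem_image.1 hI
      obtain ⟨R', hR', rfl⟩ := Finset.mem_image.1 hI'
      rw [R.set_triple, R'.set_triple] at h
      rw [dilate_three_injective h]
    · intro I hI
      rw [hF, Finset.sum_image htinj.injOn]
      calc 2 * ∑ R ∈ 𝒯.filter fun R => tripleClass R = c.1,
            (if R.triple.set ⊆ I.set then volume R.triple.set else 0)
          ≤ 2 * ∑ R ∈ 𝒯, 3 ^ d * (if R.set ⊆ I.set then volume R.set else 0) := by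
            gcongr
            refine (Finset.sum_le_sum_of_subset (Finset.filter_subset _ _)).trans
              (Finset.sum_le_sum fun R _ => ?_)
            rw [R.set_triple, R.volume_dilate_three]
            split_ifs with h1 h2
            · exact le_rfl
            · exact absurd ((R.subset_dilate (by norm_num)).trans h1) h2
            · exact bot_le
            · exact bot_le
        _ ≤ 2 * (3 ^ d * (2 * volume I.set)) := by
            rw [← Finset.mul_sum]
            gcongr
            exact hcar _ I.measurableSet_set
        _ = m * volume I.set := by
            rw [hm]; push_cast; ring
  -- A single sparse family is required, so the one with the largest sum is kept; the number of
  -- families becomes the constant.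
  obtain ⟨c, -, hc⟩ := Finset.exists_max_image
    (Finset.univ : Finset ((Fin d → ZMod 3) × Fin m)) (fun c => ∑' I : S c, w I)
    ⟨(0, ⟨0, hmpos⟩), Finset.mem_univ _⟩
  refine ⟨S c, hsparse c, ?_⟩
  calc ∑ R ∈ 𝒯, w R.triple
      = ∑ κ, ∑ R ∈ 𝒯.filter fun R => tripleClass R = κ, w R.triple :=
        (Finset.sum_fiberwise 𝒯 tripleClass _).symm
    _ = ∑ κ, ∑ I ∈ F κ, w I := by
        refine Finset.sum_congr rfl fun κ _ => ?_
        rw [hF, Finset.sum_image htinj.injOn]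
    _ = ∑ κ, ∑ j : Fin m, ∑ I ∈ (F κ).filter fun I =>
          (⟨generation (F κ) I % m, Nat.mod_lt _ hmpos⟩ : Fin m) = j, w I :=
        Finset.sum_congr rfl fun κ _ => (Finset.sum_fiberwise _ _ _).symm
    _ = ∑ c : (Fin d → ZMod 3) × Fin m, ∑' I : S c, w I := by
        rw [Fintype.sum_prod_type]
        refine Finset.sum_congr rfl fun κ _ => Finset.sum_congr rfl fun j _ => ?_
        have hset : S (κ, j) = ↑((F κ).filter fun I =>
            (⟨generation (F κ) I % m, Nat.mod_lt _ hmpos⟩ : Fin m) = j) := by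
          ext I
          simp [hS, Fin.ext_iff]
        rw [hset, Finset.tsum_subtype' _ w]
    _ ≤ ∑ _c : (Fin d → ZMod 3) × Fin m, ∑' I : S c, w I :=
        Finset.sum_le_sum fun c' hc' => hc c' hc'
    _ = _ := by
        rw [Finset.sum_const, Finset.card_univ, Fintype.card_prod, Fintype.card_fun, ZMod.card,
          Fintype.card_fin, Fintype.card_fin, nsmul_eq_mul, hm]
        push_cast
        ring

end

section

variable {d : ℕ} {K : ℤ → (Fin d → ℝ) → (Fin d → ℝ) → ℂ} {t₁ t₂ : (Fin d → ℝ) → ℤ}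

/-! ### Sparse domination of the maximal truncations -/

lemma linearizedPairing_sum_left (hK : IsKernelFamily K) (ht₁ : IsTruncationFunction t₁)
    (ht₂ : IsTruncationFunction t₂) (σ : ℤ) {ι : Type*} (ℛ : Finset ι)
    {f : ι → (Fin d → ℝ) → ℂ} {g : (Fin d → ℝ) → ℂ} (hf : ∀ i, Integrable (f i))
    (hg : Integrable g) :
    linearizedPairing K t₁ t₂ σ (∑ i ∈ ℛ, f i) g =
      ∑ i ∈ ℛ, linearizedPairing K t₁ t₂ σ (f i) g := by
  classical
  induction ℛ using Finset.induction_on with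
  | empty =>
    have := linearizedPairing_const_smul (K := K) (t₁ := t₁) (t₂ := t₂) σ 0 g 0 1
    simpa using this
  | insert i s hi ih =>
    rw [Finset.sum_insert hi, Finset.sum_insert hi, linearizedPairing_add_left hK ht₁ ht₂ σ (hf i)
      (integrable_finsetSum' s fun i _ => hf i) hg, ih]

lemma IsBoundedCompactlySupported.exists_closedBall {f : (Fin d → ℝ) → ℂ}
    (hf : IsBoundedCompactlySupported f) : ∃ ρ : ℝ, ∀ x ∉ Metric.closedBall (0 : Fin d → ℝ) ρ,
      f x = 0 := by
  obtain ⟨ρ, hρ⟩ := hf.2.isCompact.isBounded.subset_closedBall 0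
  exact ⟨ρ, fun x hx => image_eq_zero_of_notMem_tsupport fun h => hx (hρ h)⟩

lemma volume_closedBall_ne_top (ρ : ℝ) : volume (Metric.closedBall (0 : Fin d → ℝ) ρ) ≠ ∞ :=
  (isCompact_closedBall _ _).measure_lt_top.ne

lemma IsBoundedCompactlySupported.memLp {f : (Fin d → ℝ) → ℂ}
    (hf : IsBoundedCompactlySupported f) (q : ℝ≥0∞) : MemLp f q := by
  obtain ⟨ρ, hρ⟩ := hf.exists_closedBall
  exact memLp_of_memLp_top hf.1 measurableSet_closedBall (volume_closedBall_ne_top ρ) hρ q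

/-- At so large a scale a point of the ball has dyadic indices in `{-1, 0}` only. -/
lemma exists_finset_dyadicCube (s : ℤ) {ρ : ℝ} (hρ : ρ < 2 ^ s) :
    ∃ ℛ : Finset (DyadicCube d), (∀ Q ∈ ℛ, Q.scale = s) ∧
      ∀ x ∈ Metric.closedBall (0 : Fin d → ℝ) ρ, dyadicAt s x ∈ ℛ := by
  classical
  refine ⟨(Fintype.piFinset fun _ => Finset.Icc (-1 : ℤ) 0).image fun m => ⟨s, m⟩, ?_, ?_⟩
  · intro Q hQ
    obtain ⟨m, -, rfl⟩ := Finset.mem_image.1 hQ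
    rfl
  · intro x hx
    refine Finset.mem_image.2 ⟨_, Fintype.mem_piFinset.2 fun i => ?_, rfl⟩
    have hp : (0 : ℝ) < 2 ^ s := by positivity
    have hxi : |x i| < 2 ^ s := by
      have h1 : ‖x‖ ≤ ρ := by simpa using hx
      exact ((norm_le_pi_norm x i).trans h1).trans_lt hρ
    have h2 := abs_lt.1 hxi
    rw [Finset.mem_Icc]
    constructor
    · rw [Int.le_floor, le_div_iff₀ hp]
      push_cast
      linarith
    · rw [← Int.lt_add_one_iff, Int.floor_lt, div_lt_iff₀ hp]
      push_cast
      linarith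

/-- The constant of the sparse domination. -/
def sparseConstant (d : ℕ) : ℝ≥0 := 3 ^ d * (4 * 3 ^ d) * stepConstant d

open Classical in
lemma exists_sparse_linearizedPairing_le [NeZero d] (hK : IsKernelFamily K)
    (ht₁ : IsTruncationFunction t₁)
    (ht₂ : IsTruncationFunction t₂) {r p₁ p₂ : ℝ≥0∞} (hr1 : 1 ≤ r) (hr : r ≠ ∞) (hp₁ : 1 ≤ p₁)
    (hp₁t : p₁ ≠ ∞) (hp₂ : 1 ≤ p₂) (hp₂t : p₂ ≠ ∞) {f₁ f₂ : (Fin d → ℝ) → ℂ}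
    (hf₁ : IsBoundedCompactlySupported f₁) (hf₂ : MemLp f₂ ∞) (hf₂i : Integrable f₂) :
    ∃ S : Set (Cube d), IsSparse (1 / 2) S ∧
      ‖∫ x, truncation K f₁ x (t₁ x) (t₂ x) * f₂ x‖ₑ ≤
        sparseConstant d * (maximalNorm r K + localizedConstant p₁ p₂ K) *
          ∑' I : S, volume (I : Cube d).set * (average p₁ I f₁ * average p₂ I f₂) := by
  obtain ⟨ρ, hρ⟩ := hf₁.exists_closedBall
  obtain ⟨n, hn⟩ := pow_unbounded_of_one_lt ρ one_lt_two
  obtain ⟨N, hN⟩ := ht₂.2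
  -- The scale exceeds the bound of `t₂`, so truncating at `s` is void, and also covers the support
  -- of `f₁`.
  set s : ℤ := max n N with hs
  have hρs : ρ < (2 : ℝ) ^ s := hn.trans_le (by
    rw [← zpow_natCast]
    exact zpow_le_zpow_right₀ one_le_two (le_max_left _ _))
  obtain ⟨ℛ, hℛs, hℛ⟩ := exists_finset_dyadicCube (d := d) s hρs
  have hLP : ∫ x, truncation K f₁ x (t₁ x) (t₂ x) * f₂ x =
      linearizedPairing K t₁ t₂ s f₁ f₂ := by
    rw [linearizedPairing]
    congr 1
    ext x
    rw [min_eq_left ((abs_le.1 (hN x)).2.trans (le_max_right _ _))]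
  have hf₁sum : f₁ = ∑ Q ∈ ℛ, Q.set.indicator f₁ := by
    ext x
    rw [Finset.sum_apply]
    by_cases hx : x ∈ Metric.closedBall (0 : Fin d → ℝ) ρ
    · rw [Finset.sum_eq_single_of_mem _ (hℛ x hx), indicator_of_mem (mem_dyadicAt s x)]
      intro Q hQ hne
      refine indicator_of_notMem (fun hxQ => hne ?_) _
      rw [← mem_set_iff_dyadicAt.1 hxQ, hℛs Q hQ]
    · rw [hρ x hx]
      refine (Finset.sum_eq_zero fun Q _ => ?_).symm
      by_cases hxQ : x ∈ Q.set
      · rw [indicator_of_mem hxQ, hρ x hx]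
      · rw [indicator_of_notMem hxQ]
  have hf₁i : Integrable f₁ := memLp_one_iff_integrable.1 (hf₁.memLp 1)
  choose 𝒯 hsub hcar hdom using fun Q : DyadicCube d =>
    exists_carleson_domination hK ht₁ ht₂ hr1 hr hp₁ hp₁t hp₂ hp₂t hf₁.1 hf₂ Q
  have hQdisj : ∀ Q ∈ ℛ, ∀ Q' ∈ ℛ, Q ≠ Q' → Disjoint Q.set Q'.set := by
    intro Q hQ Q' hQ' hne
    rw [disjoint_left]
    intro x hx hx'
    exact hne (DyadicCube.eq_of_mem ((hℛs Q hQ).trans (hℛs Q' hQ').symm) hx hx')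
  have hTdisj : ∀ Q ∈ ℛ, ∀ Q' ∈ ℛ, Q ≠ Q' → Disjoint (𝒯 Q) (𝒯 Q') := by
    intro Q hQ Q' hQ' hne
    rw [Finset.disjoint_left]
    intro R hR hR'
    obtain ⟨x, hx⟩ := R.nonempty_set
    exact disjoint_left.1 (hQdisj Q hQ Q' hQ' hne) (hsub Q R hR hx) (hsub Q' R hR' hx)
  -- The packing bounds are localized to `A ∩ Q`, so they add up over the disjoint top cubes without
  -- loss.
  have hcarleson : ∀ A : Set (Fin d → ℝ), MeasurableSet A →
      ∑ R ∈ ℛ.biUnion 𝒯, (if R.set ⊆ A then volume R.set else 0) ≤ 2 * volume A := by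
    intro A hA
    rw [Finset.sum_biUnion hTdisj]
    refine (Finset.sum_le_sum fun Q _ => hcar Q A hA).trans ?_
    rw [← Finset.mul_sum]
    gcongr
    rw [← measure_biUnion_finset
      (fun Q hQ Q' hQ' hne => (hQdisj Q hQ Q' hQ' hne).mono inter_subset_right inter_subset_right)
      fun Q _ => hA.inter Q.measurableSet_set]
    exact measure_mono (iUnion₂_subset fun Q _ => inter_subset_left)
  obtain ⟨S, hS, hST⟩ := exists_sparse_domination hcarleson
    fun I => volume I.set * (average p₁ I f₁ * average p₂ I f₂)
  refine ⟨S, hS, ?_⟩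
  have hstep : ‖linearizedPairing K t₁ t₂ s f₁ f₂‖ₑ ≤
      stepConstant d * (maximalNorm r K + localizedConstant p₁ p₂ K) *
        ∑ R ∈ ℛ.biUnion 𝒯, volume R.triple.set *
          (average p₁ R.triple f₁ * average p₂ R.triple f₂) := by
    conv_lhs => rw [hf₁sum]
    rw [linearizedPairing_sum_left hK ht₁ ht₂ s ℛ
      (fun Q => hf₁i.indicator Q.measurableSet_set) hf₂i, Finset.sum_biUnion hTdisj,
      Finset.mul_sum]
    refine (enorm_sum_le _ _).trans (Finset.sum_le_sum fun Q hQ => ?_)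
    have h1 := hdom Q
    rw [hℛs Q hQ] at h1
    refine h1.trans ?_
    gcongr with R hR
    rw [R.set_triple]
    exact R.subset_dilate (by norm_num)
  rw [hLP]
  refine hstep.trans ?_
  calc stepConstant d * (maximalNorm r K + localizedConstant p₁ p₂ K) *
        ∑ R ∈ ℛ.biUnion 𝒯, volume R.triple.set *
          (average p₁ R.triple f₁ * average p₂ R.triple f₂)
      ≤ stepConstant d * (maximalNorm r K + localizedConstant p₁ p₂ K) *
        (3 ^ d * (4 * 3 ^ d) *
          ∑' I : S, volume (I : Cube d).set * (average p₁ I f₁ * average p₂ I f₂)) := by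
        gcongr
    _ = _ := by
        rw [sparseConstant]
        push_cast
        ring

/-! ### Linearizing the maximal truncation. -/

/-- A finite family of measurable functions has a measurable choice of a maximizing index. -/
lemma exists_measurable_argmax {X ι : Type*} [MeasurableSpace X] [MeasurableSpace ι]
    {F : ι → X → ℝ≥0∞} (hF : ∀ i, Measurable (F i)) {P : Finset ι} (hP : P.Nonempty) :
    ∃ τ : X → ι, Measurable τ ∧ (∀ x, τ x ∈ P) ∧ (Measurable fun x => F (τ x) x) ∧
      ∀ x, ∀ i ∈ P, F i x ≤ F (τ x) x := by
  classical
  induction hP using Finset.Nonempty.cons_induction with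
  | singleton a =>
    exact ⟨fun _ => a, measurable_const, by simp, hF a, by simp⟩
  | cons a s ha hs ih =>
    obtain ⟨τ, hτ, hmem, hFτ, hmax⟩ := ih
    have hset : MeasurableSet {x | F (τ x) x < F a x} := measurableSet_lt hFτ (hF a)
    refine ⟨fun x => if F (τ x) x < F a x then a else τ x,
      Measurable.ite hset measurable_const hτ, ?_, ?_, ?_⟩
    · intro x
      rw [Finset.mem_cons]
      beta_reduce
      split_ifs
      · exact Or.inl rfl
      · exact Or.inr (hmem x)
    · have : (fun x => F (if F (τ x) x < F a x then a else τ x) x) =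
          fun x => if F (τ x) x < F a x then F a x else F (τ x) x := by
        ext x; split_ifs <;> rfl
      rw [this]
      exact Measurable.ite hset (hF a) hFτ
    · intro x i hi
      rw [Finset.mem_cons] at hi
      beta_reduce
      split_ifs with h
      · rcases hi with rfl | hi
        · exact le_rfl
        · exact (hmax x i hi).trans h.le
      · rcases hi with rfl | hi
        · exact not_lt.1 h
        · exact hmax x i hi

/-- Finiteness is what makes half of this integral strictly smaller than the integral, so that the
linearization can reach it. -/
lemma lintegral_maximalTruncation_mul_ne_top (hK : IsKernelFamily K) {r : ℝ≥0∞} (hr1 : 1 ≤ r)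
    (hr : r ≠ ∞) (hKr : maximalNorm r K ≠ ∞) {f₁ f₂ : (Fin d → ℝ) → ℂ}
    (hf₁ : IsBoundedCompactlySupported f₁) (hf₂ : IsBoundedCompactlySupported f₂) :
    ∫⁻ x, maximalTruncation K f₁ x * ‖f₂ x‖ₑ ≠ ∞ := by
  obtain ⟨ρ₁, hρ₁⟩ := hf₁.exists_closedBall
  obtain ⟨ρ₂, hρ₂⟩ := hf₂.exists_closedBall
  set B := Metric.closedBall (0 : Fin d → ℝ) (max ρ₁ ρ₂) with hB
  have hBm : MeasurableSet B := measurableSet_closedBall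
  have hb : ∀ f : (Fin d → ℝ) → ℂ, ∀ᵐ x, ‖f x‖ₑ ≤ eLpNorm f ∞ volume := fun f => by
    rw [eLpNorm_exponent_top]; exact enorm_ae_le_eLpNormEssSup f volume
  have h1 := setLIntegral_maximalTruncation_le (r := r) hK hr1 hr hf₁.1 hBm
    (volume_closedBall_ne_top _)
    (fun x hx => hρ₁ x fun h => hx (Metric.closedBall_subset_closedBall (le_max_left _ _) h)) (hb f₁)
  refine (lt_of_le_of_lt ?_ (ENNReal.mul_lt_top (h1.trans_lt (ENNReal.mul_lt_top
    (ENNReal.mul_lt_top hKr.lt_top hf₁.1.2) (volume_closedBall_ne_top _).lt_top)) hf₂.1.2)).ne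
  rw [← lintegral_indicator hBm, ← lintegral_mul_const' _ _ hf₂.1.2.ne]
  refine lintegral_mono_ae ((hb f₂).mono fun x hx => ?_)
  by_cases hxB : x ∈ B
  · rw [indicator_of_mem hxB]
    gcongr
  · rw [hρ₂ x fun h => hxB (Metric.closedBall_subset_closedBall (le_max_right _ _) h)]
    simp

/-- Monotone convergence reduces the supremum to pairs in a finite window, where a maximizer can be
chosen measurably. Pairs in the wrong order do no harm: their truncation is an empty sum. -/
lemma exists_lt_lintegral_truncation (hK : IsKernelFamily K) {f₁ f₂ : (Fin d → ℝ) → ℂ}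
    (hf₁ : AEStronglyMeasurable f₁) (hf₂ : AEStronglyMeasurable f₂) {V : ℝ≥0∞}
    (hV : V < ∫⁻ x, maximalTruncation K f₁ x * ‖f₂ x‖ₑ) :
    ∃ t₁ t₂ : (Fin d → ℝ) → ℤ, IsTruncationFunction t₁ ∧ IsTruncationFunction t₂ ∧
      (Measurable fun x => truncation K f₁ x (t₁ x) (t₂ x)) ∧
      V < ∫⁻ x, ‖truncation K f₁ x (t₁ x) (t₂ x)‖ₑ * ‖f₂ x‖ₑ := by
  set P : ℕ → Finset (ℤ × ℤ) := fun n => Finset.Icc (-(n : ℤ)) n ×ˢ Finset.Icc (-(n : ℤ)) n with hP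
  set F : ℕ → (Fin d → ℝ) → ℝ≥0∞ := fun n x =>
    ⨆ c ∈ P n, ‖truncation K f₁ x c.1 c.2‖ₑ with hF
  have hFm : ∀ n, Measurable (F n) := fun n =>
    Measurable.iSup fun c => Measurable.iSup fun _ => (measurable_truncation hK hf₁ _ _).enorm
  have hFmono : Monotone F := by
    intro m n hmn x
    refine biSup_mono fun c hc => ?_
    simp only [hP, Finset.mem_product, Finset.mem_Icc] at hc ⊢
    have : (m : ℤ) ≤ n := by exact_mod_cast hmn
    omega
  have hFsup : ∀ x, maximalTruncation K f₁ x ≤ ⨆ n, F n x := by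
    intro x
    refine iSup_le fun a => iSup_le fun b => iSup_le fun _ => ?_
    refine le_iSup_of_le (max a.natAbs b.natAbs) ?_
    refine le_iSup₂_of_le (a, b) ?_ le_rfl
    simp only [hP, Finset.mem_product, Finset.mem_Icc]
    omega
  have hlim : V < ⨆ n, ∫⁻ x, F n x * ‖f₂ x‖ₑ := by
    rw [← lintegral_iSup' (f := fun n x => F n x * ‖f₂ x‖ₑ)
      (fun n => (hFm n).aemeasurable.mul hf₂.enorm)
      (ae_of_all _ fun x m n hmn => by dsimp only; gcongr; exact hFmono hmn x)]
    refine hV.trans_le (lintegral_mono fun x => ?_)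
    rw [← ENNReal.iSup_mul]
    gcongr
    exact hFsup x
  obtain ⟨n, hn⟩ := lt_iSup_iff.1 hlim
  obtain ⟨τ, hτ, hτP, -, hτmax⟩ := exists_measurable_argmax
    (F := fun (c : ℤ × ℤ) x => ‖truncation K f₁ x c.1 c.2‖ₑ)
    (fun c => (measurable_truncation hK hf₁ c.1 c.2).enorm) (P := P n)
    ⟨(0, 0), by simp [hP]⟩
  have hbd : ∀ x, |(τ x).1| ≤ (n : ℤ) ∧ |(τ x).2| ≤ (n : ℤ) := by
    intro x
    have := hτP x
    simp only [hP, Finset.mem_product, Finset.mem_Icc] at this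
    exact ⟨abs_le.2 this.1, abs_le.2 this.2⟩
  have ht₁ : IsTruncationFunction fun x => (τ x).1 := ⟨measurable_fst.comp hτ, n, fun x => (hbd x).1⟩
  have ht₂ : IsTruncationFunction fun x => (τ x).2 := ⟨measurable_snd.comp hτ, n, fun x => (hbd x).2⟩
  refine ⟨_, _, ht₁, ht₂, ?_, hn.trans_le (lintegral_mono fun x => ?_)⟩
  · have := measurable_truncation_comp hK ht₁ ht₂ n hf₁
    simpa only [min_eq_left (abs_le.1 (hbd _).2).2] using this
  · gcongr
    exact iSup₂_le fun c hc => hτmax x c hc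

lemma hasSparseBound_maximalTruncation [NeZero d] (hK : IsKernelFamily K) {r p₁ p₂ : ℝ≥0∞}
    (hr1 : 1 ≤ r) (hr : r ≠ ∞) (hp₁ : 1 ≤ p₁) (hp₁t : p₁ ≠ ∞) (hp₂ : 1 ≤ p₂) (hp₂t : p₂ ≠ ∞)
    (hKr : maximalNorm r K ≠ ∞) {c : ℝ≥0}
    (hc : 2 * sparseConstant d * (maximalNorm r K + localizedConstant p₁ p₂ K) ≤ c) :
    HasSparseBound p₁ p₂ (maximalTruncation K) c := by
  intro f₁ f₂ hf₁ hf₂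
  set V := ∫⁻ x, maximalTruncation K f₁ x * ‖f₂ x‖ₑ with hV
  by_cases hV0 : V = 0
  · exact ⟨∅, ⟨countable_empty, fun _ => ∅, by simp, by simp⟩, by rw [hV0]; exact bot_le⟩
  have hVt : V ≠ ∞ := lintegral_maximalTruncation_mul_ne_top hK hr1 hr hKr hf₁ hf₂
  obtain ⟨t₁, t₂, ht₁, ht₂, hm, hlt⟩ :=
    exists_lt_lintegral_truncation hK hf₁.1.1 hf₂.1.1 (ENNReal.half_lt_self hV0 hVt)
  set h : (Fin d → ℝ) → ℂ := fun x => truncation K f₁ x (t₁ x) (t₂ x) with hh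
  -- The conjugate phase of `h` times `|f₂|`, so that `h g = |h f₂|` and `|g| ≤ |f₂|`. Where `h`
  -- vanishes, the inverse is zero and so is `g`.
  set g : (Fin d → ℝ) → ℂ := fun x =>
    (‖f₂ x‖ : ℂ) * ((starRingEnd ℂ) (h x) * ((‖h x‖ : ℂ))⁻¹) with hg
  have hgm : AEStronglyMeasurable g := by
    refine AEStronglyMeasurable.mul ?_ ?_
    · exact Complex.continuous_ofReal.comp_aestronglyMeasurable hf₂.1.1.norm
    · refine Measurable.aestronglyMeasurable ?_
      exact (Complex.continuous_conj.measurable.comp hm).mul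
        (Complex.measurable_ofReal.comp hm.norm).inv
  have hgle : ∀ x, ‖g x‖ ≤ ‖f₂ x‖ := by
    intro x
    simp only [hg, norm_mul, norm_inv, Complex.norm_real, norm_norm, RCLike.norm_conj]
    exact mul_le_of_le_one_right (norm_nonneg _) mul_inv_le_one
  have hgq : ∀ q, MemLp g q := fun q => (hf₂.memLp q).mono hgm (ae_of_all _ hgle)
  have hhg : ∀ x, h x * g x = ((‖h x * f₂ x‖ : ℝ) : ℂ) := by
    intro x
    by_cases hx : h x = 0
    · simp [hx]
    · have hne : (‖h x‖ : ℂ) ≠ 0 := by simpa using hx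
      have : h x * (starRingEnd ℂ) (h x) = (‖h x‖ : ℂ) ^ 2 := Complex.mul_conj' (h x)
      simp only [hg, norm_mul]
      push_cast
      calc h x * ((‖f₂ x‖ : ℂ) * ((starRingEnd ℂ) (h x) * ((‖h x‖ : ℂ))⁻¹))
          = (h x * (starRingEnd ℂ) (h x)) * (‖f₂ x‖ : ℂ) * ((‖h x‖ : ℂ))⁻¹ := by ring
        _ = _ := by rw [this]; field_simp
  obtain ⟨S, hS, hle⟩ := exists_sparse_linearizedPairing_le (K := K) (p₁ := p₁) (p₂ := p₂) hK
    ht₁ ht₂ hr1 hr hp₁ hp₁t hp₂ hp₂t hf₁ (hgq ∞) (memLp_one_iff_integrable.1 (hgq 1))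
  refine ⟨S, hS, ?_⟩
  have hint : Integrable fun x => h x * f₂ x := by
    obtain ⟨N, hN⟩ := ht₂.2
    have := integrable_truncation_mul hK ht₁ ht₂ N
      (memLp_one_iff_integrable.1 (hf₁.memLp 1)) (memLp_one_iff_integrable.1 (hf₂.memLp 1))
    simpa only [min_eq_left (abs_le.1 (hN _)).2] using this
  have hnorm : ‖∫ x, h x * g x‖ₑ = ∫⁻ x, ‖h x‖ₑ * ‖f₂ x‖ₑ := by
    simp_rw [hhg]
    rw [integral_complex_ofReal, ← ofReal_norm, Complex.norm_real, Real.norm_eq_abs,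
      abs_of_nonneg (integral_nonneg fun x => norm_nonneg _),
      ofReal_integral_norm_eq_lintegral_enorm hint]
    simp_rw [enorm_mul]
  calc V = 2 * (V / 2) := (ENNReal.mul_div_cancel two_ne_zero (by simp)).symm
    _ ≤ 2 * ‖∫ x, h x * g x‖ₑ := by
        rw [hnorm]
        gcongr
    _ ≤ 2 * (sparseConstant d * (maximalNorm r K + localizedConstant p₁ p₂ K) *
          ∑' I : S, volume (I : Cube d).set * (average p₁ I f₁ * average p₂ I g)) := by
        gcongr
    _ ≤ 2 * (sparseConstant d * (maximalNorm r K + localizedConstant p₁ p₂ K) *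
          ∑' I : S, volume (I : Cube d).set * (average p₁ I f₁ * average p₂ I f₂)) := by
        gcongr with I
        exact average_mono (ae_of_all _ fun x _ => by
          rw [← ofReal_norm, ← ofReal_norm]
          exact ENNReal.ofReal_le_ofReal (hgle x))
    _ = 2 * sparseConstant d * (maximalNorm r K + localizedConstant p₁ p₂ K) *
          ∑' I : S, volume (I : Cube d).set * (average p₁ I f₁ * average p₂ I f₂) := by ring
    _ ≤ _ := by gcongr

end

end SparseDom

end

/-! ### The theorem. -/

theorem theorem3 (d : ℕ) (hd : 1 ≤ d) :
    ∃ C : ℝ≥0, ∀ (r p₁ p₂ : ℝ≥0∞), 1 < r → r < ∞ → 1 ≤ p₁ → p₁ < ∞ → 1 ≤ p₂ → p₂ < ∞ →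
      ∀ K : ℤ → (Fin d → ℝ) → (Fin d → ℝ) → ℂ,
        SparseDom.IsKernelFamily K →
        SparseDom.maximalNorm r K < ∞ →
        SparseDom.localizedConstant p₁ p₂ K < ∞ →
        SparseDom.sparseNorm p₁ p₂ (SparseDom.maximalTruncation K) ≤
          C * (SparseDom.maximalNorm r K + SparseDom.localizedConstant p₁ p₂ K) := by
  have : NeZero d := ⟨by omega⟩
  refine ⟨2 * SparseDom.sparseConstant d, ?_⟩
  intro r p₁ p₂ hr1 hr hp₁ hp₁t hp₂ hp₂t K hK hKr hCL
  -- `sparseNorm` ranges over strictly positive constants while the bound may be zero, hence the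
  -- `ε`.
  refine ENNReal.le_of_forall_pos_le_add fun ε hε hlt => ?_
  lift ((2 * SparseDom.sparseConstant d : ℝ≥0) : ℝ≥0∞) *
    (SparseDom.maximalNorm r K + SparseDom.localizedConstant p₁ p₂ K) to ℝ≥0 using hlt.ne with b hb
  refine iInf_le_of_le (b + ε) (iInf_le_of_le (by positivity) (iInf_le_of_le
    (SparseDom.hasSparseBound_maximalTruncation hK hr1.le hr.ne hp₁ hp₁t.ne hp₂ hp₂t.ne hKr.ne ?_)
    (by push_cast; exact le_rfl)))
  push_cast at hb ⊢
  rw [← hb]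
  exact le_self_add
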